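/- Let $X$ be an $n$-element set and write $\binom{X}{k}$ for the family of all $k$-element subsets of $X$. For families $\mathcal H\subseteq 2^X$ and $\mathcal G\subseteq 2^Y$, write $\mathcal H\subseteq_S\mathcal G$ if there is an injective map $f:X\to Y$ with $f(A)\in\mathcal G$ for every $A\in\mathcal H$, and call $\mathcal H$ and $\mathcal G$ isomorphic if $\mathcal H\subseteq_S\mathcal G$ and $\mathcal G\subseteq_S\mathcal H$. A family is intersecting if any two of its members (also when they are equal) have non-empty intersection, and $k$-uniform if all its members have exactly $k$ elements. Define the following families of $k$-subsets of $X$. - $\mathcal F_0$ is any family isomorphic to a star $\{G\in\binom{X}{k}: x\in G\}$, where $x\in X$. - $\mathcal F_1$ is any family isomorphic to a Hilton--Milner family $\{F\}\cup\{G\in\binom{X}{k}: x\in G,\ F\cap G\ne\emptyset\}$, where $F\in\binom{X}{k}$ and $x\in X\setminus F$. - For $2\le i\le k$, $\mathcal G_i$ is any family isomorphic to $\{G\in\binom{X}{k}: E\subseteq G\}\cup\{G\in\binom{X}{k}: x_0\in G,\ G\cap E\neq\emptyset\}$, where $E\subseteq X$, $|E|=i$ and $x_0\in X\setminus E$. -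 For $1\le i\le k-1$, $\mathcal J_i$ is any family isomorphic to $\{G\in\binom{X}{k}: E\subseteq G,\ G\cap J\ne\emptyset\}\cup\{G\in\binom{X}{k}: J\subseteq G\}\cup\{G\in\binom{X}{k}: x_0\in G,\ G\cap E\neq\emptyset\}$, where $E\subseteq X$, $|E|=k-1$, $J\subseteq X\setminus E$, $|J|=i+1$ and $x_0\in J$. Suppose $k\ge 3$ and $n>2k$, and let $\mathcal H$ be an intersecting $k$-uniform family on $X$. Assume that $\mathcal H\not\subseteq_S\mathcal F_0$, that $\mathcal H\not\subseteq_S\mathcal F_1$ and, if $k=3$, that $\mathcal H\not\subseteq_S\mathcal G_2$. Then $$|\mathcal H|\le\binom{n-1}{k-1}-\binom{n-k-1}{k-1}-\binom{n-k-2}{k-2}+2 .$$ Moreover, for every such $\mathcal H$: if $k=4$, equality holds if and only if $\mathcal H$ is isomorphic to $\mathcal J_2$, $\mathcal G_2$ or $\mathcal G_3$; if $k\neq 4$, equality holds if and only if $\mathcal H$ is isomorphic to $\mathcal J_2$. -/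

import Mathlib

namespace BeyondHM

/-- `SubS 𝓗 𝓖`: some injection of the ground sets maps every member of `𝓗` to a member of `𝓖`. -/
def SubS {X Y : Type*} (𝓗 : Finset (Finset X)) (𝓖 : Finset (Finset Y)) : Prop :=
  ∃ f : X ↪ Y, ∀ A ∈ 𝓗, A.map f ∈ 𝓖

/-- Isomorphism of families: each one embeds in the other. -/
def Iso {X Y : Type*} (𝓗 : Finset (Finset X)) (𝓖 : Finset (Finset Y)) : Prop :=
  SubS 𝓗 𝓖 ∧ SubS 𝓖 𝓗

variable {X : Type*} [Fintype X] [DecidableEq X]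

/-- The full star: all `k`-subsets of `X` that contain `x`. -/
def star (k : ℕ) (x : X) : Finset (Finset X) :=
  {G ∈ (Finset.univ : Finset X).powersetCard k | x ∈ G}

/-- The Hilton-Milner family: `F` itself, and all `k`-subsets that contain `x` and meet `F`. -/
def hiltonMilner (k : ℕ) (F : Finset X) (x : X) : Finset (Finset X) :=
  insert F {G ∈ (Finset.univ : Finset X).powersetCard k | x ∈ G ∧ (F ∩ G).Nonempty}

/-- The family `𝒢(E, x₀)`: all `k`-subsets that contain `E`, and all `k`-subsets that
contain `x₀` and meet `E`. -/
def familyG (k : ℕ) (E : Finset X) (x₀ : X) : Finset (Finset X) :=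
  {G ∈ (Finset.univ : Finset X).powersetCard k | E ⊆ G} ∪
    {G ∈ (Finset.univ : Finset X).powersetCard k | x₀ ∈ G ∧ (G ∩ E).Nonempty}

/-- The family `𝒥(E, J, x₀)`: all `k`-subsets that contain `E` and meet `J`, or contain `J`,
or contain `x₀` and meet `E`. -/
def familyJ (k : ℕ) (E J : Finset X) (x₀ : X) : Finset (Finset X) :=
  {G ∈ (Finset.univ : Finset X).powersetCard k | E ⊆ G ∧ (G ∩ J).Nonempty} ∪
    {G ∈ (Finset.univ : Finset X).powersetCard k | J ⊆ G} ∪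
    {G ∈ (Finset.univ : Finset X).powersetCard k | x₀ ∈ G ∧ (G ∩ E).Nonempty}

/-- `𝓗` is a copy of `𝓕₀`. -/
def IsF₀ (k : ℕ) (𝓗 : Finset (Finset X)) : Prop :=
  ∃ x : X, Iso 𝓗 (star k x)

/-- `𝓗` is a copy of `𝓕₁`. -/
def IsF₁ (k : ℕ) (𝓗 : Finset (Finset X)) : Prop :=
  ∃ (F : Finset X) (x : X), F.card = k ∧ x ∉ F ∧ Iso 𝓗 (hiltonMilner k F x)

/-- `𝓗` is a copy of `𝒢ᵢ` (used for `2 ≤ i ≤ k`). -/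
def IsG (k i : ℕ) (𝓗 : Finset (Finset X)) : Prop :=
  ∃ (E : Finset X) (x₀ : X), E.card = i ∧ x₀ ∉ E ∧ Iso 𝓗 (familyG k E x₀)

/-- `𝓗` is a copy of `𝒥ᵢ` (used for `1 ≤ i ≤ k - 1`). -/
def IsJ (k i : ℕ) (𝓗 : Finset (Finset X)) : Prop :=
  ∃ (E J : Finset X) (x₀ : X), E.card = k - 1 ∧ J.card = i + 1 ∧ Disjoint E J ∧ x₀ ∈ J ∧
    Iso 𝓗 (familyJ k E J x₀)

/-- The bound, as an integer. -/
def bound (n k : ℕ) : ℤ :=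
  ((n - 1).choose (k - 1) : ℤ) - ((n - k - 1).choose (k - 1) : ℤ)
    - ((n - k - 2).choose (k - 2) : ℤ) + 2

end BeyondHM

/-! Write k = r + 1. By Pascal's rule the bound is 2 plus the number of r-subsets of an (n-1)-set
that meet both of two (r+1)-sets sharing r points (`bound_eq`). This is the size of a family in
which exactly two members D₁, D₂ avoid a point x, with |D₁ ∩ D₂| = r, and x lies in every other
admissible set; that family is 𝒥₂. The excluded embeddings say that every point is missed by at
least two members and, for k = 3, that no three points meet every member twice (`NonTrivial`).

Suppose two points x, y meet every member (`Covered`). The members through both number at most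
C(n-2, r-1). The members through exactly one of them, with that point deleted, form two
cross-intersecting families of r-sets on n - 2 points, each with at least two members. The
inequality `cross_two` (`cross_two_pairs` for r = 2) bounds the sum of their sizes, and Pascal's
rule adds up to the theorem. Equality needs a family of size two, which leads to 𝒥₂, or r = 3 and
one of the configurations of `ExtremalThree`, which lead to 𝒢₂ and 𝒢₃.

`cross_two` is proved by shifting. In shifted families already the traces on the first 2r points are
cross-intersecting. Traces of size r are controlled by complements, smaller ones by Hilton-Milner
type bounds obtained by the same method; weighting the trace inequalities by binomial coefficients
and summing with Vandermonde's identity gives the bound. For pairs it is a direct argument.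

If no two points meet every member, the inequality is strict (`card_lt_of_not_covered`). Shifting is
continued as long as the family stays nontrivial and uncovered. If a fully shifted family is
reached, it contains {2, ..., r+2} and the trace method gives strictness. If a shift would leave at
most two members missing its new point, few members of the original avoid both points of the shift,
and the count for the links is strict. If a shift makes the family covered, equality would give it
an extremal shape, and undoing the shift refutes this. -/

open Finset

namespace BeyondHM

/-! ### Cross-intersecting families, shifted families and their traces. -/

/-- Every member of `A` meets every member of `B`. -/
def CrossInt {α : Type*} (A B : Finset (Finset α)) : Prop :=
  ∀ F ∈ A, ∀ G ∈ B, ¬ Disjoint F G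

/-- A family of sets of naturals is shifted if replacing an element of a member by a smaller one
never leaves the family. -/
def IsShifted (A : Finset (Finset ℕ)) : Prop :=
  ∀ F ∈ A, ∀ c ∈ F, ∀ d < c, d ∉ F → insert d (F.erase c) ∈ A

theorem CrossInt.symm {α : Type*} {A B : Finset (Finset α)} (h : CrossInt A B) : CrossInt B A :=
  fun F hF G hG hd => h G hG F hF hd.symm

theorem card_insert_erase {α : Type*} [DecidableEq α] {F : Finset α} {c d : α} (hc : c ∈ F)
    (hd : d ∉ F) : #(insert d (F.erase c)) = #F := by
  rw [card_insert_of_notMem (fun h => hd (mem_of_mem_erase h)), card_erase_add_one hc]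

/-- A shifted family contains every set that a member dominates. -/
theorem IsShifted.mem_of_dominated {A : Finset (Finset ℕ)} (hA : IsShifted A) {F G : Finset ℕ}
    (hF : F ∈ A) (hcard : #F = #G) (hdom : ∀ t, #(F ∩ range t) ≤ #(G ∩ range t)) : G ∈ A := by
  induction hm : #(F \ G) using Nat.strong_induction_on generalizing F with
  | _ m ih =>
  by_cases hFG : F \ G = ∅
  · rw [sdiff_eq_empty_iff_subset] at hFG
    rwa [← eq_of_subset_of_card_le hFG hcard.ge]
  have hne : (F \ G).Nonempty := nonempty_iff_ne_empty.2 hFG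
  have hne' : (G \ F).Nonempty := by
    rw [← card_pos, ← card_sdiff_comm hcard]
    exact card_pos.2 hne
  set c := (F \ G).min' hne with hc
  set d := (G \ F).min' hne' with hd
  have hcm : c ∈ F ∧ c ∉ G := mem_sdiff.1 ((F \ G).min'_mem hne)
  have hdm : d ∈ G ∧ d ∉ F := mem_sdiff.1 ((G \ F).min'_mem hne')
  have hcmin : ∀ x ∈ F, x ∉ G → c ≤ x := fun x h1 h2 => min'_le _ _ (mem_sdiff.2 ⟨h1, h2⟩)
  have hdmin : ∀ x ∈ G, x ∉ F → d ≤ x := fun x h1 h2 => min'_le _ _ (mem_sdiff.2 ⟨h1, h2⟩)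
  -- If c < d, then below c + 1 every element of G lies in F while c lies in F only, against
  -- domination at t = c + 1.
  have hdc : d < c := by
    by_contra hlt
    have hlt' : c < d := lt_of_le_of_ne (not_lt.1 hlt) (by rintro h; rw [h] at hcm; exact hcm.2 hdm.1)
    have : G ∩ range (c + 1) ⊂ F ∩ range (c + 1) := by
      rw [ssubset_iff_of_subset]
      · exact ⟨c, by simp [hcm.1], by simp [hcm.2]⟩
      · intro x hx
        simp only [mem_inter, mem_range] at hx ⊢
        refine ⟨?_, hx.2⟩
        by_contra hxF
        have := hdmin x hx.1 hxF
        omega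
    exact absurd (hdom (c + 1)) (not_le.2 (card_lt_card this))
  refine ih (#((insert d (F.erase c)) \ G)) ?_ (hA F hF c hcm.1 d hdc hdm.2)
    ((card_insert_erase hcm.1 hdm.2).trans hcard) ?_ rfl
  · rw [← hm]
    apply card_lt_card
    rw [ssubset_iff_of_subset]
    · exact ⟨c, by simp [hcm], by simp [hdc.ne']⟩
    · intro x hx
      simp only [mem_sdiff, mem_insert, mem_erase] at hx ⊢
      rcases hx with ⟨rfl | h, h2⟩
      · exact absurd hdm.1 h2
      · exact ⟨h.2, h2⟩
  -- Domination survives the exchange. Up to d the trace of F can only shrink; between d and c all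
  -- elements of F already lie in G, so the traces are nested; beyond c the count of F is unchanged.
  · intro t
    by_cases htd : t ≤ d
    · refine le_trans (card_le_card ?_) (hdom t)
      intro x hx
      simp only [mem_inter, mem_insert, mem_erase, mem_range] at hx ⊢
      refine ⟨?_, hx.2⟩
      rcases hx.1 with rfl | h
      · omega
      · exact h.2
    by_cases htc : t ≤ c
    · apply card_le_card
      intro x hx
      simp only [mem_inter, mem_insert, mem_erase, mem_range] at hx ⊢
      refine ⟨?_, hx.2⟩
      rcases hx.1 with rfl | h
      · exact hdm.1
      · by_contra hxG
        have := hcmin x h.2 hxG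
        omega
    · have : insert d (F.erase c) ∩ range t = insert d ((F ∩ range t).erase c) := by
        ext x
        simp only [mem_inter, mem_insert, mem_erase, mem_range]
        constructor
        · rintro ⟨rfl | h, h2⟩ <;> tauto
        · rintro (rfl | h)
          · exact ⟨Or.inl rfl, by omega⟩
          · tauto
      rw [this, card_insert_erase (by simp [hcm.1]; omega) (by simp [hdm.2])]
      exact hdom t

/-- The traces of size `i` on `range m` of the members of `A`. -/
def trace (m i : ℕ) (A : Finset (Finset ℕ)) : Finset (Finset ℕ) :=
  {F ∈ A | #(F ∩ range m) = i}.image (· ∩ range m)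

theorem mem_trace {m i : ℕ} {A : Finset (Finset ℕ)} {T : Finset ℕ} :
    T ∈ trace m i A ↔ ∃ F ∈ A, F ∩ range m = T ∧ #T = i := by
  simp only [trace, mem_image, mem_filter]
  constructor
  · rintro ⟨F, ⟨h1, h2⟩, rfl⟩; exact ⟨F, h1, rfl, h2⟩
  · rintro ⟨F, h1, rfl, h2⟩; exact ⟨F, ⟨h1, h2⟩, rfl⟩

theorem trace_subset (m i : ℕ) (A : Finset (Finset ℕ)) :
    trace m i A ⊆ powersetCard i (range m) := by
  intro T hT
  obtain ⟨F, -, rfl, h⟩ := mem_trace.1 hT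
  exact mem_powersetCard.2 ⟨inter_subset_right, h⟩

theorem IsShifted.trace {A : Finset (Finset ℕ)} (hA : IsShifted A) (m i : ℕ) :
    IsShifted (trace m i A) := by
  intro T hT c hc d hdc hd
  obtain ⟨F, hF, rfl, h⟩ := mem_trace.1 hT
  simp only [mem_inter, mem_range] at hc hd
  have hdF : d ∉ F := fun h => hd ⟨h, by omega⟩
  refine mem_trace.2 ⟨_, hA F hF c hc.1 d hdc hdF, ?_, ?_⟩
  · ext x
    simp only [mem_inter, mem_insert, mem_erase, mem_range]
    constructor
    · rintro ⟨rfl | h, h2⟩ <;> tauto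
    · rintro (rfl | h)
      · exact ⟨Or.inl rfl, by omega⟩
      · tauto
  · rw [card_insert_erase (by simp [hc]) (by simp only [mem_inter, mem_range]; exact hd), h]

/-- A member is determined by its trace and by its part in `Ico m n`, which is allowed to be
arbitrary here. Inequalities between traces of each size thus turn into inequalities between
families. -/
theorem card_le_sum_trace {A : Finset (Finset ℕ)} {n k m : ℕ} (hA : A ⊆ powersetCard k (range n)) :
    #A ≤ ∑ p ∈ antidiagonal k, #(trace m p.1 A) * (n - m).choose p.2 := by
  have key : A ⊆ (antidiagonal k).biUnion (fun p =>
      (trace m p.1 A ×ˢ powersetCard p.2 (Ico m n)).image (fun q => q.1 ∪ q.2)) := by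
    intro F hF
    obtain ⟨hFn, hFk⟩ := mem_powersetCard.1 (hA hF)
    simp only [mem_biUnion, mem_image, mem_product, Prod.exists, HasAntidiagonal.mem_antidiagonal]
    refine ⟨#(F ∩ range m), #(F \ range m), by rw [card_inter_add_card_sdiff, hFk],
      F ∩ range m, F \ range m, ⟨mem_trace.2 ⟨F, hF, rfl, rfl⟩, ?_⟩, ?_⟩
    · refine mem_powersetCard.2 ⟨?_, rfl⟩
      intro x hx
      simp only [mem_sdiff, mem_range, mem_Ico] at hx ⊢
      have := mem_range.1 (hFn hx.1)
      omega
    · ext x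
      simp only [mem_union, mem_inter, mem_sdiff]
      tauto
  refine (card_le_card key).trans (card_biUnion_le.trans (sum_le_sum fun p _ => ?_))
  refine card_image_le.trans ?_
  rw [card_product, card_powersetCard, Nat.card_Ico]

/-- If a common element c is at least k + l, then F and G without c are too small to cover `range (k
+ l)`, so some smaller d lies in neither. Replacing c by d in F stays in the family and shrinks F ∩
G, which permits induction. Only one of the two families has to be shifted. -/
theorem IsShifted.exists_inter_lt {A B : Finset (Finset ℕ)} {k l : ℕ} (hA : IsShifted A)
    (hkA : ∀ F ∈ A, #F = k) (hkB : ∀ F ∈ B, #F = l) (hAB : CrossInt A B) {F G : Finset ℕ}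
    (hF : F ∈ A) (hG : G ∈ B) : ∃ x ∈ F, x ∈ G ∧ x < k + l := by
  induction hm : #(F ∩ G) using Nat.strong_induction_on generalizing F with
  | _ m ih =>
  obtain ⟨c, hcF, hcG⟩ := not_disjoint_iff.1 (hAB F hF G hG)
  by_cases hc : c < k + l
  · exact ⟨c, hcF, hcG, hc⟩
  have hlt : #((F.erase c) ∪ (G.erase c)) < #(range (k + l)) := by
    refine (card_union_le _ _).trans_lt ?_
    rw [card_range, ← hkA F hF, ← hkB G hG]
    have h1 := card_erase_add_one hcF
    have h2 := card_erase_add_one hcG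
    omega
  obtain ⟨d, hd, hdn⟩ := exists_mem_notMem_of_card_lt_card hlt
  simp only [mem_range] at hd
  have hdc : d ≠ c := by omega
  simp only [mem_union, mem_erase, not_or, not_and] at hdn
  have hdF := hdn.1 hdc
  have hdG := hdn.2 hdc
  obtain ⟨x, h1, h2, h3⟩ := ih (#(insert d (F.erase c) ∩ G)) (by
    rw [← hm]
    apply card_lt_card
    rw [ssubset_iff_of_subset]
    · exact ⟨c, by simp [hcF, hcG], by simp [hdc.symm]⟩
    · intro x hx
      simp only [mem_inter, mem_insert, mem_erase] at hx ⊢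
      rcases hx with ⟨rfl | h, h2⟩
      · exact absurd h2 hdG
      · exact ⟨h.2, h2⟩) (hA F hF c hcF d (by omega) hdF) rfl
  simp only [mem_insert, mem_erase] at h1
  rcases h1 with rfl | h1
  · exact absurd h2 hdG
  · exact ⟨x, h1.2, h2, h3⟩

theorem IsShifted.trace_crossInt {A B : Finset (Finset ℕ)} {k m : ℕ} (hA : IsShifted A)
    (hkA : ∀ F ∈ A, #F = k) (hkB : ∀ F ∈ B, #F = k) (hAB : CrossInt A B) (hm : 2 * k ≤ m)
    (i j : ℕ) : CrossInt (BeyondHM.trace m i A) (BeyondHM.trace m j B) := by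
  intro T hT S hS
  obtain ⟨F, hF, rfl, -⟩ := mem_trace.1 hT
  obtain ⟨G, hG, rfl, -⟩ := mem_trace.1 hS
  obtain ⟨x, h1, h2, h3⟩ := hA.exists_inter_lt hkA hkB hAB hF hG
  refine not_disjoint_iff.2 ⟨x, ?_, ?_⟩ <;> simp only [mem_inter, mem_range] <;> 
    exact ⟨by assumption, by omega⟩

theorem mem_trace_of_subset {A : Finset (Finset ℕ)} {F : Finset ℕ} {m : ℕ} (hF : F ∈ A)
    (h : F ⊆ range m) : F ∈ trace m #F A :=
  mem_trace.2 ⟨F, hF, inter_eq_left.2 h, rfl⟩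

/-! ### The first two members of a shifted family. -/

section Initial

variable {A : Finset (Finset ℕ)} {k : ℕ}

theorem IsShifted.Ico_mem (hA : IsShifted A) (hk : ∀ F ∈ A, #F = k) (s : ℕ) {F : Finset ℕ}
    (hF : F ∈ A) (hs : ∀ x ∈ F, s ≤ x) : Ico s (s + k) ∈ A := by
  refine hA.mem_of_dominated hF (by simp [hk F hF]) fun t => ?_
  have h1 : F ∩ range t ⊆ Ico s t := by
    intro x hx
    simp only [mem_inter, mem_range, mem_Ico] at hx ⊢
    exact ⟨hs x hx.1, hx.2⟩
  have h2 : #(F ∩ range t) ≤ k := (card_le_card inter_subset_left).trans (hk F hF).le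
  have h3 := card_le_card h1
  have h4 : Ico s (s + k) ∩ range t = Ico s (min (s + k) t) := by
    ext x; simp only [mem_inter, mem_Ico, mem_range, lt_min_iff]; tauto
  rw [h4, Nat.card_Ico]
  rw [Nat.card_Ico] at h3
  omega

/-- A k-set with all elements at least s, other than the initial interval, has at most k - 1
elements below s + k; hence it dominates the interval with its last element raised by one. -/
theorem IsShifted.second_mem (hA : IsShifted A) (hk : ∀ F ∈ A, #F = k) (hk1 : 1 ≤ k) (s : ℕ)
    {F : Finset ℕ} (hF : F ∈ A) (hs : ∀ x ∈ F, s ≤ x) (hne : F ≠ Ico s (s + k)) :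
    insert (s + k) (Ico s (s + k - 1)) ∈ A := by
  have hn : s + k ∉ Ico s (s + k - 1) := by simp only [mem_Ico]; omega
  refine hA.mem_of_dominated hF (by
    rw [hk F hF, card_insert_of_notMem hn, Nat.card_Ico]; omega) fun t => ?_
  have h1 : F ∩ range t ⊆ Ico s t := by
    intro x hx
    simp only [mem_inter, mem_range, mem_Ico] at hx ⊢
    exact ⟨hs x hx.1, hx.2⟩
  have h2 : #(F ∩ range t) ≤ k := (card_le_card inter_subset_left).trans (hk F hF).le
  have h3 := card_le_card h1
  rw [Nat.card_Ico] at h3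
  by_cases ht : t ≤ s + k
  · have h4 : insert (s + k) (Ico s (s + k - 1)) ∩ range t = Ico s (min (s + k - 1) t) := by
      ext x; simp only [mem_inter, mem_insert, mem_Ico, mem_range, lt_min_iff]
      constructor
      · rintro ⟨rfl | h, h2⟩
        · omega
        · tauto
      · rintro ⟨h, h2⟩; tauto
    rw [h4, Nat.card_Ico]
    by_cases ht' : t = s + k
    · subst ht'
      have : #(F ∩ range (s + k)) ≠ k := by
        intro h
        apply hne
        have h5 : F ∩ range (s + k) = F :=
          eq_of_subset_of_card_le inter_subset_left (by rw [h, hk F hF])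
        have h6 : F ⊆ Ico s (s + k) := h5 ▸ h1
        exact eq_of_subset_of_card_le h6 (by simp [hk F hF])
      omega
    · omega
  · have h4 : insert (s + k) (Ico s (s + k - 1)) ∩ range t = insert (s + k) (Ico s (s + k - 1)) := by
      rw [inter_eq_left]
      intro x; simp only [mem_insert, mem_Ico, mem_range]; omega
    rw [h4, card_insert_of_notMem hn, Nat.card_Ico]
    omega

end Initial

/-! ### Counting sets that meet given sets. -/

section Counting

variable {α : Type*} [DecidableEq α]

theorem card_filter_disjoint {W S : Finset α} (hS : S ⊆ W) (r : ℕ) :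
    #{T ∈ powersetCard r W | Disjoint T S} = (#W - #S).choose r := by
  rw [← card_sdiff_of_subset hS, ← card_powersetCard]
  congr 1
  ext T
  simp only [mem_filter, mem_powersetCard, subset_sdiff]
  tauto

theorem card_filter_not_disjoint {W S : Finset α} (hS : S ⊆ W) (r : ℕ) :
    #{T ∈ powersetCard r W | ¬ Disjoint T S} + (#W - #S).choose r = (#W).choose r := by
  rw [← card_filter_disjoint hS, add_comm, card_filter_add_card_filter_not, card_powersetCard]

theorem card_filter_not_disjoint_two {W S T : Finset α} (hS : S ⊆ W) (hT : T ⊆ W) (r : ℕ) :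
    #{U ∈ powersetCard r W | ¬ Disjoint U S ∧ ¬ Disjoint U T} + (#W - #S).choose r +
      (#W - #T).choose r = (#W).choose r + (#W - #(S ∪ T)).choose r := by
  rw [← card_filter_disjoint hS, ← card_filter_disjoint hT,
    ← card_filter_disjoint (union_subset hS hT), ← card_powersetCard]
  have h1 := card_filter_add_card_filter_not (s := powersetCard r W)
    (fun U => ¬ Disjoint U S ∧ ¬ Disjoint U T)
  have h2 := card_union_add_card_inter {U ∈ powersetCard r W | Disjoint U S}
    {U ∈ powersetCard r W | Disjoint U T}
  rw [← filter_or, ← filter_and] at h2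
  have h3 : {U ∈ powersetCard r W | ¬ (¬ Disjoint U S ∧ ¬ Disjoint U T)} =
      {U ∈ powersetCard r W | Disjoint U S ∨ Disjoint U T} := by
    apply filter_congr; intro U _; tauto
  have h4 : {U ∈ powersetCard r W | Disjoint U (S ∪ T)} =
      {U ∈ powersetCard r W | Disjoint U S ∧ Disjoint U T} := by
    apply filter_congr; intro U _; rw [disjoint_union_right]
  rw [h3] at h1
  rw [h4]
  omega

theorem card_union_ge_succ {S T : Finset α} (hST : #S = #T) (hne : S ≠ T) :
    #S + 1 ≤ #(S ∪ T) := by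
  refine Nat.succ_le_of_lt (card_lt_card ?_)
  rw [ssubset_iff_subset_ne]
  refine ⟨subset_union_left, fun h => hne ?_⟩
  have : T ⊆ S := h ▸ subset_union_right
  exact (eq_of_subset_of_card_le this hST.le).symm

/-- The `r`-sets meeting two given distinct sets of the same size. -/
theorem card_le_of_meets_two {W S T : Finset α} {A : Finset (Finset α)} {N r s : ℕ}
    (hW : #W = N) (hA : A ⊆ powersetCard r W) (hS : S ⊆ W) (hT : T ⊆ W) (hSs : #S = s)
    (hTs : #T = s) (hne : S ≠ T) (h : ∀ F ∈ A, ¬ Disjoint F S ∧ ¬ Disjoint F T) :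
    #A + 2 * (N - s).choose r ≤ N.choose r + (N - (s + 1)).choose r := by
  have h1 : A ⊆ {U ∈ powersetCard r W | ¬ Disjoint U S ∧ ¬ Disjoint U T} :=
    fun F hF => mem_filter.2 ⟨hA hF, h F hF⟩
  have h2 := card_le_card h1
  have h3 := card_filter_not_disjoint_two hS hT r
  have h4 := card_union_ge_succ (hSs.trans hTs.symm) hne
  have h5 : (N - #(S ∪ T)).choose r ≤ (N - (s + 1)).choose r :=
    Nat.choose_le_choose _ (by omega)
  rw [hW, hSs, hTs] at h3
  omega

theorem card_le_of_meets {W S : Finset α} {A : Finset (Finset α)} {r : ℕ}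
    (hA : A ⊆ powersetCard r W) (hS : S ⊆ W) (h : ∀ F ∈ A, ¬ Disjoint F S) :
    #A + (#W - #S).choose r ≤ (#W).choose r := by
  rw [← card_filter_not_disjoint hS]
  gcongr
  exact fun F hF => mem_filter.2 ⟨hA hF, h F hF⟩

theorem card_filter_mem {V : Finset α} {x : α} (hx : x ∈ V) (k : ℕ) :
    #{F ∈ powersetCard (k + 1) V | x ∈ F} = (#V - 1).choose k := by
  rw [← card_erase_of_mem hx, ← card_powersetCard]
  refine card_bij' (fun F _ => F.erase x) (fun F _ => insert x F) ?_ ?_ ?_ ?_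
  · intro F hF
    simp only [mem_filter, mem_powersetCard] at hF ⊢
    exact ⟨erase_subset_erase _ hF.1.1, by rw [card_erase_of_mem hF.2, hF.1.2]; rfl⟩
  · intro F hF
    simp only [mem_filter, mem_powersetCard] at hF ⊢
    have hxF : x ∉ F := fun h => by simpa using hF.1 h
    refine ⟨⟨insert_subset hx (hF.1.trans (erase_subset _ _)), ?_⟩, mem_insert_self _ _⟩
    rw [card_insert_of_notMem hxF, hF.2]
  · intro F hF
    simp only [mem_filter] at hF
    exact insert_erase hF.2
  · intro F hF
    simp only [mem_powersetCard] at hF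
    exact erase_insert (fun h => by simpa using hF.1 h)

end Counting

/-! ### Binomial inequalities for the trace sizes. -/

theorem sum_choose_mul (a b c : ℕ) :
    (∑ p ∈ antidiagonal c, a.choose p.1 * b.choose p.2) = (a + b).choose c :=
  (Nat.add_choose_eq a b c).symm

/-- Pays for the extra 1 of the inductive Hilton-Milner bound at the levels i < r, where 2r - i is
at least r + 1. -/
theorem choose_trace_ineq {r i : ℕ} (h1 : 1 ≤ i) (h2 : i < r) :
    r.choose i + 1 ≤ (2 * r - i).choose i := by
  obtain ⟨j, rfl⟩ : ∃ j, i = j + 1 := ⟨i - 1, by omega⟩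
  have h3 : (r + 1).choose (j + 1) ≤ (2 * r - (j + 1)).choose (j + 1) :=
    Nat.choose_le_choose _ (by omega)
  have h4 : 0 < r.choose j := Nat.choose_pos (by omega)
  have h5 : (r + 1).choose (j + 1) = r.choose j + r.choose (j + 1) := Nat.choose_succ_succ _ _
  omega

/-- At level r - 1 equality holds only for r = 3. This is where the additional extremal families for
k = 4 come from. -/
theorem choose_trace_ineq_two_pred {r : ℕ} (hr : 3 ≤ r) :
    2 * r.choose (r - 1) + 1 ≤ (2 * r - (r - 1)).choose (r - 1) + (r - 1).choose (r - 1) ∧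
    (r ≠ 3 → 2 * r.choose (r - 1) + 1 < (2 * r - (r - 1)).choose (r - 1) +
      (r - 1).choose (r - 1)) := by
  obtain ⟨s, rfl⟩ : ∃ s, r = s + 3 := ⟨r - 3, by omega⟩
  have h1 : 2 * (s + 3) - (s + 3 - 1) = (s + 2) + 2 := by omega
  have h2 : s + 3 - 1 = s + 2 := rfl
  have h3 : (s + 3).choose (s + 2) = s + 3 := Nat.choose_succ_self_right (s + 2)
  have h4 : (s + 2 + 2).choose (s + 2) = (s + 2 + 2).choose 2 := by
    rw [← Nat.choose_symm (by omega : 2 ≤ s + 2 + 2)]; simp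
  have h5 : (s + 2 + 2).choose 2 = (s + 3) + (s + 3).choose 2 := by
    rw [Nat.choose_succ_succ' (s + 3) 1]; simp
  have h6 : (s + 3).choose 2 = (s + 2) + (s + 2).choose 2 := by
    rw [Nat.choose_succ_succ' (s + 2) 1]; simp
  have h7 : (s + 2).choose 2 = (s + 1) + (s + 1).choose 2 := by
    rw [Nat.choose_succ_succ' (s + 1) 1]; simp
  have h8 : (s + 1).choose 2 = s + s.choose 2 := by
    rw [Nat.choose_succ_succ' s 1]; simp
  rw [h1, h2, h3, h4, Nat.choose_self]
  refine ⟨by omega, fun h => by omega⟩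

theorem choose_trace_ineq_two {r i : ℕ} (hr : 3 ≤ r) (h1 : 1 ≤ i) (h2 : i < r) :
    2 * r.choose i + 1 ≤ (2 * r - i).choose i + (r - 1).choose i := by
  by_cases hi : i = r - 1
  · subst hi
    exact (choose_trace_ineq_two_pred hr).1
  obtain ⟨j, rfl⟩ : ∃ j, i = j + 1 := ⟨i - 1, by omega⟩
  obtain ⟨s, rfl⟩ : ∃ s, r = s + 1 := ⟨r - 1, by omega⟩
  have h3 : (s + 1 + 2).choose (j + 1) ≤ (2 * (s + 1) - (j + 1)).choose (j + 1) :=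
    Nat.choose_le_choose _ (by omega)
  have h4 : (s + 1 + 2).choose (j + 1) = (s + 1 + 1).choose j + (s + 1 + 1).choose (j + 1) :=
    Nat.choose_succ_succ _ _
  have h5 : (s + 1 + 1).choose (j + 1) = (s + 1).choose j + (s + 1).choose (j + 1) :=
    Nat.choose_succ_succ _ _
  have h6 : (s + 1).choose (j + 1) = s.choose j + s.choose (j + 1) := Nat.choose_succ_succ _ _
  have h7 : s.choose j ≤ (s + 1).choose j := Nat.choose_le_choose _ (by omega)
  have h8 : (s + 1).choose j ≤ (s + 1 + 1).choose j := Nat.choose_le_choose _ (by omega)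
  have h9 : 0 < (s + 1).choose j := Nat.choose_pos (by omega)
  simp only [Nat.add_sub_cancel]
  omega

/-! ### Deleting a common point, and weighted sums over trace sizes. -/

section Link

variable {α : Type*} [DecidableEq α]

theorem card_memberSubfamily_of_forall {A : Finset (Finset α)} {x : α} (h : ∀ F ∈ A, x ∈ F) :
    #(A.memberSubfamily x) = #A := by
  have h1 := card_memberSubfamily_add_card_nonMemberSubfamily x A
  have h2 : A.nonMemberSubfamily x = ∅ := by
    rw [eq_empty_iff_forall_notMem]
    intro F hF
    rw [mem_nonMemberSubfamily] at hF
    exact hF.2 (h F hF.1)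
  rw [h2, card_empty] at h1
  omega

theorem memberSubfamily_subset_powersetCard {A : Finset (Finset α)} {x : α} {V : Finset α} {k : ℕ}
    (h : A ⊆ powersetCard (k + 1) V) :
    A.memberSubfamily x ⊆ powersetCard k (V.erase x) := by
  intro F hF
  rw [mem_memberSubfamily] at hF
  obtain ⟨h1, h2⟩ := mem_powersetCard.1 (h hF.1)
  rw [card_insert_of_notMem hF.2] at h2
  exact mem_powersetCard.2 ⟨subset_erase.2 ⟨(subset_insert _ _).trans h1, hF.2⟩, by omega⟩

theorem not_disjoint_of_mem_memberSubfamily {A : Finset (Finset α)} {x : α} {S F : Finset α}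
    (hx : x ∉ S) (h : ∀ F ∈ A, x ∈ F → ¬ Disjoint F S) (hF : F ∈ A.memberSubfamily x) :
    ¬ Disjoint F S := by
  rw [mem_memberSubfamily] at hF
  intro hd
  exact h _ hF.1 (mem_insert_self _ _) (disjoint_insert_left.2 ⟨hx, hd⟩)

end Link

/-- The defect e is allowed only for j = 0, where the weight is `M.choose 0 = 1`, so it enters the
sum exactly once. -/
theorem sum_weighted_le {r M : ℕ} {a b c : ℕ → ℕ} {e : ℕ}
    (h : ∀ i j, i + j = r → a i + b i ≤ c i + (if j = 0 then e else 0)) :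
    (∑ p ∈ antidiagonal r, a p.1 * M.choose p.2) + (∑ p ∈ antidiagonal r, b p.1 * M.choose p.2) ≤
      (∑ p ∈ antidiagonal r, c p.1 * M.choose p.2) + e := by
  have he : (∑ p ∈ antidiagonal r, (if p.2 = 0 then e else 0) * M.choose p.2) = e := by
    rw [sum_eq_single (r, 0)]
    · simp
    · rintro ⟨i, j⟩ hp hne
      simp only [HasAntidiagonal.mem_antidiagonal] at hp
      have : j ≠ 0 := by rintro rfl; simp at hp; exact hne (by rw [hp])
      simp [this]
    · intro h; simp at h
  rw [← sum_add_distrib]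
  conv_rhs => rw [← he]
  rw [← sum_add_distrib]
  refine sum_le_sum fun p hp => ?_
  rw [← add_mul, ← add_mul]
  exact Nat.mul_le_mul_right _ (h _ _ (HasAntidiagonal.mem_antidiagonal.1 hp))

/-- The level i = r - 1 carries the weight `M.choose 1 = M`, so strictness there survives when M is
positive. -/
theorem sum_weighted_lt {r M : ℕ} {a b c : ℕ → ℕ} {e : ℕ}
    (h : ∀ i j, i + j = r → a i + b i ≤ c i + (if j = 0 then e else 0)) {i : ℕ}
    (hi : i + 1 = r) (hM : 0 < M) (hlt : a i + b i < c i) :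
    (∑ p ∈ antidiagonal r, a p.1 * M.choose p.2) + (∑ p ∈ antidiagonal r, b p.1 * M.choose p.2) <
      (∑ p ∈ antidiagonal r, c p.1 * M.choose p.2) + e := by
  have h' : ∀ i' j, i' + j = r →
      (if i' = i then a i' + 1 else a i') + b i' ≤ c i' + (if j = 0 then e else 0) := by
    intro i' j hij
    split_ifs with h1 h2 h2
    · omega
    · subst h1; omega
    · have := h i' j hij; simp only [h2, if_true] at this; omega
    · have := h i' j hij; simp only [h2, if_false] at this; omega
  have h1 := sum_weighted_le (M := M) (a := fun i' => if i' = i then a i' + 1 else a i') h'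
  have h2 : (∑ p ∈ antidiagonal r, a p.1 * M.choose p.2) <
      ∑ p ∈ antidiagonal r, (if p.1 = i then a p.1 + 1 else a p.1) * M.choose p.2 := by
    refine sum_lt_sum (fun p _ => Nat.mul_le_mul_right _ (by split_ifs <;> omega))
      ⟨(i, 1), by simp [hi], ?_⟩
    simp only [if_true, Nat.choose_one_right]
    exact Nat.mul_lt_mul_of_pos_right (by omega) hM
  omega

theorem sum_choose_mul_mul (s a b c : ℕ) :
    (∑ p ∈ antidiagonal c, (s * a.choose p.1) * b.choose p.2) = s * (a + b).choose c := by
  rw [← sum_choose_mul, mul_sum]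
  exact sum_congr rfl fun p _ => mul_assoc _ _ _

theorem sum_add_choose_mul (a a' b c : ℕ) :
    (∑ p ∈ antidiagonal c, (a.choose p.1 + a'.choose p.1) * b.choose p.2) =
      (a + b).choose c + (a' + b).choose c := by
  rw [← sum_choose_mul, ← sum_choose_mul, ← sum_add_distrib]
  exact sum_congr rfl fun p _ => add_mul _ _ _

/-! ### Hilton-Milner bounds for shifted families. -/

/-- On 2r points, A contains no complement of a member of B. -/
theorem CrossInt.card_add_card_le_centralBinom {α : Type*} [DecidableEq α]
    {A B : Finset (Finset α)} {W : Finset α} {r : ℕ}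
    (hW : #W = 2 * r) (hA : A ⊆ powersetCard r W) (hB : B ⊆ powersetCard r W)
    (h : CrossInt A B) : #A + #B ≤ (2 * r).choose r := by
  have h1 : #(B.image (W \ ·)) = #B := by
    refine card_image_of_injOn ?_
    intro F hF G hG hFG
    have h1 := (mem_powersetCard.1 (hB hF)).1
    have h2 := (mem_powersetCard.1 (hB hG)).1
    simp only at hFG
    rw [← Finset.sdiff_sdiff_eq_self h1, hFG, Finset.sdiff_sdiff_eq_self h2]
  have h2 : Disjoint A (B.image (W \ ·)) := by
    rw [disjoint_left]
    intro F hF hF'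
    obtain ⟨G, hG, rfl⟩ := mem_image.1 hF'
    exact h _ hF G hG sdiff_disjoint
  rw [← h1, ← card_union_of_disjoint h2, ← hW, ← card_powersetCard]
  apply card_le_card
  refine union_subset hA fun F hF => ?_
  obtain ⟨G, hG, rfl⟩ := mem_image.1 hF
  obtain ⟨h3, h4⟩ := mem_powersetCard.1 (hB hG)
  exact mem_powersetCard.2 ⟨sdiff_subset, by rw [card_sdiff_of_subset h3, hW, h4]; omega⟩

theorem CrossInt.nonempty_left_pos {α : Type*} {A B : Finset (Finset α)} (h : CrossInt A B)
    {F : Finset α} (hF : F ∈ A) (hB : B.Nonempty) : 1 ≤ #F := by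
  obtain ⟨G, hG⟩ := hB
  obtain ⟨x, hx, -⟩ := not_disjoint_iff.1 (h F hF G hG)
  exact card_pos.2 ⟨x, hx⟩

theorem sized_of_subset {α : Type*} {A : Finset (Finset α)} {V : Finset α} {k : ℕ}
    (h : A ⊆ powersetCard k V) : ∀ F ∈ A, #F = k :=
  fun _ hF => (mem_powersetCard.1 (h hF)).2

theorem IsShifted.range_mem {A : Finset (Finset ℕ)} {r : ℕ} (hA : IsShifted A)
    (hk : ∀ F ∈ A, #F = r) (hne : A.Nonempty) : range r ∈ A := by
  obtain ⟨F, hF⟩ := hne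
  have := hA.Ico_mem hk 0 hF (fun _ _ => Nat.zero_le _)
  rwa [zero_add, ← range_eq_Ico] at this

/-- If the trace of one family is empty, the trace of the other meets the initial segment. -/
theorem card_trace_le {A B : Finset (Finset ℕ)} {r : ℕ} (sA : IsShifted A) (sB : IsShifted B)
    (hA : ∀ F ∈ A, #F = r) (hB : ∀ F ∈ B, #F = r) (h : CrossInt A B) (neB : B.Nonempty) (i : ℕ) :
    #(trace (2 * r) i A) + r.choose i ≤ (2 * r).choose i := by
  have hD := mem_trace_of_subset (sB.range_mem hB neB) (range_subset_range.2 (by omega : r ≤ 2 * r))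
  have := card_le_of_meets (trace_subset (2 * r) i A) (range_subset_range.2 (by omega : r ≤ 2 * r))
    (fun F hF => sA.trace_crossInt hA hB h le_rfl i _ F hF _ hD)
  simpa [card_range, two_mul] using this

/-- Traces on the first 2r points are compared level by level. At level r complements suffice, and
the defect 1 is `r.choose r`. At a lower level, either one trace is empty and the other meets `range
r`, or both are nonempty and the induction hypothesis applies to them. -/
theorem shifted_cross_card_le {r N : ℕ} (hr : 1 ≤ r) (hN : 2 * r ≤ N) {A B : Finset (Finset ℕ)}
    (hA : A ⊆ powersetCard r (range N)) (hB : B ⊆ powersetCard r (range N))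
    (sA : IsShifted A) (sB : IsShifted B) (h : CrossInt A B) (neA : A.Nonempty)
    (neB : B.Nonempty) : #A + #B + (N - r).choose r ≤ N.choose r + 1 := by
  induction r using Nat.strong_induction_on generalizing N A B with
  | _ r ih =>
  have uA := sized_of_subset hA
  have uB := sized_of_subset hB
  have key : ∀ i j, i + j = r →
      (#(trace (2 * r) i A) + #(trace (2 * r) i B)) + r.choose i ≤
        (2 * r).choose i + (if j = 0 then 1 else 0) := by
    intro i j hij
    have hc := sA.trace_crossInt uA uB h le_rfl i i
    split_ifs with hj
    · obtain rfl : i = r := by omega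
      have := hc.card_add_card_le_centralBinom (card_range _) (trace_subset _ _ _)
        (trace_subset _ _ _)
      rw [Nat.choose_self]
      omega
    · have h1 := card_trace_le sA sB uA uB h neB i
      have h2 := card_trace_le sB sA uB uA h.symm neA i
      rcases (trace (2 * r) i A).eq_empty_or_nonempty with hA0 | hA1
      · rw [hA0, card_empty]; omega
      rcases (trace (2 * r) i B).eq_empty_or_nonempty with hB0 | hB1
      · rw [hB0, card_empty]; omega
      have hi : 1 ≤ i := by
        obtain ⟨T, hT⟩ := hA1
        rw [← sized_of_subset (trace_subset _ _ _) T hT]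
        exact hc.nonempty_left_pos hT hB1
      have h3 := ih i (by omega) hi (by omega) (trace_subset _ _ _) (trace_subset _ _ _)
        (sA.trace _ _) (sB.trace _ _) hc hA1 hB1
      have h4 := choose_trace_ineq hi (by omega : i < r)
      omega
  have h1 := sum_weighted_le (M := N - 2 * r) key
  have h2 := card_le_sum_trace (m := 2 * r) hA
  have h3 := card_le_sum_trace (m := 2 * r) hB
  rw [sum_choose_mul, sum_choose_mul] at h1
  simp only [add_mul, sum_add_distrib] at h1
  rw [show r + (N - 2 * r) = N - r by omega, show 2 * r + (N - 2 * r) = N by omega] at h1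
  omega

/-- The members of a family that all contain `x` and meet a set `S` avoiding `x`. -/
theorem card_le_of_mem_of_meets {α : Type*} [DecidableEq α] {A : Finset (Finset α)}
    {W S : Finset α} {x : α} {i : ℕ}
    (hA : A ⊆ powersetCard (i + 1) W) (hx : x ∈ W) (hxS : x ∉ S) (hS : S ⊆ W)
    (hxA : ∀ F ∈ A, x ∈ F) (h : ∀ F ∈ A, ¬ Disjoint F S) :
    #A + (#W - 1 - #S).choose i ≤ (#W - 1).choose i := by
  have := card_le_of_meets (memberSubfamily_subset_powersetCard (x := x) hA)
    (subset_erase.2 ⟨hS, hxS⟩)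
    (fun F hF => not_disjoint_of_mem_memberSubfamily hxS (fun F hF _ => h F hF) hF)
  rwa [card_memberSubfamily_of_forall hxA, card_erase_of_mem hx] at this

theorem card_le_sum_trace_succ {H : Finset (Finset ℕ)} {n r m : ℕ}
    (hH : H ⊆ powersetCard (r + 1) (range n)) (h0 : trace m 0 H = ∅) :
    #H ≤ ∑ p ∈ antidiagonal r, #(trace m (p.1 + 1) H) * (n - m).choose p.2 := by
  have := card_le_sum_trace (m := m) hH
  rwa [Nat.sum_antidiagonal_succ, h0, card_empty, zero_mul, zero_add] at this

theorem trace_zero_eq_empty {A : Finset (Finset ℕ)} {k m : ℕ} (sA : IsShifted A)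
    (uA : ∀ F ∈ A, #F = k) (h : CrossInt A A) (hm : 2 * k ≤ m) : trace m 0 A = ∅ := by
  rw [eq_empty_iff_forall_notMem]
  intro T hT
  have h1 := (sA.trace_crossInt uA uA h hm 0 0).nonempty_left_pos hT ⟨T, hT⟩
  have := sized_of_subset (trace_subset _ _ _) T hT
  omega

/-- The trace method for one family, on 2(r + 1) points. At the top level the family has at most
half of the middle layer, which is C(2r+1, r). At a lower level, either all traces contain 0 and
meet the member {1, ..., r+1}, or the induction hypothesis applies. -/
theorem shifted_intersecting_card_le {r n : ℕ} (hn : 2 * (r + 1) ≤ n) {H : Finset (Finset ℕ)}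
    (hH : H ⊆ powersetCard (r + 1) (range n)) (sH : IsShifted H) (h : CrossInt H H)
    (h0 : ∃ F ∈ H, 0 ∉ F) : #H + (n - 2 - r).choose r ≤ (n - 1).choose r + 1 := by
  induction r using Nat.strong_induction_on generalizing n H with
  | _ r ih =>
  have uH := sized_of_subset hH
  have hD : Ico 1 (1 + (r + 1)) ∈ H := by
    obtain ⟨F, hF, hF0⟩ := h0
    exact sH.Ico_mem uH 1 hF fun x hx => Nat.one_le_iff_ne_zero.2 (by rintro rfl; exact hF0 hx)
  have hDs : Ico 1 (1 + (r + 1)) ⊆ range (2 * (r + 1)) := by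
    intro x; simp only [mem_Ico, mem_range]; omega
  have hDt := mem_trace_of_subset hD hDs
  have key : ∀ i j, i + j = r → #(trace (2 * (r + 1)) (i + 1) H) + r.choose i ≤
      (2 * r + 1).choose i + (if j = 0 then 1 else 0) := by
    intro i j hij
    have hc := sH.trace_crossInt uH uH h le_rfl (i + 1) (i + 1)
    split_ifs with hj
    · obtain rfl : i = r := by omega
      have h1 := hc.card_add_card_le_centralBinom (card_range _) (trace_subset _ _ _)
        (trace_subset _ _ _)
      have h2 : (2 * (i + 1)).choose (i + 1) = 2 * (2 * i + 1).choose i := by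
        rw [show 2 * (i + 1) = 2 * i + 1 + 1 by ring, Nat.choose_succ_succ',
          Nat.choose_symm_half]
        ring
      rw [Nat.choose_self]
      omega
    · by_cases hs : ∀ T ∈ trace (2 * (r + 1)) (i + 1) H, 0 ∈ T
      · have := card_le_of_mem_of_meets (trace_subset _ _ _) (by simp) (by simp) hDs hs
          (fun F hF => sH.trace_crossInt uH uH h le_rfl (i + 1) _ F hF _ hDt)
        simp only [card_range, Nat.card_Ico] at this
        rw [show 2 * (r + 1) - 1 - (1 + (r + 1) - 1) = r by omega,
          show 2 * (r + 1) - 1 = 2 * r + 1 by omega] at this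
        omega
      · push Not at hs
        have h3 := ih i (by omega) (by omega) (trace_subset _ _ _) (sH.trace _ _) hc hs
        -- For i = 0 the traces are singletons, and {0} would be disjoint from the one that misses
        -- 0.
        have hi : 1 ≤ i := by
          by_contra hi
          obtain rfl : i = 0 := by omega
          obtain ⟨T, hT, hT0⟩ := hs
          have hT1 := sized_of_subset (trace_subset _ _ _) T hT
          have := (sH.trace _ _).range_mem (sized_of_subset (trace_subset _ _ _)) ⟨T, hT⟩
          refine hc _ this T hT ?_
          simp [hT0]
        have h4 := choose_trace_ineq hi (by omega : i < r)
        rw [show 2 * (r + 1) - 2 - i = 2 * r - i by omega,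
          show 2 * (r + 1) - 1 = 2 * r + 1 by omega] at h3
        omega
  have h1 := sum_weighted_le (M := n - 2 * (r + 1)) key
  have h2 := card_le_sum_trace_succ hH (trace_zero_eq_empty sH uH h le_rfl)
  rw [sum_choose_mul, sum_choose_mul] at h1
  rw [show r + (n - 2 * (r + 1)) = n - 2 - r by omega,
    show 2 * r + 1 + (n - 2 * (r + 1)) = n - 1 by omega] at h1
  omega

/-! ### Cross-intersecting shifted families with at least two members each. -/

/-- The extremal configurations of cross-intersecting triples other than those with a family of
size two. -/
def ExtremalThree {α : Type*} (A B : Finset (Finset α)) : Prop :=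
  (∃ z, (∀ F ∈ A, z ∈ F) ∧ ∀ F ∈ B, z ∈ F) ∨
  (∃ P : Finset α, #P = 2 ∧ (∀ F ∈ B, P ⊆ F) ∧ ∀ F ∈ A, ¬ Disjoint F P) ∨
  (∃ P : Finset α, #P = 2 ∧ (∀ F ∈ A, P ⊆ F) ∧ ∀ F ∈ B, ¬ Disjoint F P)

theorem ExtremalThree.symm {α : Type*} {A B : Finset (Finset α)} (h : ExtremalThree A B) :
    ExtremalThree B A := by
  rcases h with ⟨z, h1, h2⟩ | h | h
  · exact Or.inl ⟨z, h2, h1⟩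
  · exact Or.inr (Or.inr h)
  · exact Or.inr (Or.inl h)

/-- T contains neither S₁ nor S₂, so one point of each can be chosen off T and the pair enlarged off
T. Consequently the family of all u-sets meeting S₁ and S₂ cross-intersects no other set T of at
most their size. -/
theorem exists_disjoint_meeting {α : Type*} [DecidableEq α] {W S₁ S₂ T : Finset α} {u : ℕ}
    (hu : 2 ≤ u) (hW : u ≤ #(W \ T)) (h1 : S₁ ⊆ W) (h2 : S₂ ⊆ W) (hT1 : #T ≤ #S₁)
    (hT2 : #T ≤ #S₂) (hne1 : T ≠ S₁) (hne2 : T ≠ S₂) :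
    ∃ U ⊆ W, #U = u ∧ ¬ Disjoint U S₁ ∧ ¬ Disjoint U S₂ ∧ Disjoint U T := by
  have aux : ∀ S : Finset α, #T ≤ #S → T ≠ S → ∃ p ∈ S, p ∉ T := by
    intro S hS hne
    by_contra! hcon
    exact hne (eq_of_subset_of_card_le hcon hS).symm
  obtain ⟨p, hp1, hpT⟩ := aux S₁ hT1 hne1
  obtain ⟨q, hq1, hqT⟩ := aux S₂ hT2 hne2
  have hpq : ({p, q} : Finset α) ⊆ W \ T := by
    intro x hx
    simp only [mem_insert, mem_singleton] at hx
    rcases hx with rfl | rfl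
    · exact mem_sdiff.2 ⟨h1 hp1, hpT⟩
    · exact mem_sdiff.2 ⟨h2 hq1, hqT⟩
  obtain ⟨U, hU1, hU2, hU3⟩ := exists_subsuperset_card_eq hpq (card_le_two.trans hu) hW
  refine ⟨U, hU2.trans sdiff_subset, hU3, ?_, ?_, ?_⟩
  · exact not_disjoint_iff.2 ⟨p, hU1 (by simp), hp1⟩
  · exact not_disjoint_iff.2 ⟨q, hU1 (by simp), hq1⟩
  · exact disjoint_of_subset_left hU2 sdiff_disjoint

theorem IsShifted.exists_two_initial {B : Finset (Finset ℕ)} {r : ℕ} (sB : IsShifted B)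
    (uB : ∀ F ∈ B, #F = r) (hr : 1 ≤ r) (hB : 2 ≤ #B) :
    range r ∈ B ∧ insert r (range (r - 1)) ∈ B := by
  have h1 := sB.range_mem uB (card_pos.1 (by omega))
  refine ⟨h1, ?_⟩
  obtain ⟨F, hF, hne⟩ := exists_mem_ne (by omega : 1 < #B) (range r)
  have := sB.second_mem uB hr 0 hF (fun _ _ => Nat.zero_le _) (by
    rwa [zero_add, ← range_eq_Ico])
  rwa [zero_add, ← range_eq_Ico] at this

theorem insert_range_ne {r : ℕ} : insert r (range (r - 1)) ≠ range r := by
  intro h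
  have : r ∈ range r := h ▸ mem_insert_self _ _
  simp at this

theorem card_insert_range {r : ℕ} (hr : 1 ≤ r) : #(insert r (range (r - 1))) = r := by
  rw [card_insert_of_notMem (by simp), card_range]; omega

theorem insert_range_subset {r m : ℕ} (h : r < m) : insert r (range (r - 1)) ⊆ range m := by
  intro x; simp only [mem_insert, mem_range]; omega

theorem card_trace_le_two {A B : Finset (Finset ℕ)} {r : ℕ} (hr : 1 ≤ r) (sA : IsShifted A)
    (sB : IsShifted B) (hA : ∀ F ∈ A, #F = r) (hB : ∀ F ∈ B, #F = r) (h : CrossInt A B)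
    (h2 : 2 ≤ #B) (i : ℕ) :
    #(trace (2 * r) i A) + 2 * r.choose i ≤ (2 * r).choose i + (r - 1).choose i := by
  obtain ⟨hD1, hD2⟩ := sB.exists_two_initial hB hr h2
  have hs1 : range r ⊆ range (2 * r) := range_subset_range.2 (by omega)
  have hs2 : insert r (range (r - 1)) ⊆ range (2 * r) := insert_range_subset (by omega)
  have hc := sA.trace_crossInt hA hB h le_rfl i
  have := card_le_of_meets_two (card_range _) (trace_subset (2 * r) i A) hs1 hs2 (card_range r)
    (card_insert_range hr) insert_range_ne.symm
    (fun F hF => ⟨hc _ F hF _ (mem_trace_of_subset hD1 hs1),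
      hc _ F hF _ (mem_trace_of_subset hD2 hs2)⟩)
  rwa [show 2 * r - r = r by omega, show 2 * r - (r + 1) = r - 1 by omega] at this

/-- If the traces of size `r - 1` of one family are all the sets meeting the first two members of
the other family, then the other family has just two members. -/
theorem card_eq_two_of_trace {A B : Finset (Finset ℕ)} {r : ℕ} (hr : 3 ≤ r) (sA : IsShifted A)
    (sB : IsShifted B) (hA : ∀ F ∈ A, #F = r) (hB : ∀ F ∈ B, #F = r) (h : CrossInt A B)
    (h2 : 2 ≤ #B)
    (heq : #(trace (2 * r) (r - 1) A) + 2 * r.choose (r - 1) =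
      (2 * r).choose (r - 1) + (r - 1).choose (r - 1)) : #B = 2 := by
  obtain ⟨hD1, hD2⟩ := sB.exists_two_initial hB (by omega) h2
  have hs1 : range r ⊆ range (2 * r) := range_subset_range.2 (by omega)
  have hs2 : insert r (range (r - 1)) ⊆ range (2 * r) := insert_range_subset (by omega)
  have hc := sA.trace_crossInt hA hB h le_rfl (r - 1)
  have hc2 := card_insert_range (by omega : 1 ≤ r)
  have hsub : trace (2 * r) (r - 1) A ⊆ {U ∈ powersetCard (r - 1) (range (2 * r)) |
      ¬ Disjoint U (range r) ∧ ¬ Disjoint U (insert r (range (r - 1)))} := fun F hF =>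
    mem_filter.2 ⟨trace_subset _ _ _ hF, hc _ F hF _ (mem_trace_of_subset hD1 hs1),
      hc _ F hF _ (mem_trace_of_subset hD2 hs2)⟩
  have hfull : trace (2 * r) (r - 1) A = {U ∈ powersetCard (r - 1) (range (2 * r)) |
      ¬ Disjoint U (range r) ∧ ¬ Disjoint U (insert r (range (r - 1)))} := by
    apply eq_of_subset_of_card_le hsub
    have h3 := card_le_of_meets_two (A := {U ∈ powersetCard (r - 1) (range (2 * r)) |
      ¬ Disjoint U (range r) ∧ ¬ Disjoint U (insert r (range (r - 1)))}) (card_range _)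
      (filter_subset _ _) hs1 hs2 (card_range r) hc2 insert_range_ne.symm
      (fun F hF => (mem_filter.1 hF).2)
    rw [show 2 * r - r = r by omega, show 2 * r - (r + 1) = r - 1 by omega] at h3
    omega
  have hB2 : B ⊆ {range r, insert r (range (r - 1))} := by
    intro F hF
    have hT : F ∩ range (2 * r) = range r ∨ F ∩ range (2 * r) = insert r (range (r - 1)) := by
      by_contra! hcon
      have hTc : #(F ∩ range (2 * r)) ≤ r := (card_le_card inter_subset_left).trans (hB F hF).le
      -- The set U needs room for two points, hence r - 1 ≥ 2.
      obtain ⟨U, hU1, hU2, hU3, hU4, hU5⟩ := exists_disjoint_meeting (u := r - 1) (by omega) (by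
          rw [card_sdiff_of_subset inter_subset_right, card_range]; omega) hs1 hs2
          (by rw [card_range]; exact hTc) (by rw [hc2]; exact hTc) hcon.1 hcon.2
      have hUA : U ∈ trace (2 * r) (r - 1) A := by
        rw [hfull]
        exact mem_filter.2 ⟨mem_powersetCard.2 ⟨hU1, hU2⟩, hU3, hU4⟩
      exact hc _ U hUA _ (mem_trace.2 ⟨F, hF, rfl, rfl⟩) hU5
    simp only [mem_insert, mem_singleton]
    rcases hT with hT | hT
    · left
      refine (eq_of_subset_of_card_le (hT ▸ inter_subset_left) ?_).symm
      rw [hB F hF, card_range]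
    · right
      refine (eq_of_subset_of_card_le (hT ▸ inter_subset_left) ?_).symm
      rw [hB F hF, hc2]
  exact le_antisymm ((card_le_card hB2).trans card_le_two) h2

/-- Matches the bound for triples with the pair configuration: the N - 2 triples containing a given
pair on one side, all triples meeting it on the other. -/
theorem choose_three_identity {N : ℕ} (hN : 4 ≤ N) :
    (N - 2) + 2 * (N - 3).choose 3 = (N - 4).choose 3 + 2 + (N - 2).choose 3 := by
  obtain ⟨M, rfl⟩ : ∃ M, N = M + 4 := ⟨N - 4, by omega⟩
  have h1 : (M + 2).choose 3 = (M + 1).choose 2 + (M + 1).choose 3 := Nat.choose_succ_succ _ _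
  have h2 : (M + 1).choose 3 = M.choose 2 + M.choose 3 := Nat.choose_succ_succ _ _
  have h3 : (M + 1).choose 2 = M.choose 1 + M.choose 2 := Nat.choose_succ_succ _ _
  simp only [Nat.choose_one_right] at h3
  simp only [show M + 4 - 2 = M + 2 by omega, show M + 4 - 3 = M + 1 by omega,
    show M + 4 - 4 = M by omega]
  omega

/-- If F in A misses P, then B consists of the three sets P ∪ {y} with y in F, and any other member
of A missing P would contain F. So |A| + |B| exceeds the number of triples meeting P by at most 4,
whereas equality requires N - 2 ≥ 5. -/
theorem all_meet_of_forall_superset {α : Type*} [DecidableEq α]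
    {A B : Finset (Finset α)} {V P : Finset α} {N : ℕ}
    (hV : #V = N) (hN : 7 ≤ N) (hA : A ⊆ powersetCard 3 V) (hB : B ⊆ powersetCard 3 V)
    (h : CrossInt A B) (h3 : 3 ≤ #B) (hP : #P = 2) (hBP : ∀ F ∈ B, P ⊆ F)
    (heq : #A + #B + 2 * (N - 3).choose 3 = N.choose 3 + (N - 4).choose 3 + 2) :
    ∀ F ∈ A, ¬ Disjoint F P := by
  have uA := sized_of_subset hA
  have uB := sized_of_subset hB
  have hPV : P ⊆ V := by
    obtain ⟨G, hG⟩ := card_pos.1 (by omega : 0 < #B)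
    exact (hBP G hG).trans (mem_powersetCard.1 (hB hG)).1
  intro F hF hFP
  have hB1 : B ⊆ F.image (fun y => insert y P) := by
    intro G hG
    obtain ⟨y, hyF, hyG⟩ := not_disjoint_iff.1 (h F hF G hG)
    refine mem_image.2 ⟨y, hyF, ?_⟩
    have hyP : y ∉ P := disjoint_left.1 hFP hyF
    refine eq_of_subset_of_card_le (insert_subset hyG (hBP G hG)) ?_
    rw [card_insert_of_notMem hyP, hP, uB G hG]
  have hc1 : #B ≤ 3 := (card_le_card hB1).trans (card_image_le.trans (uA F hF).le)
  have hBeq : B = F.image (fun y => insert y P) :=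
    eq_of_subset_of_card_le hB1 (card_image_le.trans ((uA F hF).le.trans h3))
  have hA1 : A.erase F ⊆ {U ∈ powersetCard 3 V | ¬ Disjoint U P} := by
    intro F' hF'
    obtain ⟨hne, hF'⟩ := mem_erase.1 hF'
    refine mem_filter.2 ⟨hA hF', fun hd => hne ?_⟩
    refine (eq_of_subset_of_card_le ?_ ((uA F' hF').trans (uA F hF).symm).le).symm
    intro y hy
    have : insert y P ∈ B := by rw [hBeq]; exact mem_image_of_mem _ hy
    obtain ⟨x, hx1, hx2⟩ := not_disjoint_iff.1 (h F' hF' _ this)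
    rcases mem_insert.1 hx2 with rfl | hx2
    · exact hx1
    · exact absurd hx2 (disjoint_left.1 hd hx1)
  have h4 := card_le_card hA1
  rw [card_erase_of_mem hF] at h4
  have h5 := card_filter_not_disjoint hPV 3
  have h6 := choose_three_identity (by omega : 4 ≤ N)
  rw [hV, hP] at h5
  omega

/-- Nine is the number of pairs in `range 6` meeting {0, 1}, so all of them are traces of A. A
member of B missing 0 or 1 would have to contain the other five points of `range 6`. -/
theorem shifted_three_of_trace_single {A B : Finset (Finset ℕ)} {N : ℕ} (hN : 7 ≤ N)
    (hA : A ⊆ powersetCard 3 (range N)) (hB : B ⊆ powersetCard 3 (range N))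
    (sA : IsShifted A) (h : CrossInt A B) (h3 : 3 ≤ #B)
    (htr : trace 6 2 B = {{0, 1}}) (htA : #(trace 6 2 A) = 9)
    (heq : #A + #B + 2 * (N - 3).choose 3 = N.choose 3 + (N - 4).choose 3 + 2) :
    ExtremalThree A B := by
  have uA := sized_of_subset hA
  have uB := sized_of_subset hB
  have hc := sA.trace_crossInt uA uB h (le_refl 6) 2
  have hfull : trace 6 2 A = {U ∈ powersetCard 2 (range 6) | ¬ Disjoint U {0, 1}} := by
    apply eq_of_subset_of_card_le
    · exact fun U hU => mem_filter.2 ⟨trace_subset _ _ _ hU, hc 2 U hU _ (by simp [htr])⟩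
    · rw [htA]; decide
  have hBP : ∀ F ∈ B, {0, 1} ⊆ F := by
    intro F hF
    have hT : ∀ a ∈ ({0, 1} : Finset ℕ), ∀ b < 6, a ≠ b → a ∈ F ∨ b ∈ F := by
      intro a ha b hb hab
      have ha6 : a < 6 := by simp at ha; omega
      have hU : {a, b} ∈ trace 6 2 A := by
        rw [hfull]
        refine mem_filter.2 ⟨mem_powersetCard.2 ⟨?_, card_pair hab⟩, ?_⟩
        · intro x; simp only [mem_insert, mem_singleton, mem_range]; omega
        · exact not_disjoint_iff.2 ⟨a, by simp, ha⟩
      obtain ⟨x, hx1, hx2⟩ := not_disjoint_iff.1 (hc _ _ hU _ (mem_trace.2 ⟨F, hF, rfl, rfl⟩))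
      simp only [mem_insert, mem_singleton] at hx1
      rcases hx1 with rfl | rfl
      · exact Or.inl (mem_inter.1 hx2).1
      · exact Or.inr (mem_inter.1 hx2).1
    intro a ha
    by_contra haF
    have : (range 6).erase a ⊆ F := by
      intro b hb
      simp only [mem_erase, mem_range] at hb
      exact (hT a ha b hb.2 hb.1.symm).resolve_left haF
    have h1 := card_le_card this
    rw [uB F hF, card_erase_of_mem (by simp at ha ⊢; omega), card_range] at h1
    omega
  exact Or.inr (Or.inl ⟨{0, 1}, rfl, hBP,
    all_meet_of_forall_superset (card_range N) hN hA hB h h3 rfl hBP heq⟩)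

/-- Both families contain {0, 1} and {0, 2}, so a member of B missing 0 is {1, 2}. Then A has at
most the three pairs of `range 3`, and B at most the six pairs meeting {0, 1} and {0, 2}: fewer than
ten together. -/
theorem trace_pairs_subset_star {A B : Finset (Finset ℕ)} (hA : A ⊆ powersetCard 2 (range 6))
    (hB : B ⊆ powersetCard 2 (range 6)) (sA : IsShifted A)
    (sB : IsShifted B) (h : CrossInt A B) (h1 : 2 ≤ #A) (h2 : 2 ≤ #B) (hsum : #A + #B = 10) :
    ∀ F ∈ B, 0 ∈ F := by
  have uA := sized_of_subset hA
  have uB := sized_of_subset hB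
  obtain ⟨hA1, hA2⟩ := sA.exists_two_initial uA (by omega) h1
  obtain ⟨hB1, hB2⟩ := sB.exists_two_initial uB (by omega) h2
  intro F hF
  by_contra h0
  have hF12 : F = {1, 2} := by
    refine (eq_of_subset_of_card_le ?_ (uB F hF).le).symm
    obtain ⟨x, hx1, hx2⟩ := not_disjoint_iff.1 (h _ hA1 F hF)
    obtain ⟨y, hy1, hy2⟩ := not_disjoint_iff.1 (h _ hA2 F hF)
    simp only [mem_range, mem_insert] at hx1 hy1
    have hx : x = 1 := by
      have : x ≠ 0 := by rintro rfl; exact h0 hx2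
      omega
    have hy : y = 2 := by
      have : y ≠ 0 := by rintro rfl; exact h0 hy2
      omega
    subst hx hy
    intro z; simp only [mem_insert, mem_singleton]; rintro (rfl | rfl) <;> assumption
  have hA3 : A ⊆ powersetCard 2 (range 3) := by
    intro G hG
    refine mem_powersetCard.2 ⟨?_, uA G hG⟩
    obtain ⟨x, hx1, hx2⟩ := not_disjoint_iff.1 (h G hG _ hB1)
    obtain ⟨y, hy1, hy2⟩ := not_disjoint_iff.1 (h G hG _ hB2)
    obtain ⟨w, hw1, hw2⟩ := not_disjoint_iff.1 (h G hG _ hF)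
    rw [hF12] at hw2
    have h3 : ∃ a b, a ≠ b ∧ a ∈ G ∧ b ∈ G ∧ a < 3 ∧ b < 3 := by
      simp only [mem_range, mem_insert, mem_singleton] at hx2 hy2 hw2
      by_cases hxy : x = y
      · refine ⟨x, w, ?_, hx1, hw1, by omega, by omega⟩
        omega
      · exact ⟨x, y, hxy, hx1, hy1, by omega, by omega⟩
    obtain ⟨a, b, hab, haG, hbG, ha, hb⟩ := h3
    have hG' : {a, b} = G := by
      refine eq_of_subset_of_card_le ?_ ?_
      · intro z; simp only [mem_insert, mem_singleton]; rintro (rfl | rfl) <;> assumption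
      · rw [uA G hG, card_pair hab]
    rw [← hG']
    intro z; simp only [mem_insert, mem_singleton, mem_range]; omega
  have h4 := card_le_card hA3
  have h5 := card_le_of_meets_two (card_range 6) hB (range_subset_range.2 (by omega : 2 ≤ 6))
    (insert_range_subset (by omega : 2 < 6)) (card_range 2) (card_insert_range (by omega : 1 ≤ 2))
    insert_range_ne.symm (fun G hG => ⟨fun hd => h _ hA1 G hG hd.symm, fun hd => h _ hA2 G hG hd.symm⟩)
  rw [card_powersetCard, card_range] at h4
  norm_num [Nat.choose] at h4 h5
  omega

theorem shifted_three_star {A : Finset (Finset ℕ)} (uA : ∀ F ∈ A, #F = 3)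
    {B : Finset (Finset ℕ)} (hB : B ⊆ powersetCard 2 (range 6)) (h0 : ∀ F ∈ B, 0 ∈ F)
    (h5 : 5 ≤ #B) (h : ∀ F ∈ A, ∀ G ∈ B, ¬ Disjoint F G) : ∀ F ∈ A, 0 ∈ F := by
  have hBeq : B = {U ∈ powersetCard 2 (range 6) | 0 ∈ U} := by
    apply eq_of_subset_of_card_le (fun U hU => mem_filter.2 ⟨hB hU, h0 U hU⟩)
    refine le_trans ?_ h5
    decide
  intro F hF
  by_contra h0F
  have : Ico 1 6 ⊆ F := by
    intro b hb
    simp only [mem_Ico] at hb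
    have hU : {0, b} ∈ B := by
      rw [hBeq]
      refine mem_filter.2 ⟨mem_powersetCard.2 ⟨?_, card_pair (by omega)⟩, by simp⟩
      intro x; simp only [mem_insert, mem_singleton, mem_range]; omega
    obtain ⟨x, hx1, hx2⟩ := not_disjoint_iff.1 (h F hF _ hU)
    simp only [mem_insert, mem_singleton] at hx2
    rcases hx2 with rfl | rfl
    · exact absurd hx1 h0F
    · exact hx1
  have h1 := card_le_card this
  rw [uA F hF, Nat.card_Ico] at h1
  omega

/-- The trace method again, now with two initial members on each side. Since N > 2r, equality forces
equality at level r - 1. If one trace is empty there, the other is as large as possible and the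
family with the empty trace has two members. If neither is, the Hilton-Milner bound leaves only r =
3, where pairs on six points are examined. -/
theorem shifted_cross_two {r N : ℕ} (hr : 3 ≤ r) (hN : 2 * r < N) {A B : Finset (Finset ℕ)}
    (hA : A ⊆ powersetCard r (range N)) (hB : B ⊆ powersetCard r (range N))
    (sA : IsShifted A) (sB : IsShifted B) (h : CrossInt A B) (hA2 : 2 ≤ #A) (hB2 : 2 ≤ #B) :
    #A + #B + 2 * (N - r).choose r ≤ N.choose r + (N - r - 1).choose r + 2 ∧
    (#A + #B + 2 * (N - r).choose r = N.choose r + (N - r - 1).choose r + 2 →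
      #A = 2 ∨ #B = 2 ∨ (r = 3 ∧ ExtremalThree A B)) := by
  have uA := sized_of_subset hA
  have uB := sized_of_subset hB
  have key : ∀ i j, i + j = r →
      (#(trace (2 * r) i A) + #(trace (2 * r) i B)) + 2 * r.choose i ≤
        ((2 * r).choose i + (r - 1).choose i) + (if j = 0 then 2 else 0) := by
    intro i j hij
    have hc := sA.trace_crossInt uA uB h le_rfl i i
    split_ifs with hj
    · obtain rfl : i = r := by omega
      have := hc.card_add_card_le_centralBinom (card_range _) (trace_subset _ _ _)
        (trace_subset _ _ _)
      rw [Nat.choose_self]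
      omega
    · have h1 := card_trace_le_two (by omega) sA sB uA uB h hB2 i
      have h2 := card_trace_le_two (by omega) sB sA uB uA h.symm hA2 i
      rcases (trace (2 * r) i A).eq_empty_or_nonempty with hA0 | hA1
      · rw [hA0, card_empty]; omega
      rcases (trace (2 * r) i B).eq_empty_or_nonempty with hB0 | hB1
      · rw [hB0, card_empty]; omega
      have hi : 1 ≤ i := by
        obtain ⟨T, hT⟩ := hA1
        rw [← sized_of_subset (trace_subset _ _ _) T hT]
        exact hc.nonempty_left_pos hT hB1
      have h3 := shifted_cross_card_le hi (by omega) (trace_subset _ _ _) (trace_subset _ _ _)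
        (sA.trace _ _) (sB.trace _ _) hc hA1 hB1
      have h4 := choose_trace_ineq_two hr hi (by omega : i < r)
      omega
  have h1 := sum_weighted_le (M := N - 2 * r) key
  have h2 := card_le_sum_trace (m := 2 * r) hA
  have h3 := card_le_sum_trace (m := 2 * r) hB
  have e1 : r + (N - 2 * r) = N - r := by omega
  have e2 : 2 * r + (N - 2 * r) = N := by omega
  have e3 : r - 1 + (N - 2 * r) = N - r - 1 := by omega
  have hab : (∑ p ∈ antidiagonal r, (#(trace (2 * r) p.1 A) + #(trace (2 * r) p.1 B)) *
      (N - 2 * r).choose p.2) = (∑ p ∈ antidiagonal r, #(trace (2 * r) p.1 A) *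
      (N - 2 * r).choose p.2) + ∑ p ∈ antidiagonal r, #(trace (2 * r) p.1 B) *
      (N - 2 * r).choose p.2 := by
    rw [← sum_add_distrib]
    exact sum_congr rfl fun p _ => add_mul _ _ _
  rw [sum_choose_mul_mul, sum_add_choose_mul, e1, e2, e3, hab] at h1
  refine ⟨by omega, fun heq => ?_⟩
  have htop : (#(trace (2 * r) (r - 1) A) + #(trace (2 * r) (r - 1) B)) + 2 * r.choose (r - 1) =
      (2 * r).choose (r - 1) + (r - 1).choose (r - 1) := by
    have hle := key (r - 1) 1 (by omega)
    simp only [one_ne_zero, if_false, add_zero] at hle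
    refine le_antisymm hle (not_lt.1 fun hlt => ?_)
    have h4 := sum_weighted_lt (M := N - 2 * r) key (by omega : r - 1 + 1 = r) (by omega) hlt
    rw [sum_choose_mul_mul, sum_add_choose_mul, e1, e2, e3, hab] at h4
    omega
  rcases (trace (2 * r) (r - 1) A).eq_empty_or_nonempty with hA0 | hA1
  · left
    rw [hA0, card_empty, zero_add] at htop
    exact card_eq_two_of_trace hr sB sA uB uA h.symm hA2 htop
  rcases (trace (2 * r) (r - 1) B).eq_empty_or_nonempty with hB0 | hB1
  · right; left
    rw [hB0, card_empty, add_zero] at htop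
    exact card_eq_two_of_trace hr sA sB uA uB h hB2 htop
  have hc := sA.trace_crossInt uA uB h (le_refl (2 * r))
  have hr3 : r = 3 := by
    by_contra hne
    have h5 := shifted_cross_card_le (by omega) (by omega) (trace_subset _ _ _)
      (trace_subset _ _ _) (sA.trace _ _) (sB.trace _ _) (hc (r - 1) (r - 1)) hA1 hB1
    have h6 := (choose_trace_ineq_two_pred hr).2 hne
    omega
  subst hr3
  by_cases h2A : #A = 2
  · exact Or.inl h2A
  by_cases h2B : #B = 2
  · exact Or.inr (Or.inl h2B)
  refine Or.inr (Or.inr ⟨rfl, ?_⟩)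
  -- The two traces consist of ten pairs in total: either 1 + 9, or both are stars at 0 and have
  -- five each.
  replace htop : #(trace 6 2 A) + #(trace 6 2 B) + 2 * 3 = 15 + 1 := htop
  have hsingle : ∀ C : Finset (Finset ℕ), (∀ F ∈ C, #F = 2) → IsShifted C → #C = 1 →
      C = {{0, 1}} := by
    intro C uC sC hC
    have := sC.range_mem uC (card_pos.1 (by omega))
    obtain ⟨x, rfl⟩ := card_eq_one.1 hC
    rw [mem_singleton] at this
    rw [← this]; rfl
  have utA := sized_of_subset (trace_subset 6 2 A)
  have utB := sized_of_subset (trace_subset 6 2 B)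
  have hAp : 0 < #(trace 6 2 A) := card_pos.2 hA1
  have hBp : 0 < #(trace 6 2 B) := card_pos.2 hB1
  replace hc : ∀ i j, CrossInt (trace 6 i A) (trace 6 j B) := hc
  rw [show N - 3 - 1 = N - 4 by omega] at heq
  by_cases hb1 : #(trace 6 2 B) = 1
  · exact shifted_three_of_trace_single (by omega) hA hB sA h (by omega)
      (hsingle _ utB (sB.trace _ _) hb1) (by omega) heq
  by_cases ha1 : #(trace 6 2 A) = 1
  · exact (shifted_three_of_trace_single (by omega) hB hA sB h.symm (by omega)
      (hsingle _ utA (sA.trace _ _) ha1) (by omega) (by omega)).symm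
  have h0B := trace_pairs_subset_star (trace_subset 6 2 A) (trace_subset 6 2 B) (sA.trace _ _)
    (sB.trace _ _) (hc 2 2) (by omega) (by omega) (by omega)
  have h0A := trace_pairs_subset_star (trace_subset 6 2 B) (trace_subset 6 2 A) (sB.trace _ _)
    (sA.trace _ _) (hc 2 2).symm (by omega) (by omega) (by omega)
  have hle5 : ∀ C : Finset (Finset ℕ), C ⊆ powersetCard 2 (range 6) → (∀ F ∈ C, 0 ∈ F) →
      #C ≤ 5 := by
    intro C hC h0
    refine (card_le_card (fun U hU => mem_filter.2 ⟨hC hU, h0 U hU⟩ :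
      C ⊆ {U ∈ powersetCard 2 (range 6) | 0 ∈ U})).trans ?_
    decide
  have h5A := hle5 _ (trace_subset _ _ _) h0A
  have h5B := hle5 _ (trace_subset _ _ _) h0B
  refine Or.inl ⟨0, ?_, ?_⟩
  · refine shifted_three_star uA (trace_subset 6 2 B) h0B (by omega) fun F hF G hG hd => ?_
    refine hc _ _ _ (mem_trace.2 ⟨F, hF, rfl, rfl⟩) G hG ?_
    exact disjoint_of_subset_left inter_subset_left hd
  · refine shifted_three_star uB (trace_subset 6 2 A) h0A (by omega) fun F hF G hG hd => ?_
    refine hc _ _ G hG _ (mem_trace.2 ⟨F, hF, rfl, rfl⟩) ?_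
    exact (disjoint_of_subset_left inter_subset_left hd).symm

/-! ### Shifted families that no two points cover. -/

theorem IsShifted.triple_mem {A : Finset (Finset ℕ)} (sA : IsShifted A) (uA : ∀ F ∈ A, #F = 3)
    {F : Finset ℕ} (hF : F ∈ A) {c : ℕ} (hc : c ∈ F) (h2 : 2 ≤ c) : {0, 1, c} ∈ A := by
  have h3 : #({0, 1, c} : Finset ℕ) = 3 := by
    rw [card_insert_of_notMem, card_pair (by omega)]
    simp only [mem_insert, mem_singleton]; omega
  refine sA.mem_of_dominated hF (by rw [uA F hF, h3]) fun t => ?_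
  by_cases ht : t ≤ c
  · have h4 : #(F ∩ range t) ≤ 2 := by
      have : F ∩ range t ⊆ F.erase c := by
        intro x; simp only [mem_inter, mem_range, mem_erase]; rintro ⟨h, h'⟩
        exact ⟨by omega, h⟩
      refine (card_le_card this).trans ?_
      rw [card_erase_of_mem hc, uA F hF]
    have h5 : #(F ∩ range t) ≤ t := (card_le_card inter_subset_right).trans (card_range t).le
    have h6 : range (min 2 t) ⊆ {0, 1, c} ∩ range t := by
      intro x; simp only [mem_inter, mem_range, mem_insert, mem_singleton]; omega
    have h7 := card_le_card h6
    rw [card_range] at h7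
    omega
  · have : ({0, 1, c} : Finset ℕ) ∩ range t = {0, 1, c} := by
      rw [inter_eq_left]
      intro x; simp only [mem_range, mem_insert, mem_singleton]; omega
    rw [this, h3, ← uA F hF]
    exact card_le_card inter_subset_left

/-- A member with an element c ≥ s would push down to {0, 1, c}, which misses `Ico 2 s`. -/
theorem IsShifted.triples_subset {A : Finset (Finset ℕ)} (sA : IsShifted A)
    (uA : ∀ F ∈ A, #F = 3) {s : ℕ} (hs : 2 ≤ s) (h : ∀ F ∈ A, ¬ Disjoint F (Ico 2 s)) :
    A ⊆ powersetCard 3 (range s) := by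
  intro F hF
  refine mem_powersetCard.2 ⟨fun c hc => ?_, uA F hF⟩
  rw [mem_range]
  by_contra hcs
  have hm := sA.triple_mem uA hF hc (by omega)
  refine h _ hm (disjoint_left.2 fun x hx hx' => ?_)
  simp only [mem_insert, mem_singleton] at hx
  simp only [mem_Ico] at hx'
  omega

/-- The number 11 = 3 + 3 + 3 + 2 is the size estimate for the exceptional family of triples in
`card_lt_of_missing_both_le_two`. -/
theorem choose_two_lt {n : ℕ} (hn : 7 ≤ n) :
    11 + 2 * (n - 4).choose 2 < (n - 1).choose 2 + (n - 5).choose 2 + 2 := by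
  obtain ⟨m, rfl⟩ : ∃ m, n = m + 7 := ⟨n - 7, by omega⟩
  have h : ∀ a, (a + 1).choose 2 = a + a.choose 2 := fun a => by
    rw [Nat.choose_succ_succ' a 1]; simp
  simp only [show m + 7 - 4 = m + 3 by omega, show m + 7 - 1 = m + 6 by omega,
    show m + 7 - 5 = m + 2 by omega]
  have h1 := h (m + 2)
  have h2 := h (m + 3)
  have h3 := h (m + 4)
  have h4 := h (m + 5)
  simp only [Nat.add_assoc, Nat.reduceAdd] at h1 h2 h3 h4
  omega

theorem card_le_of_mem_of_meets_two {α : Type*} [DecidableEq α] {A : Finset (Finset α)}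
    {W S T : Finset α} {x : α} {i N s : ℕ} (hW : #W = N + 1)
    (hA : A ⊆ powersetCard (i + 1) W) (hx : x ∈ W) (hS : S ⊆ W) (hT : T ⊆ W) (hxS : x ∉ S)
    (hxT : x ∉ T) (hSs : #S = s) (hTs : #T = s) (hne : S ≠ T)
    (hxA : ∀ F ∈ A, x ∈ F) (h : ∀ F ∈ A, ¬ Disjoint F S ∧ ¬ Disjoint F T) :
    #A + 2 * (N - s).choose i ≤ N.choose i + (N - (s + 1)).choose i := by
  rw [← card_memberSubfamily_of_forall hxA]
  exact card_le_of_meets_two (by rw [card_erase_of_mem hx, hW]; rfl)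
    (memberSubfamily_subset_powersetCard hA) (subset_erase.2 ⟨hS, hxS⟩) (subset_erase.2 ⟨hT, hxT⟩)
    hSs hTs hne fun F hF =>
      ⟨not_disjoint_of_mem_memberSubfamily hxS (fun F hF _ => (h F hF).1) hF,
        not_disjoint_of_mem_memberSubfamily hxT (fun F hF _ => (h F hF).2) hF⟩

theorem card_star_meets_two_le {α : Type*} [DecidableEq α] {W S T : Finset α} {x : α} {i N s : ℕ}
    (hW : #W = N + 1) (hx : x ∈ W) (hS : S ⊆ W) (hT : T ⊆ W) (hxS : x ∉ S) (hxT : x ∉ T)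
    (hSs : #S = s) (hTs : #T = s) (hne : S ≠ T) :
    #{F ∈ powersetCard (i + 1) W | x ∈ F ∧ ¬ Disjoint F S ∧ ¬ Disjoint F T} +
      2 * (N - s).choose i ≤ N.choose i + (N - (s + 1)).choose i :=
  card_le_of_mem_of_meets_two hW (filter_subset _ _) hx hS hT hxS hxT hSs hTs hne
    (fun _ hF => (mem_filter.1 hF).2.1) fun _ hF => (mem_filter.1 hF).2.2

theorem shifted_uncovered_three {n : ℕ} (hn : 7 ≤ n) {H : Finset (Finset ℕ)}
    (hH : H ⊆ powersetCard 3 (range n)) (sH : IsShifted H) (h : CrossInt H H)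
    (hcov : ∃ F ∈ H, 0 ∉ F ∧ 1 ∉ F) :
    #H + 2 * (n - 4).choose 2 < (n - 1).choose 2 + (n - 5).choose 2 + 2 := by
  have uH := sized_of_subset hH
  obtain ⟨F, hF, h0, h1⟩ := hcov
  have hD := sH.Ico_mem uH 2 hF fun x hx => by
    have : x ≠ 0 := by rintro rfl; exact h0 hx
    have : x ≠ 1 := by rintro rfl; exact h1 hx
    omega
  have h2 := card_le_card (sH.triples_subset uH (by omega) fun G hG => h G hG _ hD)
  rw [card_powersetCard, card_range] at h2
  norm_num [Nat.choose] at h2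
  have := choose_two_lt hn
  omega

/-- A member missing 0 and 1 puts {2, ..., r+2} into the family, besides the two initial sets D₁, D₂
that miss 0. The trace method with D₁, D₂ gives the weak inequality; the additional member makes
level r - 1 strict. -/
theorem shifted_uncovered_lt {r n : ℕ} (hr : 2 ≤ r) (hn : 2 * (r + 1) < n) {H : Finset (Finset ℕ)}
    (hH : H ⊆ powersetCard (r + 1) (range n)) (sH : IsShifted H) (h : CrossInt H H)
    (hcov : ∃ F ∈ H, 0 ∉ F ∧ 1 ∉ F) :
    #H + 2 * (n - 2 - r).choose r < (n - 1).choose r + (n - 3 - r).choose r + 2 := by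
  by_cases hr3 : r = 2
  · subst hr3
    exact shifted_uncovered_three (by omega) hH sH h hcov
  have uH := sized_of_subset hH
  obtain ⟨F₀, hF₀, hF₀0, hF₀1⟩ := hcov
  have hge : ∀ x ∈ F₀, 2 ≤ x := fun x hx => by
    have : x ≠ 0 := by rintro rfl; exact hF₀0 hx
    have : x ≠ 1 := by rintro rfl; exact hF₀1 hx
    omega
  have hD := sH.Ico_mem uH 2 hF₀ hge
  have hD1 := sH.Ico_mem uH 1 hF₀ fun x hx => (by omega : 1 ≤ 2).trans (hge x hx)
  have hD2 := sH.second_mem uH (by omega) 1 hF₀ (fun x hx => (by omega : 1 ≤ 2).trans (hge x hx))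
    (by rintro rfl; exact hF₀1 (by simp))
  set D₁ := Ico 1 (1 + (r + 1)) with hD₁
  set D₂ := insert (1 + (r + 1)) (Ico 1 (1 + (r + 1) - 1)) with hD₂
  have hs1 : D₁ ⊆ range (2 * (r + 1)) := by
    intro x; simp only [hD₁, mem_Ico, mem_range]; omega
  have hs2 : D₂ ⊆ range (2 * (r + 1)) := by
    intro x; simp only [hD₂, mem_insert, mem_Ico, mem_range]; omega
  have hsD : Ico 2 (2 + (r + 1)) ⊆ range (2 * (r + 1)) := by
    intro x; simp only [mem_Ico, mem_range]; omega
  have hne : D₁ ≠ D₂ := by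
    intro h
    have : 1 + (r + 1) ∈ D₁ := h ▸ mem_insert_self _ _
    simp [hD₁] at this
  have h01 : 0 ∉ D₁ := by simp [hD₁]
  have h02 : 0 ∉ D₂ := by simp [hD₂]
  have hm : (0 : ℕ) ∈ range (2 * (r + 1)) := by simp
  have hW : #(range (2 * (r + 1))) = (2 * r + 1) + 1 := by rw [card_range]; ring
  have e1 : 2 * r + 1 - (r + 1) = r := by omega
  have e2 : 2 * r + 1 - (r + 1 + 1) = r - 1 := by omega
  have hcross := sH.trace_crossInt uH uH h (le_refl (2 * (r + 1)))
  have hmeet : ∀ i, ∀ F ∈ trace (2 * (r + 1)) i H, ¬ Disjoint F D₁ ∧ ¬ Disjoint F D₂ := fun i F hF =>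
    ⟨hcross _ _ F hF _ (mem_trace_of_subset hD1 hs1),
      hcross _ _ F hF _ (mem_trace_of_subset hD2 hs2)⟩
  have key : ∀ i j, i + j = r → #(trace (2 * (r + 1)) (i + 1) H) + 2 * r.choose i ≤
      ((2 * r + 1).choose i + (r - 1).choose i) + (if j = 0 then 2 else 0) := by
    intro i j hij
    have hc := hcross (i + 1) (i + 1)
    split_ifs with hj
    · obtain rfl : i = r := by omega
      have h1 := hc.card_add_card_le_centralBinom (card_range _) (trace_subset _ _ _)
        (trace_subset _ _ _)
      have h2 : (2 * (i + 1)).choose (i + 1) = 2 * (2 * i + 1).choose i := by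
        rw [show 2 * (i + 1) = 2 * i + 1 + 1 by ring, Nat.choose_succ_succ',
          Nat.choose_symm_half]
        ring
      rw [Nat.choose_self]
      omega
    · by_cases hs : ∀ T ∈ trace (2 * (r + 1)) (i + 1) H, 0 ∈ T
      · have := card_le_of_mem_of_meets_two hW (trace_subset _ _ _) hm hs1 hs2 h01 h02
          (uH _ hD1) (uH _ hD2) hne hs (hmeet (i + 1))
        rw [e1, e2] at this
        omega
      · push Not at hs
        have h3 := shifted_intersecting_card_le (by omega) (trace_subset _ _ _) (sH.trace _ _)
          hc hs
        have hi : 1 ≤ i := by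
          by_contra hi
          obtain rfl : i = 0 := by omega
          obtain ⟨T, hT, hT0⟩ := hs
          have := (sH.trace _ _).range_mem (sized_of_subset (trace_subset _ _ _)) ⟨T, hT⟩
          refine hc _ this T hT ?_
          simp [hT0]
        have h4 := choose_trace_ineq_two (by omega) hi (by omega : i < r)
        rw [show 2 * (r + 1) - 2 - i = 2 * r - i by omega,
          show 2 * (r + 1) - 1 = 2 * r + 1 by omega] at h3
        omega
  have htop : #(trace (2 * (r + 1)) (r - 1 + 1) H) + 2 * r.choose (r - 1) <
      (2 * r + 1).choose (r - 1) + (r - 1).choose (r - 1) := by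
    have hle := key (r - 1) 1 (by omega)
    simp only [one_ne_zero, if_false, add_zero] at hle
    refine lt_of_le_of_ne hle fun heq => ?_
    have hc := hcross (r - 1 + 1) (r - 1 + 1)
    by_cases hs : ∀ T ∈ trace (2 * (r + 1)) (r - 1 + 1) H, 0 ∈ T
    · have hfull : trace (2 * (r + 1)) (r - 1 + 1) H =
          {F ∈ powersetCard (r - 1 + 1) (range (2 * (r + 1))) |
            0 ∈ F ∧ ¬ Disjoint F D₁ ∧ ¬ Disjoint F D₂} := by
        apply eq_of_subset_of_card_le
        · exact fun F hF => mem_filter.2 ⟨trace_subset _ _ _ hF, hs F hF, hmeet _ F hF⟩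
        · have := card_star_meets_two_le (i := r - 1) hW hm hs1 hs2 h01 h02 (uH _ hD1) (uH _ hD2) hne
          rw [e1, e2] at this
          omega
      -- Equality would make every set {0} ∪ U with U meeting D₁ and D₂ a trace, including one that
      -- misses {2, ..., r+2}.
      obtain ⟨U, hU1, hU2, hU3, hU4, hU5⟩ := exists_disjoint_meeting
        (W := Ico 1 (2 * (r + 1))) (S₁ := D₁) (S₂ := D₂) (T := Ico 2 (2 + (r + 1))) (u := r - 1)
        (by omega) (by
          rw [card_sdiff_of_subset, Nat.card_Ico, Nat.card_Ico]
          · omega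
          · intro x; simp only [mem_Ico]; omega)
        (by intro x; simp only [hD₁, mem_Ico]; omega)
        (by intro x; simp only [hD₂, mem_insert, mem_Ico]; omega)
        (by rw [uH _ hD, uH _ hD1]) (by rw [uH _ hD, uH _ hD2])
        (by
          intro h
          have : 1 ∈ Ico 2 (2 + (r + 1)) := by rw [h, hD₁, mem_Ico]; omega
          simp at this)
        (by
          intro h
          have : 1 ∈ Ico 2 (2 + (r + 1)) := by
            rw [h, hD₂]; simp only [mem_insert, mem_Ico]; omega
          simp at this)
      have h0U : 0 ∉ U := fun h => by simpa using hU1 h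
      have hUm : insert 0 U ∈ trace (2 * (r + 1)) (r - 1 + 1) H := by
        rw [hfull]
        refine mem_filter.2 ⟨mem_powersetCard.2 ⟨insert_subset hm (hU1.trans ?_), ?_⟩,
          mem_insert_self _ _, ?_, ?_⟩
        · intro x; simp only [mem_Ico, mem_range]; omega
        · rw [card_insert_of_notMem h0U, hU2]
        · exact fun h => hU3 (disjoint_of_subset_left (subset_insert _ _) h)
        · exact fun h => hU4 (disjoint_of_subset_left (subset_insert _ _) h)
      refine hcross _ _ _ hUm _ (mem_trace_of_subset hD hsD) ?_
      exact disjoint_insert_left.2 ⟨by simp, hU5⟩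
    · push Not at hs
      by_cases hr4 : r = 3
      · subst hr4
        -- For r = 3 the binomial inequality is not strict. However, all traces of size 3 meet {2,
        -- ..., 5}, hence lie in `range 6`; being intersecting there are at most ten, not the
        -- sixteen needed for equality.
        have hsub : trace 8 3 H ⊆ powersetCard 3 (range 6) :=
          (sH.trace 8 3).triples_subset (sized_of_subset (trace_subset _ _ _)) (by omega)
            fun F hF => hcross _ _ F hF _ (mem_trace_of_subset hD hsD)
        have h5 : #(trace 8 3 H) + #(trace 8 3 H) ≤ 20 :=
          CrossInt.card_add_card_le_centralBinom (r := 3) (card_range 6) hsub hsub hc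
        replace heq : #(trace 8 3 H) + 2 * 3 = 21 + 1 := heq
        omega
      · have h3 := shifted_intersecting_card_le (by omega) (trace_subset _ _ _) (sH.trace _ _)
          hc hs
        have h4 := (choose_trace_ineq_two_pred (by omega : 3 ≤ r)).2 hr4
        rw [show 2 * (r + 1) - 2 - (r - 1) = 2 * r - (r - 1) by omega,
          show 2 * (r + 1) - 1 = 2 * r + 1 by omega] at h3
        omega
  have h1 := sum_weighted_lt (M := n - 2 * (r + 1)) key (by omega : r - 1 + 1 = r) (by omega) htop
  have h2 := card_le_sum_trace_succ hH (trace_zero_eq_empty sH uH h le_rfl)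
  rw [sum_choose_mul_mul, sum_add_choose_mul] at h1
  rw [show r + (n - 2 * (r + 1)) = n - 2 - r by omega,
    show 2 * r + 1 + (n - 2 * (r + 1)) = n - 1 by omega,
    show r - 1 + (n - 2 * (r + 1)) = n - 3 - r by omega] at h1
  omega

/-! ### The shift operation. -/

section Shift

variable {α : Type*} [DecidableEq α]

/-- The shift replacing `j` by `i`. -/
def shift (i j : α) (A : Finset (Finset α)) : Finset (Finset α) := UV.compression {i} {j} A

theorem compress_singleton {i j : α} (hij : i ≠ j) (F : Finset α) :
    UV.compress {i} {j} F = if j ∈ F ∧ i ∉ F then insert i (F.erase j) else F := by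
  unfold UV.compress
  have : (Disjoint ({i} : Finset α) F ∧ {j} ≤ F) ↔ (j ∈ F ∧ i ∉ F) := by
    simp [and_comm]
  simp only [this]
  split_ifs with h
  · ext x
    simp only [sup_eq_union, mem_sdiff, mem_union, mem_singleton, mem_insert, mem_erase]
    constructor
    · rintro ⟨h1 | h1, h2⟩ <;> tauto
    · rintro (rfl | h1)
      · exact ⟨Or.inr rfl, hij⟩
      · tauto
  · rfl

theorem insert_erase_insert_erase {i j : α} {F : Finset α} (hi : i ∈ F) (hj : j ∉ F) :
    insert i ((insert j (F.erase i)).erase j) = F := by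
  rw [erase_insert (fun h => hj (mem_of_mem_erase h)), insert_erase hi]

theorem mem_shift {i j : α} (hij : i ≠ j) {A : Finset (Finset α)} {F : Finset α} :
    F ∈ shift i j A ↔ (F ∈ A ∧ (j ∈ F → i ∉ F → insert i (F.erase j) ∈ A)) ∨
      (F ∉ A ∧ i ∈ F ∧ j ∉ F ∧ insert j (F.erase i) ∈ A) := by
  unfold shift
  rw [UV.mem_compression, compress_singleton hij]
  refine or_congr ?_ ?_
  · split_ifs with h <;> tauto
  · refine and_congr_right fun hF => ?_
    constructor
    · rintro ⟨G, hG, hGF⟩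
      rw [compress_singleton hij] at hGF
      split_ifs at hGF with h
      · subst hGF
        refine ⟨mem_insert_self _ _, ?_, ?_⟩
        · simp [hij.symm]
        · rwa [insert_erase_insert_erase h.1 h.2]
      · exact absurd (hGF ▸ hG) hF
    · rintro ⟨h1, h2, h3⟩
      refine ⟨_, h3, ?_⟩
      rw [compress_singleton hij, if_pos, insert_erase_insert_erase h1 h2]
      exact ⟨mem_insert_self _ _, by simp [hij]⟩

theorem mem_shift_or {i j : α} (hij : i ≠ j) {A : Finset (Finset α)} {F : Finset α} (hF : F ∈ A) :
    F ∈ shift i j A ∨ (j ∈ F ∧ i ∉ F ∧ insert i (F.erase j) ∉ A ∧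
      insert i (F.erase j) ∈ shift i j A) := by
  by_cases h : j ∈ F ∧ i ∉ F ∧ insert i (F.erase j) ∉ A
  · refine Or.inr ⟨h.1, h.2.1, h.2.2, (mem_shift hij).2 (Or.inr ⟨h.2.2, mem_insert_self _ _, ?_, ?_⟩)⟩
    · simp [hij.symm]
    · rwa [insert_erase_insert_erase h.1 h.2.1]
  · refine Or.inl ((mem_shift hij).2 (Or.inl ⟨hF, ?_⟩))
    tauto

theorem card_shift (i j : α) (A : Finset (Finset α)) : #(shift i j A) = #A :=
  UV.card_compression _ _ _

theorem shift_subset_powersetCard {i j : α} (hij : i ≠ j) {A : Finset (Finset α)} {V : Finset α}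
    {k : ℕ} (hi : i ∈ V) (hA : A ⊆ powersetCard k V) : shift i j A ⊆ powersetCard k V := by
  intro F hF
  rcases (mem_shift hij).1 hF with h | ⟨-, h1, h2, h3⟩
  · exact hA h.1
  · obtain ⟨h4, h5⟩ := mem_powersetCard.1 (hA h3)
    refine mem_powersetCard.2 ⟨?_, ?_⟩
    · rw [← insert_erase_insert_erase h1 h2]
      exact insert_subset hi ((erase_subset _ _).trans h4)
    · rw [← h5, card_insert_erase h1 h2]

theorem CrossInt.shift {i j : α} (hij : i ≠ j) {A B : Finset (Finset α)} (h : CrossInt A B) :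
    CrossInt (shift i j A) (BeyondHM.shift i j B) := by
  -- The case of a retained F against a new G. If they were disjoint, then F, or its exchange when j
  -- lies in F (which is in A because F was retained), would be disjoint from the set that G came
  -- from.
  have aux : ∀ {A B : Finset (Finset α)}, CrossInt A B → ∀ F ∈ A,
      (j ∈ F → i ∉ F → insert i (F.erase j) ∈ A) → ∀ G, i ∈ G → j ∉ G →
      insert j (G.erase i) ∈ B → ¬ Disjoint F G := by
    intro A B h F hF hF' G hiG hjG hG hd
    by_cases hi : i ∈ F
    · exact disjoint_left.1 hd hi hiG
    by_cases hj : j ∈ F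
    · obtain ⟨x, hx1, hx2⟩ := not_disjoint_iff.1 (h _ (hF' hj hi) _ hG)
      simp only [mem_insert, mem_erase] at hx1 hx2
      rcases hx1 with rfl | hx1
      · rcases hx2 with hx2 | hx2
        · exact hij hx2
        · exact hx2.1 rfl
      · rcases hx2 with hx2 | hx2
        · exact hx1.1 hx2
        · exact disjoint_left.1 hd hx1.2 hx2.2
    · obtain ⟨x, hx1, hx2⟩ := not_disjoint_iff.1 (h _ hF _ hG)
      simp only [mem_insert, mem_erase] at hx2
      rcases hx2 with rfl | hx2
      · exact hj hx1
      · exact disjoint_left.1 hd hx1 hx2.2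
  intro F hF G hG
  rcases (mem_shift hij).1 hF with ⟨h1, h2⟩ | ⟨h1, h2, h3, h4⟩
  · rcases (mem_shift hij).1 hG with ⟨h5, h6⟩ | ⟨h5, h6, h7, h8⟩
    · exact h F h1 G h5
    · exact aux h F h1 h2 G h6 h7 h8
  · rcases (mem_shift hij).1 hG with ⟨h5, h6⟩ | ⟨h5, h6, h7, h8⟩
    · exact fun hd => aux h.symm G h5 h6 F h2 h3 h4 hd.symm
    · exact not_disjoint_iff.2 ⟨i, h2, h6⟩

theorem shift_filter_notMem {i j x : α} (hij : i ≠ j) (hxi : x ≠ i) (hxj : x ≠ j)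
    (A : Finset (Finset α)) :
    {F ∈ shift i j A | x ∉ F} = shift i j {F ∈ A | x ∉ F} := by
  ext F
  simp only [mem_filter, mem_shift hij, mem_insert, mem_erase]
  tauto

end Shift

/-- The total of all elements of all members. -/
def weight (A : Finset (Finset ℕ)) : ℕ := ∑ F ∈ A, ∑ x ∈ F, x

theorem shift_eq_image {α : Type*} [DecidableEq α] (i j : α) (A : Finset (Finset α)) :
    shift i j A = A.image (fun F => if UV.compress {i} {j} F ∈ A then F else
      UV.compress {i} {j} F) := by
  symm
  apply eq_of_subset_of_card_le
  · intro F hF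
    obtain ⟨G, hG, rfl⟩ := mem_image.1 hF
    refine UV.mem_compression.2 ?_
    split_ifs with h
    · exact Or.inl ⟨hG, h⟩
    · exact Or.inr ⟨h, G, hG, rfl⟩
  · rw [card_shift, card_image_of_injOn]
    intro F hF G hG hFG
    simp only at hFG
    split_ifs at hFG with h1 h2 h2
    · exact hFG
    · exact absurd (hFG ▸ hF) h2
    · exact absurd (hFG.symm ▸ hG) h1
    · exact UV.compress_injOn (by simpa using ⟨hF, h1⟩) (by simpa using ⟨hG, h2⟩) hFG

theorem weight_shift {i j : ℕ} (hij : i < j) (A : Finset (Finset ℕ)) :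
    weight (shift i j A) ≤ weight A ∧ (shift i j A ≠ A → weight (shift i j A) < weight A) := by
  have hinj : Set.InjOn (fun F => if UV.compress {i} {j} F ∈ A then F else
      UV.compress {i} {j} F) A := by
    rw [← card_image_iff, ← shift_eq_image, card_shift]
  have hsum : weight (shift i j A) = ∑ F ∈ A, ∑ x ∈ (if UV.compress {i} {j} F ∈ A then F else
      UV.compress {i} {j} F), x := by
    rw [weight, shift_eq_image, sum_image hinj]
  have hc : ∀ F : Finset ℕ, (∑ x ∈ UV.compress {i} {j} F, x ≤ ∑ x ∈ F, x) ∧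
      (UV.compress {i} {j} F ≠ F → ∑ x ∈ UV.compress {i} {j} F, x < ∑ x ∈ F, x) := by
    intro F
    rw [compress_singleton hij.ne]
    split_ifs with h
    · have h1 : ∑ x ∈ insert i (F.erase j), x = i + ∑ x ∈ F.erase j, x :=
        sum_insert (fun h' => h.2 (mem_of_mem_erase h'))
      have h2 := add_sum_erase F (fun x => x) h.1
      refine ⟨by omega, fun _ => by omega⟩
    · exact ⟨le_rfl, fun h => absurd rfl h⟩
  have hle : ∀ F ∈ A, ∑ x ∈ (if UV.compress {i} {j} F ∈ A then F else
      UV.compress {i} {j} F), x ≤ ∑ x ∈ F, x := by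
    intro F _
    split_ifs
    · exact le_rfl
    · exact (hc F).1
  rw [hsum]
  refine ⟨sum_le_sum hle, fun hne => sum_lt_sum hle ?_⟩
  have : ∃ F ∈ A, UV.compress {i} {j} F ∉ A := by
    by_contra! hcon
    apply hne
    rw [shift_eq_image]
    ext G
    simp only [mem_image]
    constructor
    · rintro ⟨F, hF, rfl⟩
      rwa [if_pos (hcon F hF)]
    · intro hG
      exact ⟨G, hG, if_pos (hcon G hG)⟩
  obtain ⟨F, hF, hFn⟩ := this
  refine ⟨F, hF, ?_⟩
  rw [if_neg hFn]
  exact (hc F).2 fun h => hFn (h.symm ▸ hF)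

theorem exists_shift_ne {A : Finset (Finset ℕ)} (h : ¬ IsShifted A) :
    ∃ F ∈ A, ∃ j ∈ F, ∃ i < j, i ∉ F ∧ shift i j A ≠ A := by
  unfold IsShifted at h
  push Not at h
  obtain ⟨F, hF, j, hj, i, hij, hi, hn⟩ := h
  refine ⟨F, hF, j, hj, i, hij, hi, fun heq => ?_⟩
  rw [← heq, mem_shift hij.ne] at hF
  rcases hF with h | h
  · exact hn (h.2 hj hi)
  · exact hi h.2.1

/-! ### Undoing a shift of an extremal configuration. -/

section Unshift

variable {α : Type*} [DecidableEq α]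

theorem forall_mem_of_shift {i j z : α} (hij : i ≠ j) (hz : z ≠ i) {A : Finset (Finset α)}
    (h : ∀ F ∈ shift i j A, z ∈ F) : ∀ F ∈ A, z ∈ F := by
  intro F hF
  rcases mem_shift_or hij hF with h1 | ⟨-, -, -, h1⟩
  · exact h F h1
  · have := h _ h1
    simp only [mem_insert, mem_erase] at this
    tauto

theorem forall_meets_of_shift {i j : α} (hij : i ≠ j) {P : Finset α} (hP : i ∉ P)
    {A : Finset (Finset α)} (h : ∀ F ∈ shift i j A, ¬ Disjoint F P) : ∀ F ∈ A, ¬ Disjoint F P := by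
  intro F hF
  rcases mem_shift_or hij hF with h1 | ⟨-, -, -, h1⟩
  · exact h F h1
  · obtain ⟨x, hx1, hx2⟩ := not_disjoint_iff.1 (h _ h1)
    simp only [mem_insert, mem_erase] at hx1
    refine not_disjoint_iff.2 ⟨x, ?_, hx2⟩
    rcases hx1 with rfl | hx1
    · exact absurd hx2 hP
    · exact hx1.2

/-- Two full stars of triples with a common centre also attain the bound. -/
theorem choose_three_star_identity {N : ℕ} (hN : 4 ≤ N) :
    2 * (N - 1).choose 2 + 2 * (N - 3).choose 3 = N.choose 3 + (N - 4).choose 3 + 2 := by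
  obtain ⟨M, rfl⟩ : ∃ M, N = M + 4 := ⟨N - 4, by omega⟩
  simp only [show M + 4 - 1 = M + 3 by omega, show M + 4 - 3 = M + 1 by omega,
    show M + 4 - 4 = M by omega]
  have h2 : ∀ a, (a + 1).choose 2 = a + a.choose 2 := fun a => by
    rw [Nat.choose_succ_succ' a 1]; simp
  have h3 : ∀ a, (a + 1).choose 3 = a.choose 2 + a.choose 3 := fun a => Nat.choose_succ_succ' a 2
  have a1 := h3 (M + 3)
  have a2 := h3 (M + 2)
  have a3 := h3 (M + 1)
  have a4 := h3 M
  have b1 := h2 (M + 2)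
  have b2 := h2 (M + 1)
  have b3 := h2 M
  simp only [Nat.add_assoc, Nat.reduceAdd] at *
  omega

/-- Undoing a shift that produces the star at the new element. -/
theorem star_of_shift_star {V : Finset α} {N : ℕ} (hV : #V = N) (hN : 7 ≤ N) {i j : α}
    (hij : i ≠ j) (hi : i ∈ V) (hj : j ∈ V) {A B : Finset (Finset α)}
    (hA : shift i j A = {F ∈ powersetCard 3 V | i ∈ F})
    (hB : shift i j B = {F ∈ powersetCard 3 V | i ∈ F}) (h : CrossInt A B) :
    ((∀ F ∈ A, i ∈ F) ∧ ∀ F ∈ B, i ∈ F) ∨ ((∀ F ∈ A, j ∈ F) ∧ ∀ F ∈ B, j ∈ F) := by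
  set W := (V.erase i).erase j with hW
  have hWc : #W = N - 2 := by
    rw [hW, card_erase_of_mem (mem_erase.2 ⟨hij.symm, hj⟩), card_erase_of_mem hi, hV]; rfl
  have hiW : i ∉ W := by simp [hW]
  have hjW : j ∉ W := by simp [hW]
  have hWV : W ⊆ V := (erase_subset _ _).trans (erase_subset _ _)
  -- With `notboth`: for each pair Q in W, exactly one of Q ∪ {i} and Q ∪ {j} belongs to the
  -- unshifted family.
  have insmem : ∀ C : Finset (Finset α), shift i j C = {F ∈ powersetCard 3 V | i ∈ F} →
      ∀ Q ⊆ W, #Q = 2 → (insert i Q ∈ C ∨ insert j Q ∈ C) := by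
    intro C hC Q hQ hQ2
    have hiQ : i ∉ Q := fun h => hiW (hQ h)
    have hm : insert i Q ∈ shift i j C := by
      rw [hC, mem_filter, mem_powersetCard, card_insert_of_notMem hiQ, hQ2]
      exact ⟨⟨insert_subset hi (hQ.trans hWV), rfl⟩, mem_insert_self _ _⟩
    rcases (mem_shift hij).1 hm with h1 | ⟨-, -, -, h1⟩
    · exact Or.inl h1.1
    · right; rwa [erase_insert hiQ] at h1
  have notboth : ∀ C : Finset (Finset α), shift i j C = {F ∈ powersetCard 3 V | i ∈ F} →
      ∀ Q ⊆ W, ¬ (insert i Q ∈ C ∧ insert j Q ∈ C) := by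
    rintro C hC Q hQ ⟨h1, h2⟩
    have hiQ : i ∉ Q := fun h => hiW (hQ h)
    have hjQ : j ∉ Q := fun h => hjW (hQ h)
    have hm : insert j Q ∈ shift i j C := by
      refine (mem_shift hij).2 (Or.inl ⟨h2, fun _ _ => ?_⟩)
      rwa [erase_insert hjQ]
    rw [hC, mem_filter] at hm
    simp [hij, hiQ] at hm
  have disj : ∀ Q ⊆ W, ∀ R ⊆ W, Disjoint Q R → Disjoint (insert i Q) (insert j R) := by
    intro Q hQ R hR hd
    rw [disjoint_insert_left, disjoint_insert_right]
    refine ⟨?_, fun h => hjW (hQ h), hd⟩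
    simp only [mem_insert, not_or]
    exact ⟨hij, fun h => hiW (hR h)⟩
  have stepA : ∀ Q ⊆ W, #Q = 2 → ∀ R ⊆ W, #R = 2 → Disjoint Q R →
      insert i Q ∈ A → insert i R ∈ B := by
    intro Q hQ hQ2 R hR hR2 hd hQA
    rcases insmem B hB R hR hR2 with h1 | h1
    · exact h1
    · exact absurd (disj Q hQ R hR hd) (h _ hQA _ h1)
  have stepB : ∀ Q ⊆ W, #Q = 2 → ∀ R ⊆ W, #R = 2 → Disjoint Q R →
      insert i Q ∈ B → insert i R ∈ A := by
    intro Q hQ hQ2 R hR hR2 hd hQA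
    rcases insmem A hA R hR hR2 with h1 | h1
    · exact h1
    · exact absurd (disj Q hQ R hR hd) (h.symm _ hQA _ h1)
  -- Intersecting pairs cover at most three of the at least five points of W, so a pair S avoids
  -- both; the choice of i passes from Q in A to S in B and back to R in A.
  have adj : ∀ Q ⊆ W, #Q = 2 → ∀ R ⊆ W, #R = 2 → ¬ Disjoint Q R → insert i Q ∈ A →
      insert i R ∈ A := by
    intro Q hQ hQ2 R hR hR2 hd hQA
    have h1 : #(Q ∪ R) ≤ 3 := by
      have h2 := card_union_add_card_inter Q R
      have h3 : 0 < #(Q ∩ R) := card_pos.2 (not_disjoint_iff_nonempty_inter.1 hd)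
      omega
    have h2 : 2 ≤ #(W \ (Q ∪ R)) := by
      rw [card_sdiff_of_subset (union_subset hQ hR), hWc]; omega
    obtain ⟨S, hS, hS2⟩ := exists_subset_card_eq h2
    have hSW := hS.trans sdiff_subset
    have hSd : Disjoint S (Q ∪ R) := disjoint_of_subset_left hS sdiff_disjoint
    rw [disjoint_union_right] at hSd
    exact stepB S hSW hS2 R hR hR2 hSd.2 (stepA Q hQ hQ2 S hSW hS2 hSd.1.symm hQA)
  have all : ∀ Q ⊆ W, #Q = 2 → ∀ R ⊆ W, #R = 2 → insert i Q ∈ A → insert i R ∈ A := by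
    intro Q hQ hQ2 R hR hR2 hQA
    by_cases hd : Disjoint Q R
    · obtain ⟨q, hq⟩ := card_pos.1 (by omega : 0 < #Q)
      obtain ⟨s, hs⟩ := card_pos.1 (by omega : 0 < #R)
      have hqs : q ≠ s := fun h => disjoint_left.1 hd hq (h ▸ hs)
      have hT : ({q, s} : Finset α) ⊆ W := by
        intro x hx; simp only [mem_insert, mem_singleton] at hx
        rcases hx with rfl | rfl
        · exact hQ hq
        · exact hR hs
      refine adj {q, s} hT (card_pair hqs) R hR hR2 (not_disjoint_iff.2 ⟨s, by simp, hs⟩) ?_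
      exact adj Q hQ hQ2 _ hT (card_pair hqs) (not_disjoint_iff.2 ⟨q, hq, by simp⟩) hQA
    · exact adj Q hQ hQ2 R hR hR2 hd hQA
  have exd : ∀ Q ⊆ W, #Q = 2 → ∃ R ⊆ W, #R = 2 ∧ Disjoint Q R := by
    intro Q hQ hQ2
    have h2 : 2 ≤ #(W \ Q) := by rw [card_sdiff_of_subset hQ, hWc]; omega
    obtain ⟨S, hS, hS2⟩ := exists_subset_card_eq h2
    exact ⟨S, hS.trans sdiff_subset, hS2, (disjoint_of_subset_left hS sdiff_disjoint).symm⟩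
  have rest : ∀ C : Finset (Finset α), shift i j C = {F ∈ powersetCard 3 V | i ∈ F} →
      ∀ a b : α, (a = i ∧ b = j) ∨ (a = j ∧ b = i) →
      (∀ Q ⊆ W, #Q = 2 → insert b Q ∉ C) → ∀ F ∈ C, a ∈ F := by
    intro C hC a b hab hQC F hF
    by_contra haF
    have hFm : j ∈ F ∨ i ∈ F := by
      rcases mem_shift_or hij hF with h1 | ⟨h1, -, -, -⟩
      · rw [hC, mem_filter] at h1; exact Or.inr h1.2
      · exact Or.inl h1
    have hFV : F ⊆ V ∧ #F = 3 := by
      rcases mem_shift_or hij hF with h1 | ⟨h1, h2, -, h3⟩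
      · rw [hC, mem_filter, mem_powersetCard] at h1; exact h1.1
      · rw [hC, mem_filter, mem_powersetCard, card_insert_erase h1 h2] at h3
        refine ⟨?_, h3.1.2⟩
        rw [← insert_erase h1]
        exact insert_subset hj ((subset_insert _ _).trans h3.1.1)
    have hbF : b ∈ F := by rcases hab with ⟨rfl, rfl⟩ | ⟨rfl, rfl⟩ <;> tauto
    refine hQC (F.erase b) ?_ (by rw [card_erase_of_mem hbF, hFV.2]) (by rwa [insert_erase hbF])
    intro x hx
    obtain ⟨hxb, hxF⟩ := mem_erase.1 hx
    have hxa : x ≠ a := fun h => haF (h ▸ hxF)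
    simp only [hW, mem_erase]
    rcases hab with ⟨rfl, rfl⟩ | ⟨rfl, rfl⟩ <;> exact ⟨by assumption, by assumption, hFV.1 hxF⟩
  by_cases hex : ∃ Q ⊆ W, #Q = 2 ∧ insert i Q ∈ A
  · obtain ⟨Q, hQ, hQ2, hQA⟩ := hex
    left
    have hA' := fun R hR hR2 => all Q hQ hQ2 R hR hR2 hQA
    constructor
    · exact rest A hA i j (Or.inl ⟨rfl, rfl⟩) fun R hR hR2 hRA =>
        notboth A hA R hR ⟨hA' R hR hR2, hRA⟩
    · refine rest B hB i j (Or.inl ⟨rfl, rfl⟩) fun R hR hR2 hRB => ?_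
      obtain ⟨S, hS, hS2, hd⟩ := exd R hR hR2
      exact h _ (hA' S hS hS2) _ hRB (disj S hS R hR hd.symm)
  · push Not at hex
    right
    constructor
    · exact rest A hA j i (Or.inr ⟨rfl, rfl⟩) hex
    · refine rest B hB j i (Or.inr ⟨rfl, rfl⟩) fun R hR hR2 hRB => ?_
      obtain ⟨S, hS, hS2, hd⟩ := exd R hR hR2
      exact hex S hS hS2 (stepB R hR hR2 S hS hS2 hd hRB)

end Unshift

section Unshift

variable {α : Type*} [DecidableEq α]

theorem card_le_of_forall_superset {V P : Finset α} {N : ℕ} (hV : #V = N) {B : Finset (Finset α)}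
    (hB : B ⊆ powersetCard 3 V) (hP : #P = 2) (hPV : P ⊆ V) (h : ∀ F ∈ B, P ⊆ F) :
    #B ≤ N - 2 := by
  have : B ⊆ (V \ P).image (fun y => insert y P) := by
    intro F hF
    obtain ⟨h1, h2⟩ := mem_powersetCard.1 (hB hF)
    obtain ⟨y, hyF, hyP⟩ := exists_mem_notMem_of_card_lt_card (by omega : #P < #F)
    refine mem_image.2 ⟨y, mem_sdiff.2 ⟨h1 hyF, hyP⟩, ?_⟩
    refine eq_of_subset_of_card_le (insert_subset hyF (h F hF)) ?_
    rw [card_insert_of_notMem hyP]; omega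
  refine (card_le_card this).trans (card_image_le.trans ?_)
  rw [card_sdiff_of_subset hPV, hV, hP]

/-- Undoing a shift that produces all triples containing a pair, and all triples meeting it. -/
theorem extremalThree_of_shift_pair {V : Finset α} {N : ℕ} (hV : #V = N) (hN : 7 ≤ N) {i j : α}
    (hij : i ≠ j) (hi : i ∈ V) {A B : Finset (Finset α)}
    (hA : A ⊆ powersetCard 3 V) (hB : B ⊆ powersetCard 3 V) (h : CrossInt A B) (h3 : 3 ≤ #B)
    (heq : #A + #B + 2 * (N - 3).choose 3 = N.choose 3 + (N - 4).choose 3 + 2)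
    {P : Finset α} (hP : #P = 2) (hBP : ∀ F ∈ shift i j B, P ⊆ F)
    (hAP : ∀ F ∈ shift i j A, ¬ Disjoint F P) : ExtremalThree A B := by
  have hAs := shift_subset_powersetCard hij hi (j := j) hA
  have hBs := shift_subset_powersetCard hij hi (j := j) hB
  by_cases hiP : i ∉ P
  · exact Or.inr (Or.inl ⟨P, hP, fun F hF z hz => forall_mem_of_shift hij (by rintro rfl; exact hiP hz)
      (fun G hG => hBP G hG hz) F hF, forall_meets_of_shift hij hiP hAP⟩)
  push Not at hiP
  have hBj : ∀ F ∈ B, F ∈ shift i j B ∨ (j ∈ F ∧ i ∉ F ∧ j ∉ P ∧ P.erase i ⊆ F) := by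
    intro F hF
    rcases mem_shift_or hij hF with h1 | ⟨h1, h2, -, h4⟩
    · exact Or.inl h1
    · have h5 := hBP _ h4
      refine Or.inr ⟨h1, h2, fun hjP => ?_, ?_⟩
      · have := h5 hjP; simp [hij.symm] at this
      · intro x hx
        obtain ⟨hxi, hxP⟩ := mem_erase.1 hx
        have := h5 hxP
        simp only [mem_insert, mem_erase] at this
        tauto
  by_cases hBi : ∀ F ∈ B, i ∈ F
  · have hBP' : ∀ F ∈ B, P ⊆ F := by
      intro F hF
      rcases hBj F hF with h1 | ⟨-, h1, -⟩
      · exact hBP F h1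
      · exact absurd (hBi F hF) h1
    exact Or.inr (Or.inl ⟨P, hP, hBP', all_meet_of_forall_superset hV hN hA hB h h3 hP hBP' heq⟩)
  by_cases hBj' : ∀ F ∈ B, j ∈ F
  · have hjP : j ∉ P := by
      push Not at hBi
      obtain ⟨F, hF, hiF⟩ := hBi
      rcases hBj F hF with h1 | h1
      · exact absurd (hBP F h1 hiP) hiF
      · exact h1.2.2.1
    have hP' : #(insert j (P.erase i)) = 2 := by rw [card_insert_erase hiP hjP, hP]
    have hBP' : ∀ F ∈ B, insert j (P.erase i) ⊆ F := by
      intro F hF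
      refine insert_subset (hBj' F hF) ?_
      rcases hBj F hF with h1 | h1
      · exact (erase_subset _ _).trans (hBP F h1)
      · exact h1.2.2.2
    exact Or.inr (Or.inl ⟨_, hP', hBP', all_meet_of_forall_superset hV hN hA hB h h3 hP' hBP' heq⟩)
  exfalso
  push Not at hBi hBj'
  obtain ⟨F₁, hF₁, hi1⟩ := hBi
  obtain ⟨F₂, hF₂, hj2⟩ := hBj'
  have hPV : P ⊆ V := by
    obtain ⟨G, hG⟩ := card_pos.1 (by rw [card_shift]; omega : 0 < #(shift i j B))
    exact (hBP G hG).trans (mem_powersetCard.1 (hBs hG)).1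
  -- At most N - 2 triples contain P, so equality forces the other family to consist of all triples
  -- meeting P.
  have hfull : shift i j A = {F ∈ powersetCard 3 V | ¬ Disjoint F P} := by
    apply eq_of_subset_of_card_le (fun F hF => mem_filter.2 ⟨hAs hF, hAP F hF⟩)
    have h4 := card_le_of_forall_superset hV hBs hP hPV hBP
    have h5 := card_filter_not_disjoint hPV 3
    have h6 := choose_three_identity (by omega : 4 ≤ N)
    rw [card_shift] at h4 ⊢
    rw [hV, hP] at h5
    omega
  obtain ⟨hF1V, hF1c⟩ := mem_powersetCard.1 (hB hF₁)
  obtain ⟨hF2V, hF2c⟩ := mem_powersetCard.1 (hB hF₂)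
  have hsub1 : P.erase i ⊆ F₁ ∧ j ∈ F₁ := by
    rcases hBj F₁ hF₁ with h1 | h1
    · exact absurd (hBP _ h1 hiP) hi1
    · exact ⟨h1.2.2.2, h1.1⟩
  have hsub2 : P ⊆ F₂ := by
    rcases hBj F₂ hF₂ with h1 | h1
    · exact hBP _ h1
    · exact absurd h1.1 hj2
  -- F₁ misses i, F₂ misses j, and they share a point of P. Among at least seven points a pair Q
  -- avoids both; then Q ∪ {i} or Q ∪ {j} lies in A and is disjoint from F₁ or F₂ respectively.
  have hc : #(F₁ ∪ F₂) ≤ 5 := by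
    have h1 := card_union_add_card_inter F₁ F₂
    have h2 : P.erase i ⊆ F₁ ∩ F₂ := subset_inter hsub1.1 ((erase_subset _ _).trans hsub2)
    have h3 := card_le_card h2
    rw [card_erase_of_mem hiP, hP] at h3
    omega
  have hc2 : 2 ≤ #(V \ (F₁ ∪ F₂)) := by
    rw [card_sdiff_of_subset (union_subset hF1V hF2V)]; omega
  obtain ⟨Q, hQ, hQ2⟩ := exists_subset_card_eq hc2
  have hQd : Disjoint Q (F₁ ∪ F₂) := disjoint_of_subset_left hQ sdiff_disjoint
  have hiQ : i ∉ Q := fun hiQ => disjoint_left.1 hQd hiQ (mem_union_right _ (hsub2 hiP))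
  rw [disjoint_union_right] at hQd
  have hm : insert i Q ∈ shift i j A := by
    rw [hfull]
    refine mem_filter.2 ⟨mem_powersetCard.2 ⟨insert_subset hi (hQ.trans sdiff_subset), ?_⟩, ?_⟩
    · rw [card_insert_of_notMem hiQ, hQ2]
    · exact not_disjoint_iff.2 ⟨i, mem_insert_self _ _, hiP⟩
  rcases (mem_shift hij).1 hm with h1 | ⟨-, -, -, h1⟩
  · exact h _ h1.1 _ hF₁ (disjoint_insert_left.2 ⟨hi1, hQd.1⟩)
  · rw [erase_insert hiQ] at h1
    exact h _ h1 _ hF₂ (disjoint_insert_left.2 ⟨hj2, hQd.2⟩)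

theorem extremalThree_of_shift {V : Finset α} {N : ℕ} (hV : #V = N) (hN : 7 ≤ N) {i j : α}
    (hij : i ≠ j) (hi : i ∈ V) (hj : j ∈ V) {A B : Finset (Finset α)}
    (hA : A ⊆ powersetCard 3 V) (hB : B ⊆ powersetCard 3 V) (h : CrossInt A B) (hA3 : 3 ≤ #A)
    (hB3 : 3 ≤ #B)
    (heq : #A + #B + 2 * (N - 3).choose 3 = N.choose 3 + (N - 4).choose 3 + 2)
    (hext : ExtremalThree (shift i j A) (shift i j B)) : ExtremalThree A B := by
  have hAs := shift_subset_powersetCard hij hi (j := j) hA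
  have hBs := shift_subset_powersetCard hij hi (j := j) hB
  rcases hext with ⟨z, hzA, hzB⟩ | ⟨P, hP, hBP, hAP⟩ | ⟨P, hP, hAP, hBP⟩
  · by_cases hz : z = i
    · subst hz
      have hs : ∀ C : Finset (Finset α), C ⊆ powersetCard 3 V → (∀ F ∈ C, z ∈ F) →
          C ⊆ {F ∈ powersetCard 3 V | z ∈ F} := fun C hC hz F hF => mem_filter.2 ⟨hC hF, hz F hF⟩
      have hcard : #{F ∈ powersetCard 3 V | z ∈ F} = (#V - 1).choose 2 := card_filter_mem hi 2
      have h1 := card_le_card (hs _ hAs hzA)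
      have h2 := card_le_card (hs _ hBs hzB)
      have h3 := choose_three_star_identity (by omega : 4 ≤ N)
      rw [hV] at hcard
      rw [card_shift] at h1 h2
      have hfA := eq_of_subset_of_card_le (hs _ hAs hzA) (by rw [card_shift]; omega)
      have hfB := eq_of_subset_of_card_le (hs _ hBs hzB) (by rw [card_shift]; omega)
      rcases star_of_shift_star hV hN hij hi hj hfA hfB h with h4 | h4
      · exact Or.inl ⟨_, h4⟩
      · exact Or.inl ⟨_, h4⟩
    · exact Or.inl ⟨z, forall_mem_of_shift hij hz hzA, forall_mem_of_shift hij hz hzB⟩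
  · exact extremalThree_of_shift_pair hV hN hij hi hA hB h hB3 heq hP hBP hAP
  · exact (extremalThree_of_shift_pair hV hN hij hi hB hA h.symm hA3 (by omega) hP hAP hBP).symm

end Unshift

/-! ### The cross-intersecting bound for arbitrary families. -/

theorem cross_two_nat {r N : ℕ} (hr : 3 ≤ r) (hN : 2 * r < N) {A B : Finset (Finset ℕ)}
    (hA : A ⊆ powersetCard r (range N)) (hB : B ⊆ powersetCard r (range N))
    (h : CrossInt A B) (hA2 : 2 ≤ #A) (hB2 : 2 ≤ #B) :
    #A + #B + 2 * (N - r).choose r ≤ N.choose r + (N - r - 1).choose r + 2 ∧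
    (#A + #B + 2 * (N - r).choose r = N.choose r + (N - r - 1).choose r + 2 →
      #A = 2 ∨ #B = 2 ∨ (r = 3 ∧ ExtremalThree A B)) := by
  induction hw : weight A + weight B using Nat.strong_induction_on generalizing A B with
  | _ w ih =>
  have step : ∀ i j, i < j → j < N → (shift i j A ≠ A ∨ shift i j B ≠ B) →
      #A + #B + 2 * (N - r).choose r ≤ N.choose r + (N - r - 1).choose r + 2 ∧
      (#A + #B + 2 * (N - r).choose r = N.choose r + (N - r - 1).choose r + 2 →
        #A = 2 ∨ #B = 2 ∨ (r = 3 ∧ ExtremalThree A B)) := by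
    intro i j hij hj hne
    have hi : i ∈ range N := mem_range.2 (by omega)
    have hj' : j ∈ range N := mem_range.2 hj
    have hwA := weight_shift hij A
    have hwB := weight_shift hij B
    have hlt : weight (shift i j A) + weight (shift i j B) < w := by
      rcases hne with h1 | h1
      · have := hwA.2 h1; omega
      · have := hwB.2 h1; omega
    have := ih _ hlt (shift_subset_powersetCard hij.ne hi hA)
      (shift_subset_powersetCard hij.ne hi hB) (h.shift hij.ne) (by rwa [card_shift])
      (by rwa [card_shift]) rfl
    rw [card_shift, card_shift] at this
    refine ⟨this.1, fun heq => ?_⟩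
    by_cases h2A : #A = 2
    · exact Or.inl h2A
    by_cases h2B : #B = 2
    · exact Or.inr (Or.inl h2B)
    rcases this.2 heq with h1 | h1 | ⟨rfl, h1⟩
    · exact absurd h1 h2A
    · exact absurd h1 h2B
    · refine Or.inr (Or.inr ⟨rfl, ?_⟩)
      exact extremalThree_of_shift (card_range N) (by omega) hij.ne hi hj' hA hB h (by omega)
        (by omega) heq h1
  have lt_of_mem : ∀ C : Finset (Finset ℕ), C ⊆ powersetCard r (range N) → ∀ F ∈ C, ∀ j ∈ F,
      j < N := fun C hC F hF j hj => mem_range.1 ((mem_powersetCard.1 (hC hF)).1 hj)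
  by_cases sA : IsShifted A
  · by_cases sB : IsShifted B
    · exact shifted_cross_two hr hN hA hB sA sB h hA2 hB2
    · obtain ⟨F, hF, j, hj, i, hij, -, hne⟩ := exists_shift_ne sB
      exact step i j hij (lt_of_mem B hB F hF j hj) (Or.inr hne)
  · obtain ⟨F, hF, j, hj, i, hij, -, hne⟩ := exists_shift_ne sA
    exact step i j hij (lt_of_mem A hA F hF j hj) (Or.inl hne)

section Transport

theorem exists_embedding_range {α : Type*} [DecidableEq α] [Countable α] (V : Finset α) :
    ∃ e : α ↪ ℕ, V.map e = range #V := by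
  obtain ⟨g, hg⟩ := exists_injective_nat α
  let f : α → ℕ := fun x => if h : x ∈ V then (V.equivFin ⟨x, h⟩ : ℕ) else #V + g x
  have hf1 : ∀ x (h : x ∈ V), f x = V.equivFin ⟨x, h⟩ := fun x h => dif_pos h
  have hf2 : ∀ x, x ∉ V → f x = #V + g x := fun x h => dif_neg h
  have hlt : ∀ x ∈ V, f x < #V := fun x h => by rw [hf1 x h]; exact (V.equivFin ⟨x, h⟩).2
  have hf : Function.Injective f := by
    intro x y hxy
    by_cases h1 : x ∈ V <;> by_cases h2 : y ∈ V
    · rw [hf1 x h1, hf1 y h2] at hxy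
      simpa using V.equivFin.injective (Fin.ext hxy)
    · rw [hf2 y h2] at hxy
      have := hlt x h1; omega
    · rw [hf2 x h1] at hxy
      have := hlt y h2; omega
    · rw [hf2 x h1, hf2 y h2] at hxy
      exact hg (by omega)
  refine ⟨⟨f, hf⟩, ?_⟩
  apply eq_of_subset_of_card_le
  · intro y hy
    obtain ⟨x, hx, rfl⟩ := mem_map.1 hy
    exact mem_range.2 (hlt x hx)
  · simp

/-- The image of a family under an embedding of the ground sets. -/
def mapFamily {α β : Type*} [DecidableEq β] (e : α ↪ β) (A : Finset (Finset α)) : Finset (Finset β) :=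
  A.image (Finset.map e)

variable {α β : Type*} [DecidableEq β] (e : α ↪ β)

theorem card_mapFamily (A : Finset (Finset α)) : #(mapFamily e A) = #A :=
  card_image_of_injective _ (map_injective e)

theorem forall_mem_mapFamily {A : Finset (Finset α)} {p : Finset β → Prop} :
    (∀ F ∈ mapFamily e A, p F) ↔ ∀ F ∈ A, p (F.map e) := by
  simp [mapFamily]

theorem CrossInt.mapFamily {A B : Finset (Finset α)} (h : CrossInt A B) :
    CrossInt (mapFamily e A) (BeyondHM.mapFamily e B) := by
  refine (forall_mem_mapFamily e).2 fun F hF => (forall_mem_mapFamily e).2 fun G hG => ?_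
  rw [disjoint_map]
  exact h F hF G hG

theorem mapFamily_subset {A : Finset (Finset α)} {V : Finset α} {k : ℕ} (h : A ⊆ powersetCard k V) :
    mapFamily e A ⊆ powersetCard k (V.map e) := by
  refine (forall_mem_mapFamily e).2 fun F hF => ?_
  obtain ⟨h1, h2⟩ := mem_powersetCard.1 (h hF)
  exact mem_powersetCard.2 ⟨map_subset_map.2 h1, by rw [card_map, h2]⟩

/-- Nonemptiness places the common point or the pair inside the image of a member, hence in the
range of `e`. -/
theorem ExtremalThree.of_mapFamily {A B : Finset (Finset α)} (neA : A.Nonempty) (neB : B.Nonempty)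
    (h : ExtremalThree (mapFamily e A) (BeyondHM.mapFamily e B)) : ExtremalThree A B := by
  have aux : ∀ {A B : Finset (Finset α)}, B.Nonempty → ∀ P : Finset β, #P = 2 →
      (∀ F ∈ BeyondHM.mapFamily e B, P ⊆ F) → (∀ F ∈ BeyondHM.mapFamily e A, ¬ Disjoint F P) →
      ∃ P : Finset α, #P = 2 ∧ (∀ F ∈ B, P ⊆ F) ∧ ∀ F ∈ A, ¬ Disjoint F P := by
    intro A B neB P hP h1 h2
    rw [forall_mem_mapFamily] at h1 h2
    obtain ⟨G, hG⟩ := neB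
    obtain ⟨Q, -, rfl⟩ := subset_map_iff.1 (h1 G hG)
    rw [card_map] at hP
    exact ⟨Q, hP, fun F hF => map_subset_map.1 (h1 F hF), fun F hF hd =>
      h2 F hF ((disjoint_map e).2 hd)⟩
  rcases h with ⟨z, h1, h2⟩ | ⟨P, hP, h1, h2⟩ | ⟨P, hP, h1, h2⟩
  · rw [forall_mem_mapFamily] at h1 h2
    obtain ⟨F, hF⟩ := neA
    obtain ⟨z, -, rfl⟩ := mem_map.1 (h1 F hF)
    exact Or.inl ⟨z, fun F hF => (mem_map' e).1 (h1 F hF), fun F hF => (mem_map' e).1 (h2 F hF)⟩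
  · exact Or.inr (Or.inl (aux neB P hP h1 h2))
  · exact Or.inr (Or.inr (aux neA P hP h1 h2))

theorem cross_two {α : Type*} [DecidableEq α] [Countable α] {V : Finset α} {r N : ℕ} (hV : #V = N) (hr : 3 ≤ r)
    (hN : 2 * r < N) {A B : Finset (Finset α)}
    (hA : A ⊆ powersetCard r V) (hB : B ⊆ powersetCard r V)
    (h : CrossInt A B) (hA2 : 2 ≤ #A) (hB2 : 2 ≤ #B) :
    #A + #B + 2 * (N - r).choose r ≤ N.choose r + (N - r - 1).choose r + 2 ∧
    (#A + #B + 2 * (N - r).choose r = N.choose r + (N - r - 1).choose r + 2 →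
      #A = 2 ∨ #B = 2 ∨ (r = 3 ∧ ExtremalThree A B)) := by
  obtain ⟨e, he⟩ := exists_embedding_range V
  rw [hV] at he
  have h1 := cross_two_nat hr hN (he ▸ mapFamily_subset e hA) (he ▸ mapFamily_subset e hB)
    (h.mapFamily e) (by rwa [card_mapFamily]) (by rwa [card_mapFamily])
  rw [card_mapFamily, card_mapFamily] at h1
  refine ⟨h1.1, fun heq => ?_⟩
  rcases h1.2 heq with h2 | h2 | ⟨h2, h3⟩
  · exact Or.inl h2
  · exact Or.inr (Or.inl h2)
  · exact Or.inr (Or.inr ⟨h2, h3.of_mapFamily e (card_pos.1 (by omega)) (card_pos.1 (by omega))⟩)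

end Transport

/-! ### Cross-intersecting families of pairs. -/

section Pairs

variable {α : Type*} [DecidableEq α]

theorem pair_eq_of_mem {F : Finset α} (hF : #F = 2) {x y : α} (hx : x ∈ F) (hy : y ∈ F)
    (hxy : x ≠ y) : {x, y} = F := by
  refine eq_of_subset_of_card_le ?_ ?_
  · intro z; simp only [mem_insert, mem_singleton]; rintro (rfl | rfl) <;> assumption
  · rw [hF, card_pair hxy]

theorem star_of_star_of_pairs {A B : Finset (Finset α)} (uA : ∀ F ∈ A, #F = 2)
    (uB : ∀ F ∈ B, #F = 2) (h : CrossInt A B) (hA : 3 ≤ #A) {z : α} (hz : ∀ F ∈ A, z ∈ F) :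
    ∀ F ∈ B, z ∈ F := by
  intro F hF
  by_contra hzF
  have : A ⊆ F.image (fun y => {z, y}) := by
    intro G hG
    obtain ⟨y, hyG, hyF⟩ := not_disjoint_iff.1 (h G hG F hF)
    exact mem_image.2 ⟨y, hyF, pair_eq_of_mem (uA G hG) (hz G hG) hyG
      (by rintro rfl; exact hzF hyF)⟩
  have := (card_le_card this).trans card_image_le
  rw [uB F hF] at this
  omega

/-- If A is intersecting without a common point, it contains a triangle, and every member of B is an
edge of it. Otherwise A has disjoint members e, f; then B consists of transversals of these, and a
third member of A excludes one of the four. -/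
theorem card_le_three_of_pairs {A B : Finset (Finset α)} (uA : ∀ F ∈ A, #F = 2)
    (uB : ∀ F ∈ B, #F = 2) (h : CrossInt A B) (hA : 3 ≤ #A) (hz : ∀ z, ∃ F ∈ A, z ∉ F) :
    #B ≤ 3 := by
  by_cases hint : CrossInt A A
  · obtain ⟨e, he⟩ := card_pos.1 (by omega : 0 < #A)
    obtain ⟨a, b, hab, rfl⟩ := card_eq_two.1 (uA e he)
    obtain ⟨f, hf, haf⟩ := hz a
    obtain ⟨g, hg, hbg⟩ := hz b
    have hbf : b ∈ f := by
      obtain ⟨x, hx1, hx2⟩ := not_disjoint_iff.1 (hint _ he f hf)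
      simp only [mem_insert, mem_singleton] at hx1
      rcases hx1 with rfl | rfl
      · exact absurd hx2 haf
      · exact hx2
    have hag : a ∈ g := by
      obtain ⟨x, hx1, hx2⟩ := not_disjoint_iff.1 (hint _ he g hg)
      simp only [mem_insert, mem_singleton] at hx1
      rcases hx1 with rfl | rfl
      · exact hx2
      · exact absurd hx2 hbg
    obtain ⟨c, hcf, hcg⟩ := not_disjoint_iff.1 (hint f hf g hg)
    have hbc : b ≠ c := by rintro rfl; exact hbg hcg
    have hac : a ≠ c := by rintro rfl; exact haf hcf
    obtain rfl := pair_eq_of_mem (uA f hf) hbf hcf hbc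
    obtain rfl := pair_eq_of_mem (uA g hg) hag hcg hac
    have : B ⊆ {{a, b}, {b, c}, {a, c}} := by
      intro F hF
      have h1 := h _ he F hF
      have h2 := h _ hf F hF
      have h3 := h _ hg F hF
      simp only [disjoint_insert_left, disjoint_singleton_left] at h1 h2 h3
      simp only [mem_insert, mem_singleton]
      by_cases haF : a ∈ F
      · by_cases hbF : b ∈ F
        · exact Or.inl (pair_eq_of_mem (uB F hF) haF hbF hab).symm
        · exact Or.inr (Or.inr (pair_eq_of_mem (uB F hF) haF (by tauto) hac).symm)
      · exact Or.inr (Or.inl (pair_eq_of_mem (uB F hF) (by tauto) (by tauto) hbc).symm)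
    exact (card_le_card this).trans card_le_three
  · unfold CrossInt at hint
    push Not at hint
    obtain ⟨e, he, f, hf, hd⟩ := hint
    obtain ⟨g, hg, hge, hgf⟩ : ∃ g ∈ A, g ≠ e ∧ g ≠ f := by
      by_contra! hcon
      have : A ⊆ {e, f} := by
        intro g hg
        simp only [mem_insert, mem_singleton]
        by_contra! hne
        exact hne.2 (hcon g hg hne.1)
      have := (card_le_card this).trans card_le_two
      omega
    have aux : ∀ S ∈ A, g ≠ S → ∃ x ∈ S, x ∉ g := by
      intro S hS hne
      by_contra! hcon
      exact hne (eq_of_subset_of_card_le hcon (by rw [uA S hS, uA g hg])).symm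
    obtain ⟨x, hxe, hxg⟩ := aux e he hge
    obtain ⟨y, hyf, hyg⟩ := aux f hf hgf
    have : B ⊆ ((e ×ˢ f).erase (x, y)).image (fun p => {p.1, p.2}) := by
      intro F hF
      obtain ⟨u, hue, huF⟩ := not_disjoint_iff.1 (h e he F hF)
      obtain ⟨v, hvf, hvF⟩ := not_disjoint_iff.1 (h f hf F hF)
      have huv : u ≠ v := by rintro rfl; exact disjoint_left.1 hd hue hvf
      have hFe := pair_eq_of_mem (uB F hF) huF hvF huv
      refine mem_image.2 ⟨(u, v), mem_erase.2 ⟨?_, mem_product.2 ⟨hue, hvf⟩⟩, hFe⟩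
      intro heq
      obtain ⟨rfl, rfl⟩ := Prod.mk.inj heq
      refine h g hg F hF ?_
      rw [← hFe, disjoint_insert_right, disjoint_singleton_right]
      exact ⟨hxg, hyg⟩
    refine (card_le_card this).trans (card_image_le.trans ?_)
    rw [card_erase_of_mem (mem_product.2 ⟨hxe, hyf⟩), card_product, uA e he, uA f hf]

theorem choose_pairs_lt {N : ℕ} (hN : 5 ≤ N) :
    6 + 2 * (N - 2).choose 2 < N.choose 2 + (N - 2 - 1).choose 2 + 2 := by
  obtain ⟨m, rfl⟩ : ∃ m, N = m + 5 := ⟨N - 5, by omega⟩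
  have h : ∀ a, (a + 1).choose 2 = a + a.choose 2 := fun a => by
    rw [Nat.choose_succ_succ' a 1]; simp
  simp only [show m + 5 - 2 = m + 3 by omega, show m + 3 - 1 = m + 2 by omega]
  have h1 := h (m + 2)
  have h2 := h (m + 3)
  have h3 := h (m + 4)
  simp only [Nat.add_assoc, Nat.reduceAdd] at h1 h2 h3
  omega

theorem CrossInt.card_le_of_card_eq_two {V : Finset α} {r N : ℕ} (hV : #V = N)
    {A B : Finset (Finset α)} (hA : A ⊆ powersetCard r V) (hB : B ⊆ powersetCard r V)
    (h : CrossInt A B) (hB2 : #B = 2) :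
    #A + 2 * (N - r).choose r ≤ N.choose r + (N - (r + 1)).choose r := by
  obtain ⟨S, T, hne, rfl⟩ := card_eq_two.1 hB2
  obtain ⟨hS, hSc⟩ := mem_powersetCard.1 (hB (mem_insert_self _ _))
  obtain ⟨hT, hTc⟩ := mem_powersetCard.1 (hB (mem_insert_of_mem (mem_singleton_self _)))
  exact card_le_of_meets_two hV hA hS hT hSc hTc hne fun F hF =>
    ⟨h F hF S (by simp), h F hF T (by simp)⟩

/-- Two full stars with a common centre would exceed this bound, hence `hstar`. Without a common
centre, two families with at least three members each have exactly three. -/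
theorem cross_two_pairs {V : Finset α} {N : ℕ} (hV : #V = N)
    (hN : 5 ≤ N) {A B : Finset (Finset α)}
    (hA : A ⊆ powersetCard 2 V) (hB : B ⊆ powersetCard 2 V)
    (h : CrossInt A B) (hA2 : 2 ≤ #A) (hB2 : 2 ≤ #B)
    (hstar : ¬ ∃ z, (∀ F ∈ A, z ∈ F) ∧ ∀ F ∈ B, z ∈ F) :
    #A + #B + 2 * (N - 2).choose 2 ≤ N.choose 2 + (N - 2 - 1).choose 2 + 2 ∧
    (#A + #B + 2 * (N - 2).choose 2 = N.choose 2 + (N - 2 - 1).choose 2 + 2 →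
      #A = 2 ∨ #B = 2) := by
  have uA := sized_of_subset hA
  have uB := sized_of_subset hB
  by_cases h2A : #A = 2
  · have h3 := h.symm.card_le_of_card_eq_two hV hB hA h2A
    rw [← Nat.sub_sub] at h3
    exact ⟨by omega, fun _ => Or.inl h2A⟩
  by_cases h2B : #B = 2
  · have h3 := h.card_le_of_card_eq_two hV hA hB h2B
    rw [← Nat.sub_sub] at h3
    exact ⟨by omega, fun _ => Or.inr h2B⟩
  have hzA : ∀ z, ∃ F ∈ A, z ∉ F := by
    intro z
    by_contra! hcon
    exact hstar ⟨z, hcon, star_of_star_of_pairs uA uB h (by omega) hcon⟩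
  have hzB : ∀ z, ∃ F ∈ B, z ∉ F := by
    intro z
    by_contra! hcon
    exact hstar ⟨z, star_of_star_of_pairs uB uA h.symm (by omega) hcon, hcon⟩
  have h3 := card_le_three_of_pairs uA uB h (by omega) hzA
  have h4 := card_le_three_of_pairs uB uA h.symm (by omega) hzB
  have h5 := choose_pairs_lt hN
  exact ⟨by omega, fun _ => by omega⟩

end Pairs

/-! ### Splitting an intersecting family at one or two points. -/

section Uniform

variable {α : Type*} [DecidableEq α]

/-- Some two points meet every member. -/
def Covered (H : Finset (Finset α)) : Prop := ∃ x y, ∀ F ∈ H, x ∈ F ∨ y ∈ F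

/-- Every point is missed by two members and, for triples, no three points meet every member
twice. -/
def NonTrivial (r : ℕ) (H : Finset (Finset α)) : Prop :=
  (∀ x, 2 ≤ #{F ∈ H | x ∉ F}) ∧ (r = 2 → ∀ T : Finset α, #T = 3 → ∃ F ∈ H, #(F ∩ T) ≤ 1)

theorem card_split (x : α) (H : Finset (Finset α)) :
    #H = #(H.memberSubfamily x) + #{F ∈ H | x ∉ F} :=
  (card_memberSubfamily_add_card_nonMemberSubfamily x H).symm

theorem missing_subset {H : Finset (Finset α)} {V : Finset α} {r : ℕ}
    (hH : H ⊆ powersetCard (r + 1) V) {x : α} {D : Finset α} (hD : D ∈ {F ∈ H | x ∉ F}) :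
    D ⊆ V.erase x ∧ #D = r + 1 ∧ D ∈ H ∧ x ∉ D := by
  obtain ⟨h1, h2⟩ := mem_filter.1 hD
  obtain ⟨h3, h4⟩ := mem_powersetCard.1 (hH h1)
  exact ⟨subset_erase.2 ⟨h3, h2⟩, h4, h1, h2⟩

theorem memberSubfamily_meets {H : Finset (Finset α)} (h : CrossInt H H) {x : α} {D F : Finset α}
    (hD : D ∈ {F ∈ H | x ∉ F}) (hF : F ∈ H.memberSubfamily x) : ¬ Disjoint F D := by
  obtain ⟨h1, h2⟩ := mem_filter.1 hD
  exact not_disjoint_of_mem_memberSubfamily h2 (fun G hG _ => h G hG D h1) hF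

theorem card_le_of_missing_two {V : Finset α} {r n : ℕ} (hV : #V = n) (hn : 2 * (r + 1) < n)
    {H : Finset (Finset α)} (hH : H ⊆ powersetCard (r + 1) V) (h : CrossInt H H) {x : α}
    (hx : x ∈ V) {D₁ D₂ : Finset α} (hne : D₁ ≠ D₂) (hD : {F ∈ H | x ∉ F} = {D₁, D₂}) :
    #H + 2 * (n - 2 - r).choose r ≤ (n - 1).choose r + (n - 1 - #(D₁ ∪ D₂)).choose r + 2 ∧
    #H + 2 * (n - 2 - r).choose r ≤ (n - 1).choose r + (n - 3 - r).choose r + 2 := by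
  have hm1 : D₁ ∈ {F ∈ H | x ∉ F} := by rw [hD]; simp
  have hm2 : D₂ ∈ {F ∈ H | x ∉ F} := by rw [hD]; simp
  obtain ⟨h1, h1c, -, -⟩ := missing_subset hH hm1
  obtain ⟨h2, h2c, -, -⟩ := missing_subset hH hm2
  have hs := card_split x H
  rw [hD, card_pair hne] at hs
  have h3 := card_filter_not_disjoint_two h1 h2 r
  have h4 : H.memberSubfamily x ⊆
      {U ∈ powersetCard r (V.erase x) | ¬ Disjoint U D₁ ∧ ¬ Disjoint U D₂} := fun F hF =>
    mem_filter.2 ⟨memberSubfamily_subset_powersetCard hH hF, memberSubfamily_meets h hm1 hF,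
      memberSubfamily_meets h hm2 hF⟩
  have h5 := card_le_card h4
  rw [card_erase_of_mem hx, hV, h1c, h2c, show n - 1 - (r + 1) = n - 2 - r by omega] at h3
  have h6 := card_union_ge_succ (h1c.trans h2c.symm) hne
  have h7 : (n - 1 - #(D₁ ∪ D₂)).choose r ≤ (n - 3 - r).choose r :=
    Nat.choose_le_choose _ (by omega)
  omega

/-- If the union had more than r + 2 points, the inclusion-exclusion term C(n-1-|D₁ ∪ D₂|, r) would
be strictly smaller than equality demands. -/
theorem card_inter_of_missing_two {V : Finset α} {r n : ℕ} (hV : #V = n) (hr : 1 ≤ r)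
    (hn : 2 * (r + 1) < n)
    {H : Finset (Finset α)} (hH : H ⊆ powersetCard (r + 1) V) (h : CrossInt H H) {x : α}
    (hx : x ∈ V) {D₁ D₂ : Finset α} (hne : D₁ ≠ D₂) (hD : {F ∈ H | x ∉ F} = {D₁, D₂})
    (heq : #H + 2 * (n - 2 - r).choose r = (n - 1).choose r + (n - 3 - r).choose r + 2) :
    #(D₁ ∩ D₂) = r := by
  have h1 := (card_le_of_missing_two hV hn hH h hx hne hD).1
  obtain ⟨-, h1c, -, -⟩ := missing_subset hH (by rw [hD]; simp : D₁ ∈ {F ∈ H | x ∉ F})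
  obtain ⟨-, h2c, -, -⟩ := missing_subset hH (by rw [hD]; simp : D₂ ∈ {F ∈ H | x ∉ F})
  have h3 := card_union_add_card_inter D₁ D₂
  have h6 := card_union_ge_succ (h1c.trans h2c.symm) hne
  have h4 : #(D₁ ∪ D₂) ≤ r + 2 := by
    by_contra! hlt
    have h5 : (n - 1 - #(D₁ ∪ D₂)).choose r ≤ (n - 4 - r).choose r :=
      Nat.choose_le_choose _ (by omega)
    obtain ⟨s, rfl⟩ : ∃ s, r = s + 1 := ⟨r - 1, by omega⟩
    have h7 : (n - 4 - (s + 1) + 1).choose (s + 1) =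
      (n - 4 - (s + 1)).choose s + (n - 4 - (s + 1)).choose (s + 1) := Nat.choose_succ_succ _ _
    have h8 : 0 < (n - 4 - (s + 1)).choose s := Nat.choose_pos (by omega)
    rw [show n - 4 - (s + 1) + 1 = n - 3 - (s + 1) by omega] at h7
    omega
  omega

theorem choose_pred_ge {a r : ℕ} (hr : 1 ≤ r) (h : r ≤ a) : r ≤ a.choose (r - 1) := by
  obtain ⟨s, rfl⟩ : ∃ s, r = s + 1 := ⟨r - 1, by omega⟩
  calc s + 1 = (s + 1).choose s := (Nat.choose_succ_self_right s).symm
    _ ≤ a.choose s := Nat.choose_le_choose _ h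

/-- Two of the three sets share a point p that a third one, D₃, misses. The r-sets through p
avoiding D₃ meet the first two but cannot be in the link of x. There are at least r ≥ 2 of them,
more than the one additional member. -/
theorem card_lt_of_missing_three {V : Finset α} {r n : ℕ} (hV : #V = n) (hr : 2 ≤ r)
    (hn : 2 * (r + 1) < n) {H : Finset (Finset α)} (hH : H ⊆ powersetCard (r + 1) V)
    (h : CrossInt H H) {x : α} (hx : x ∈ V) (h3 : #{F ∈ H | x ∉ F} = 3)
    (hz : ∀ z, ∃ F ∈ {F ∈ H | x ∉ F}, z ∉ F) :
    #H + 2 * (n - 2 - r).choose r < (n - 1).choose r + (n - 3 - r).choose r + 2 := by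
  obtain ⟨D₁, hm1⟩ := card_pos.1 (by omega : 0 < #{F ∈ H | x ∉ F})
  obtain ⟨D₂, hm2, hne⟩ := exists_mem_ne (by omega : 1 < #{F ∈ H | x ∉ F}) D₁
  obtain ⟨h1, h1c, h1H, -⟩ := missing_subset hH hm1
  obtain ⟨h2, h2c, h2H, -⟩ := missing_subset hH hm2
  obtain ⟨p, hp1, hp2⟩ := not_disjoint_iff.1 (h _ h1H _ h2H)
  obtain ⟨D₃, hm3, hp3⟩ := hz p
  obtain ⟨h3s, h3c, h3H, -⟩ := missing_subset hH hm3
  set U := {T ∈ powersetCard (r - 1 + 1) (V.erase x \ D₃) | p ∈ T} with hU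
  have hUc : r ≤ #U := by
    rw [hU, card_filter_mem (mem_sdiff.2 ⟨h1 hp1, hp3⟩), card_sdiff_of_subset h3s,
      card_erase_of_mem hx, hV, h3c]
    exact choose_pred_ge (by omega) (by omega)
  have hd : Disjoint (H.memberSubfamily x) U := by
    rw [disjoint_left]
    intro F hF hFU
    have h4 := (mem_powersetCard.1 (mem_filter.1 hFU).1).1
    exact memberSubfamily_meets h hm3 hF (disjoint_of_subset_left h4 sdiff_disjoint)
  have hsub : H.memberSubfamily x ∪ U ⊆ powersetCard r (V.erase x) := by
    refine union_subset (memberSubfamily_subset_powersetCard hH) fun F hF => ?_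
    obtain ⟨h4, h5⟩ := mem_powersetCard.1 (mem_filter.1 hF).1
    exact mem_powersetCard.2 ⟨h4.trans sdiff_subset, by omega⟩
  have h6 := card_le_of_meets_two (by rw [card_erase_of_mem hx, hV]) hsub h1 h2 h1c h2c hne.symm
    (by
      intro F hF
      rcases mem_union.1 hF with hF | hF
      · exact ⟨memberSubfamily_meets h hm1 hF, memberSubfamily_meets h hm2 hF⟩
      · have := (mem_filter.1 hF).2
        exact ⟨not_disjoint_iff.2 ⟨p, this, hp1⟩, not_disjoint_iff.2 ⟨p, this, hp2⟩⟩)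
  rw [card_union_of_disjoint hd, show n - 1 - (r + 1) = n - 2 - r by omega,
    show n - 1 - (r + 1 + 1) = n - 3 - r by omega] at h6
  have hs := card_split x H
  omega

theorem NonTrivial.mem {V : Finset α} {r : ℕ} {H : Finset (Finset α)}
    (hH : H ⊆ powersetCard (r + 1) V) (hnt : NonTrivial r H) {x y : α}
    (hxy : ∀ F ∈ H, x ∈ F ∨ y ∈ F) : x ∈ V ∧ y ∈ V ∧ x ≠ y := by
  obtain ⟨F, hF⟩ := card_pos.1 (by have := hnt.1 x; omega : 0 < #{F ∈ H | x ∉ F})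
  obtain ⟨G, hG⟩ := card_pos.1 (by have := hnt.1 y; omega : 0 < #{F ∈ H | y ∉ F})
  obtain ⟨hF, hFx⟩ := mem_filter.1 hF
  obtain ⟨hG, hGy⟩ := mem_filter.1 hG
  have h1 := (hxy F hF).resolve_left hFx
  have h2 := (hxy G hG).resolve_right hGy
  exact ⟨(mem_powersetCard.1 (hH hG)).1 h2, (mem_powersetCard.1 (hH hF)).1 h1,
    fun he => hFx (he ▸ h1)⟩

theorem card_lt_of_missing_le_three {V : Finset α} {r n : ℕ} (hV : #V = n) (hr : 2 ≤ r)
    (hn : 2 * (r + 1) < n) {H : Finset (Finset α)} (hH : H ⊆ powersetCard (r + 1) V)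
    (h : CrossInt H H) (hnt : NonTrivial r H) (hcov : ¬ Covered H) {x : α} (hx : x ∈ V)
    (h3 : #{F ∈ H | x ∉ F} ≤ 3) :
    #H + 2 * (n - 2 - r).choose r < (n - 1).choose r + (n - 3 - r).choose r + 2 := by
  have hz : ∀ z, ∃ F ∈ {F ∈ H | x ∉ F}, z ∉ F := by
    intro z
    by_contra! hcon
    refine hcov ⟨x, z, fun F hF => or_iff_not_imp_left.2 fun hxF => hcon F ?_⟩
    exact mem_filter.2 ⟨hF, hxF⟩
  by_cases h2 : #{F ∈ H | x ∉ F} = 2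
  · exfalso
    obtain ⟨D₁, D₂, hne, hD⟩ := card_eq_two.1 h2
    have hm1 : D₁ ∈ {F ∈ H | x ∉ F} := by rw [hD]; simp
    have hm2 : D₂ ∈ {F ∈ H | x ∉ F} := by rw [hD]; simp
    obtain ⟨z, hz1, hz2⟩ := not_disjoint_iff.1 (h _ (mem_filter.1 hm1).1 _ (mem_filter.1 hm2).1)
    obtain ⟨F, hF, hzF⟩ := hz z
    rw [hD] at hF
    simp only [mem_insert, mem_singleton] at hF
    rcases hF with rfl | rfl
    · exact hzF hz1
    · exact hzF hz2
  · have := hnt.1 x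
    exact card_lt_of_missing_three hV hr hn hH h hx (by omega) hz

/-- The members containing `i` but not `j`, with `i` removed. -/
def link (i j : α) (H : Finset (Finset α)) : Finset (Finset α) :=
  (H.nonMemberSubfamily j).memberSubfamily i

/-- The members containing both `i` and `j`, with these removed. -/
def linkBoth (i j : α) (H : Finset (Finset α)) : Finset (Finset α) :=
  (H.memberSubfamily j).memberSubfamily i

theorem mem_link {i j : α} (hij : i ≠ j) {H : Finset (Finset α)} {S : Finset α} :
    S ∈ link i j H ↔ insert i S ∈ H ∧ i ∉ S ∧ j ∉ S := by
  simp only [link, mem_memberSubfamily, mem_nonMemberSubfamily, mem_insert, not_or]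
  constructor
  · rintro ⟨⟨h1, h2, h3⟩, h4⟩; exact ⟨h1, h4, h3⟩
  · rintro ⟨h1, h2, h3⟩; exact ⟨⟨h1, hij.symm, h3⟩, h2⟩

theorem mem_linkBoth {i j : α} (hij : i ≠ j) {H : Finset (Finset α)} {S : Finset α} :
    S ∈ linkBoth i j H ↔ insert j (insert i S) ∈ H ∧ i ∉ S ∧ j ∉ S := by
  simp only [linkBoth, mem_memberSubfamily, mem_insert, not_or]
  constructor
  · rintro ⟨⟨h1, h2, h3⟩, h4⟩; exact ⟨h1, h4, h3⟩
  · rintro ⟨h1, h2, h3⟩; exact ⟨⟨h1, hij.symm, h3⟩, h2⟩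

theorem erase_mem_link {i j : α} (hij : i ≠ j) {H : Finset (Finset α)} {F : Finset α}
    (hF : F ∈ H) (hi : i ∈ F) (hj : j ∉ F) : F.erase i ∈ link i j H := by
  rw [mem_link hij, insert_erase hi]
  exact ⟨hF, notMem_erase _ _, fun h => hj (mem_of_mem_erase h)⟩

theorem link_eq {i j : α} (hij : i ≠ j) (H : Finset (Finset α)) :
    link j i H = (H.memberSubfamily j).nonMemberSubfamily i := by
  ext S
  rw [mem_link hij.symm, mem_nonMemberSubfamily, mem_memberSubfamily]
  tauto

theorem card_missing (i j : α) (H : Finset (Finset α)) :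
    #{F ∈ H | i ∉ F} = #(link j i H) + #{F ∈ H | i ∉ F ∧ j ∉ F} := by
  have h1 := card_memberSubfamily_add_card_nonMemberSubfamily j {F ∈ H | i ∉ F}
  rw [← h1]
  congr 1
  · unfold nonMemberSubfamily
    rw [filter_filter]

theorem card_split_four {i j : α} (hij : i ≠ j) (H : Finset (Finset α)) :
    #H = #(link i j H) + #(link j i H) + #(linkBoth i j H) + #{F ∈ H | i ∉ F ∧ j ∉ F} := by
  have h1 := card_memberSubfamily_add_card_nonMemberSubfamily j H
  have h2 := card_memberSubfamily_add_card_nonMemberSubfamily i (H.memberSubfamily j)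
  have h3 := card_memberSubfamily_add_card_nonMemberSubfamily i (H.nonMemberSubfamily j)
  have h4 : (H.nonMemberSubfamily j).nonMemberSubfamily i = {F ∈ H | i ∉ F ∧ j ∉ F} := by
    ext F; simp only [mem_nonMemberSubfamily, mem_filter]; tauto
  rw [← link_eq hij] at h2
  rw [h4] at h3
  unfold linkBoth
  change #(link i j H) + _ = _ at h3
  omega

theorem link_subset {i j : α} (hij : i ≠ j) {V : Finset α} {r : ℕ} {H : Finset (Finset α)}
    (hH : H ⊆ powersetCard (r + 1) V) : link i j H ⊆ powersetCard r (V \ {i, j}) := by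
  intro S hS
  obtain ⟨h1, h2, h3⟩ := (mem_link hij).1 hS
  obtain ⟨h4, h5⟩ := mem_powersetCard.1 (hH h1)
  rw [card_insert_of_notMem h2] at h5
  refine mem_powersetCard.2 ⟨subset_sdiff.2 ⟨(subset_insert _ _).trans h4, ?_⟩, by omega⟩
  rw [disjoint_insert_right, disjoint_singleton_right]
  exact ⟨h2, h3⟩

theorem linkBoth_subset {i j : α} (hij : i ≠ j) {V : Finset α} {r : ℕ} {H : Finset (Finset α)}
    (hH : H ⊆ powersetCard (r + 1) V) : linkBoth i j H ⊆ powersetCard (r - 1) (V \ {i, j}) := by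
  intro S hS
  obtain ⟨h1, h2, h3⟩ := (mem_linkBoth hij).1 hS
  obtain ⟨h4, h5⟩ := mem_powersetCard.1 (hH h1)
  rw [card_insert_of_notMem (by simp [hij.symm, h3]), card_insert_of_notMem h2] at h5
  refine mem_powersetCard.2 ⟨subset_sdiff.2 ⟨?_, ?_⟩, by omega⟩
  · exact ((subset_insert _ _).trans (subset_insert _ _)).trans h4
  rw [disjoint_insert_right, disjoint_singleton_right]
  exact ⟨h2, h3⟩

theorem card_sdiff_pair {V : Finset α} {n : ℕ} (hV : #V = n) {i j : α} (hij : i ≠ j) (hi : i ∈ V)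
    (hj : j ∈ V) : #(V \ {i, j}) = n - 2 := by
  rw [card_sdiff_of_subset, hV, card_pair hij]
  intro x; simp only [mem_insert, mem_singleton]; rintro (rfl | rfl) <;> assumption

theorem CrossInt.link {i j : α} (hij : i ≠ j) {H : Finset (Finset α)} (h : CrossInt H H) :
    CrossInt (link i j H) (BeyondHM.link j i H) := by
  intro S hS T hT hd
  obtain ⟨h1, h2, h3⟩ := (mem_link hij).1 hS
  obtain ⟨h4, h5, h6⟩ := (mem_link hij.symm).1 hT
  refine h _ h1 _ h4 ?_
  rw [disjoint_insert_left, disjoint_insert_right]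
  exact ⟨by simp [hij, h6], h3, hd⟩

theorem cross_two_links [Countable α] {V : Finset α} {n r : ℕ} (hV : #V = n) (hr : 2 ≤ r)
    (hn : 2 * (r + 1) < n) {i j : α} (hij : i ≠ j) (hi : i ∈ V) (hj : j ∈ V)
    {H : Finset (Finset α)} (hH : H ⊆ powersetCard (r + 1) V) (h : CrossInt H H)
    (hA : 2 ≤ #(link i j H)) (hB : 2 ≤ #(link j i H))
    (hstar : r = 2 → ¬ ∃ z, (∀ F ∈ link i j H, z ∈ F) ∧ ∀ F ∈ link j i H, z ∈ F) :
    #(link i j H) + #(link j i H) + 2 * (n - 2 - r).choose r ≤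
      (n - 2).choose r + (n - 3 - r).choose r + 2 ∧
    (#(link i j H) + #(link j i H) + 2 * (n - 2 - r).choose r =
      (n - 2).choose r + (n - 3 - r).choose r + 2 →
      #(link i j H) = 2 ∨ #(link j i H) = 2 ∨
        (r = 3 ∧ ExtremalThree (link i j H) (link j i H))) := by
  have hW := card_sdiff_pair hV hij hi hj
  have hsA := link_subset hij hH
  have hsB := link_subset hij.symm hH
  rw [pair_comm j i] at hsB
  rw [show n - 3 - r = n - 2 - r - 1 by omega]
  by_cases hr2 : r = 2
  · subst hr2
    have := cross_two_pairs hW (by omega) hsA hsB (h.link hij) hA hB (hstar rfl)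
    exact ⟨this.1, fun heq => (this.2 heq).imp_right Or.inl⟩
  · exact cross_two hW (by omega) (by omega) hsA hsB (h.link hij) hA hB

theorem card_linkBoth_le {V : Finset α} {n r : ℕ} (hV : #V = n) {i j : α} (hij : i ≠ j)
    (hi : i ∈ V) (hj : j ∈ V) {H : Finset (Finset α)} (hH : H ⊆ powersetCard (r + 1) V) :
    #(linkBoth i j H) ≤ (n - 2).choose (r - 1) := by
  have := card_le_card (linkBoth_subset hij hH)
  rwa [card_powersetCard, card_sdiff_pair hV hij hi hj] at this

theorem linkBoth_meets {i j : α} (hij : i ≠ j) {H : Finset (Finset α)} (h : CrossInt H H)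
    {D S : Finset α} (hD : D ∈ {F ∈ H | i ∉ F ∧ j ∉ F}) (hS : S ∈ linkBoth i j H) :
    ¬ Disjoint S D := by
  obtain ⟨h1, h2, h3⟩ := mem_filter.1 hD
  obtain ⟨h4, h5, h6⟩ := (mem_linkBoth hij).1 hS
  intro hd
  exact h _ h4 _ h1 (disjoint_insert_left.2 ⟨h3, disjoint_insert_left.2 ⟨h2, hd⟩⟩)

theorem missing_both_subset {i j : α} {H : Finset (Finset α)} {V D : Finset α} {r : ℕ}
    (hH : H ⊆ powersetCard (r + 1) V) (hD : D ∈ {F ∈ H | i ∉ F ∧ j ∉ F}) :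
    D ⊆ V \ {i, j} ∧ #D = r + 1 := by
  obtain ⟨h1, h2, h3⟩ := mem_filter.1 hD
  obtain ⟨h4, h5⟩ := mem_powersetCard.1 (hH h1)
  refine ⟨subset_sdiff.2 ⟨h4, ?_⟩, h5⟩
  rw [disjoint_insert_right, disjoint_singleton_right]
  exact ⟨h2, h3⟩

/-- Each member avoiding i and j must be met by all sets in `linkBoth`; this excludes at least r of
these sets for one such member and r + 1 for two. -/
theorem card_linkBoth_add_lt {V : Finset α} {n r : ℕ} (hV : #V = n) (hr : 2 ≤ r)
    (hn : 2 * (r + 1) < n) {i j : α} (hij : i ≠ j)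
    (hi : i ∈ V) (hj : j ∈ V) {H : Finset (Finset α)} (hH : H ⊆ powersetCard (r + 1) V)
    (h : CrossInt H H) (h1 : 1 ≤ #{F ∈ H | i ∉ F ∧ j ∉ F}) (h2 : #{F ∈ H | i ∉ F ∧ j ∉ F} ≤ 2) :
    #(linkBoth i j H) + #{F ∈ H | i ∉ F ∧ j ∉ F} < (n - 2).choose (r - 1) := by
  have hW := card_sdiff_pair hV hij hi hj
  have hsC := linkBoth_subset hij hH
  have hge := choose_pred_ge (by omega : 1 ≤ r) (by omega : r ≤ n - 3 - r)
  by_cases hD1 : #{F ∈ H | i ∉ F ∧ j ∉ F} = 1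
  · obtain ⟨D, hD⟩ := card_eq_one.1 hD1
    have hm : D ∈ {F ∈ H | i ∉ F ∧ j ∉ F} := by rw [hD]; simp
    obtain ⟨h3, h4⟩ := missing_both_subset hH hm
    have h5 := card_le_of_meets hsC h3 fun F hF => linkBoth_meets hij h hm hF
    rw [hW, h4, show n - 2 - (r + 1) = n - 3 - r by omega] at h5
    omega
  · have hD2 : #{F ∈ H | i ∉ F ∧ j ∉ F} = 2 := by omega
    obtain ⟨D, D', hne, hD⟩ := card_eq_two.1 hD2
    have hm : D ∈ {F ∈ H | i ∉ F ∧ j ∉ F} := by rw [hD]; simp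
    have hm' : D' ∈ {F ∈ H | i ∉ F ∧ j ∉ F} := by rw [hD]; simp
    obtain ⟨h3, h4⟩ := missing_both_subset hH hm
    obtain ⟨h3', h4'⟩ := missing_both_subset hH hm'
    have h5 := card_le_of_meets_two hW hsC h3 h3' h4 h4' hne fun F hF =>
      ⟨linkBoth_meets hij h hm hF, linkBoth_meets hij h hm' hF⟩
    rw [show n - 2 - (r + 1) = n - 3 - r by omega,
      show n - 2 - (r + 1 + 1) = n - 4 - r by omega] at h5
    obtain ⟨s, rfl⟩ : ∃ s, r = s + 2 := ⟨r - 2, by omega⟩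
    have h6 : (n - 4 - (s + 2) + 1).choose (s + 1) =
      (n - 4 - (s + 2)).choose s + (n - 4 - (s + 2)).choose (s + 1) := Nat.choose_succ_succ _ _
    have h7 : 0 < (n - 4 - (s + 2)).choose s := Nat.choose_pos (by omega)
    rw [show n - 4 - (s + 2) + 1 = n - 3 - (s + 2) by omega] at h6
    simp only [show s + 2 - 1 = s + 1 by omega] at *
    omega

theorem card_lt_of_missing_both_le_two [Countable α] {V : Finset α} {r n : ℕ} (hV : #V = n)
    (hr : 2 ≤ r) (hn : 2 * (r + 1) < n) {H : Finset (Finset α)} (hH : H ⊆ powersetCard (r + 1) V)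
    (h : CrossInt H H) (hnt : NonTrivial r H) (hcov : ¬ Covered H) {i j : α} (hij : i ≠ j)
    (hi : i ∈ V) (hj : j ∈ V) (h2 : #{F ∈ H | i ∉ F ∧ j ∉ F} ≤ 2) :
    #H + 2 * (n - 2 - r).choose r < (n - 1).choose r + (n - 3 - r).choose r + 2 := by
  by_cases hi3 : #{F ∈ H | i ∉ F} ≤ 3
  · exact card_lt_of_missing_le_three hV hr hn hH h hnt hcov hi hi3
  by_cases hj3 : #{F ∈ H | j ∉ F} ≤ 3
  · exact card_lt_of_missing_le_three hV hr hn hH h hnt hcov hj hj3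
  -- At least four members miss each point and at most two miss both, so each link has at least two
  -- members.
  have hmi := card_missing i j H
  have hmj := card_missing j i H
  simp only [and_comm (a := j ∉ _)] at hmj
  have h1 : 1 ≤ #{F ∈ H | i ∉ F ∧ j ∉ F} := by
    by_contra hlt
    have h0 := card_eq_zero.1 (by omega : #{F ∈ H | i ∉ F ∧ j ∉ F} = 0)
    refine hcov ⟨i, j, fun F hF => ?_⟩
    by_contra! hcon
    have : F ∈ {F ∈ H | i ∉ F ∧ j ∉ F} := mem_filter.2 ⟨hF, hcon⟩
    rw [h0] at this
    simp at this
  have hC := card_linkBoth_add_lt hV hr hn hij hi hj hH h h1 h2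
  have hs := card_split_four hij H
  have hp : (n - 1).choose r = (n - 2).choose (r - 1) + (n - 2).choose r := by
    obtain ⟨s, rfl⟩ : ∃ s, r = s + 1 := ⟨r - 1, by omega⟩
    rw [show n - 1 = (n - 2) + 1 by omega, Nat.choose_succ_succ']; rfl
  -- For r = 2, links with a common point z escape the cross bound. Some D avoiding i, j also misses
  -- z; since every member meets D, the three pieces have at most three members each.
  by_cases hstar : r = 2 ∧ ∃ z, (∀ F ∈ link i j H, z ∈ F) ∧ ∀ F ∈ link j i H, z ∈ F
  · obtain ⟨rfl, z, hzA, hzB⟩ := hstar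
    obtain ⟨D, hD, hzD⟩ : ∃ D ∈ {F ∈ H | i ∉ F ∧ j ∉ F}, z ∉ D := by
      by_contra! hcon
      refine hcov ⟨i, z, fun F hF => or_iff_not_imp_left.2 fun hiF => ?_⟩
      by_cases hjF : j ∈ F
      · exact mem_of_mem_erase (hzB _ (erase_mem_link hij.symm hF hjF hiF))
      · exact hcon F (mem_filter.2 ⟨hF, hiF, hjF⟩)
    obtain ⟨hDV, hDc⟩ := missing_both_subset hH hD
    obtain ⟨hDH, hiD, hjD⟩ := mem_filter.1 hD
    have haux : ∀ a b : α, a ≠ b → a ∉ D → (∀ F ∈ link a b H, z ∈ F) → #(link a b H) ≤ 3 := by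
      intro a b hab haD hz
      have : link a b H ⊆ D.image (fun y => {z, y}) := by
        intro S hS
        have hSc := sized_of_subset (link_subset hab hH) S hS
        obtain ⟨h3, h4, h5⟩ := (mem_link hab).1 hS
        obtain ⟨y, hyS, hyD⟩ := not_disjoint_iff.1 (h _ h3 _ hDH)
        have hyS' : y ∈ S := (mem_insert.1 hyS).resolve_left (by rintro rfl; exact haD hyD)
        exact mem_image.2 ⟨y, hyD, pair_eq_of_mem hSc (hz S hS) hyS'
          (by rintro rfl; exact hzD hyD)⟩
      exact (card_le_card this).trans (card_image_le.trans hDc.le)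
    have hA := haux i j hij hiD hzA
    have hB := haux j i hij.symm hjD hzB
    have hC3 : #(linkBoth i j H) ≤ 3 := by
      have : linkBoth i j H ⊆ powersetCard 1 D := by
        intro S hS
        have hSc : #S = 1 := sized_of_subset (linkBoth_subset hij hH) S hS
        obtain ⟨y, rfl⟩ := card_eq_one.1 hSc
        refine mem_powersetCard.2 ⟨?_, hSc⟩
        have := linkBoth_meets hij h hD hS
        rw [disjoint_singleton_left, not_not] at this
        rwa [singleton_subset_iff]
      have h3 := card_le_card this
      rwa [card_powersetCard, hDc, Nat.choose_one_right] at h3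
    have := choose_two_lt (by omega : 7 ≤ n)
    rw [show n - 2 - 2 = n - 4 by omega, show n - 3 - 2 = n - 5 by omega]
    omega
  · have := (cross_two_links hV hr hn hij hi hj hH h (by omega) (by omega)
      (fun h1 h2 => hstar ⟨h1, h2⟩)).1
    omega

end Uniform

/-! ### Covered families and the shapes attaining the bound. -/

section Uniform

variable {α : Type*} [DecidableEq α]

/-- The possible shapes of a family that attains the bound. -/
def ExtremalShape (r : ℕ) (V : Finset α) (H : Finset (Finset α)) : Prop :=
  (∃ x ∈ V, ∃ D₁ D₂, D₁ ≠ D₂ ∧ {F ∈ H | x ∉ F} = {D₁, D₂} ∧ #(D₁ ∩ D₂) = r) ∨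
  (r = 3 ∧ ∃ T ⊆ V, #T = 3 ∧ ∀ F ∈ H, 2 ≤ #(F ∩ T)) ∨
  (r = 3 ∧ ∃ E ⊆ V, ∃ x ∈ V, #E = 3 ∧ x ∉ E ∧ ∀ F ∈ H, E ⊆ F ∨ (x ∈ F ∧ ¬ Disjoint F E))

theorem two_le_card_inter {F T : Finset α} {x y : α} (hxy : x ≠ y) (hx : x ∈ F) (hy : y ∈ F)
    (hxT : x ∈ T) (hyT : y ∈ T) : 2 ≤ #(F ∩ T) := by
  rw [← card_pair hxy]
  apply card_le_card
  intro z; simp only [mem_insert, mem_singleton]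
  rintro (rfl | rfl) <;> exact mem_inter.2 ⟨by assumption, by assumption⟩

/-- A covered family whose links have a common point meets some three points twice. -/
theorem exists_triple_of_links_star {V : Finset α} {r : ℕ} {H : Finset (Finset α)}
    (hH : H ⊆ powersetCard (r + 1) V) {x y z : α} (hxy : x ≠ y) (hx : x ∈ V) (hy : y ∈ V)
    (hcov : ∀ F ∈ H, x ∈ F ∨ y ∈ F) (ne : (link x y H).Nonempty)
    (h1 : ∀ F ∈ link x y H, z ∈ F) (h2 : ∀ F ∈ link y x H, z ∈ F) :
    ∃ T ⊆ V, #T = 3 ∧ ∀ F ∈ H, 2 ≤ #(F ∩ T) := by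
  obtain ⟨S, hS⟩ := ne
  have hzS := h1 S hS
  obtain ⟨hS1, hS2, hS3⟩ := (mem_link hxy).1 hS
  have hzx : x ≠ z := by rintro rfl; exact hS2 hzS
  have hzy : y ≠ z := by rintro rfl; exact hS3 hzS
  have hzV : z ∈ V := (mem_powersetCard.1 (hH hS1)).1 (mem_insert_of_mem hzS)
  refine ⟨{x, y, z}, ?_, ?_, fun F hF => ?_⟩
  · intro w; simp only [mem_insert, mem_singleton]
    rintro (rfl | rfl | rfl) <;> assumption
  · rw [card_insert_of_notMem (by simp [hxy, hzx]), card_pair hzy]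
  · by_cases hxF : x ∈ F
    · by_cases hyF : y ∈ F
      · exact two_le_card_inter hxy hxF hyF (by simp) (by simp)
      · exact two_le_card_inter hzx hxF (mem_of_mem_erase (h1 _ (erase_mem_link hxy hF hxF hyF)))
          (by simp) (by simp)
    · have hyF := (hcov F hF).resolve_left hxF
      exact two_le_card_inter hzy hyF
        (mem_of_mem_erase (h2 _ (erase_mem_link hxy.symm hF hyF hxF))) (by simp) (by simp)

theorem extremalShape_of_pair {V P : Finset α} {H : Finset (Finset α)}
    (hH : H ⊆ powersetCard (3 + 1) V) {x y : α} (hxy : x ≠ y) (hx : x ∈ V) (hy : y ∈ V)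
    (hcov : ∀ F ∈ H, x ∈ F ∨ y ∈ F) (ne : (link y x H).Nonempty) (hP : #P = 2)
    (h1 : ∀ F ∈ link x y H, ¬ Disjoint F P) (h2 : ∀ F ∈ link y x H, P ⊆ F) :
    ∃ E ⊆ V, ∃ x ∈ V, #E = 3 ∧ x ∉ E ∧ ∀ F ∈ H, E ⊆ F ∨ (x ∈ F ∧ ¬ Disjoint F E) := by
  obtain ⟨S, hS⟩ := ne
  have hPS := h2 S hS
  obtain ⟨hS1, hS2, hS3⟩ := (mem_link hxy.symm).1 hS
  have hyP : y ∉ P := fun h => hS2 (hPS h)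
  have hxP : x ∉ P := fun h => hS3 (hPS h)
  have hSV := (mem_powersetCard.1 (hH hS1)).1
  refine ⟨insert y P, insert_subset hy (hPS.trans ((subset_insert _ _).trans hSV)), x, hx, ?_, ?_,
    fun F hF => ?_⟩
  · rw [card_insert_of_notMem hyP, hP]
  · simp [hxy, hxP]
  · by_cases hxF : x ∈ F
    · refine Or.inr ⟨hxF, ?_⟩
      by_cases hyF : y ∈ F
      · exact not_disjoint_iff.2 ⟨y, hyF, mem_insert_self _ _⟩
      · obtain ⟨w, hw1, hw2⟩ := not_disjoint_iff.1 (h1 _ (erase_mem_link hxy hF hxF hyF))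
        exact not_disjoint_iff.2 ⟨w, mem_of_mem_erase hw1, mem_insert_of_mem hw2⟩
    · have hyF := (hcov F hF).resolve_left hxF
      exact Or.inl (insert_subset hyF
        ((h2 _ (erase_mem_link hxy.symm hF hyF hxF)).trans (erase_subset _ _)))

theorem choose_pascal {n r : ℕ} (hr : 1 ≤ r) (hn : 2 ≤ n) :
    (n - 1).choose r = (n - 2).choose (r - 1) + (n - 2).choose r := by
  obtain ⟨s, rfl⟩ : ∃ s, r = s + 1 := ⟨r - 1, by omega⟩
  rw [show n - 1 = (n - 2) + 1 by omega, Nat.choose_succ_succ']; rfl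

/-- Nobody misses both x and y, so the members missing one point are exactly the link of the other,
of size at least two. The cross bound for the links and the trivial bound for `linkBoth` add up by
Pascal's rule; equality in the former determines the shape. -/
theorem covered_card_le [Countable α] {V : Finset α} {r n : ℕ} (hV : #V = n)
    (hr : 2 ≤ r) (hn : 2 * (r + 1) < n) {H : Finset (Finset α)} (hH : H ⊆ powersetCard (r + 1) V)
    (h : CrossInt H H) (hnt : NonTrivial r H) (hcov : Covered H) :
    #H + 2 * (n - 2 - r).choose r ≤ (n - 1).choose r + (n - 3 - r).choose r + 2 ∧
    (#H + 2 * (n - 2 - r).choose r = (n - 1).choose r + (n - 3 - r).choose r + 2 →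
      ExtremalShape r V H) := by
  obtain ⟨x, y, hxy⟩ := hcov
  obtain ⟨hx, hy, hne⟩ := hnt.mem hH hxy
  have h0 : #{F ∈ H | x ∉ F ∧ y ∉ F} = 0 := by
    rw [card_eq_zero, filter_eq_empty_iff]
    intro F hF; have := hxy F hF; tauto
  have h0' : #{F ∈ H | y ∉ F ∧ x ∉ F} = 0 := by simp only [and_comm (a := y ∉ _), h0]
  have hmx := card_missing x y H
  have hmy := card_missing y x H
  have hx2 := hnt.1 x
  have hy2 := hnt.1 y
  have neA : (link x y H).Nonempty := card_pos.1 (by omega)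
  have neB : (link y x H).Nonempty := card_pos.1 (by omega)
  have hs := card_split_four hne H
  have hC := card_linkBoth_le hV hne hx hy hH
  have hcr := cross_two_links hV hr hn hne hx hy hH h (by omega) (by omega) (by
    rintro rfl ⟨z, hz1, hz2⟩
    obtain ⟨T, -, hT, hT2⟩ := exists_triple_of_links_star hH hne hx hy hxy neA hz1 hz2
    obtain ⟨F, hF, hF1⟩ := hnt.2 rfl T hT
    have := hT2 F hF
    omega)
  have hp := choose_pascal (by omega : 1 ≤ r) (by omega : 2 ≤ n)
  refine ⟨by omega, fun heq => ?_⟩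
  have two : ∀ z ∈ V, #{F ∈ H | z ∉ F} = 2 → ExtremalShape r V H := by
    intro z hz h2
    obtain ⟨D₁, D₂, hD, hDeq⟩ := card_eq_two.1 h2
    exact Or.inl ⟨z, hz, D₁, D₂, hD, hDeq,
      card_inter_of_missing_two hV (by omega) hn hH h hz hD hDeq heq⟩
  rcases hcr.2 (by omega) with h2 | h2 | ⟨rfl, h2⟩
  · exact two y hy (by omega)
  · exact two x hx (by omega)
  · rcases h2 with ⟨z, hz1, hz2⟩ | ⟨P, hP, h3, h4⟩ | ⟨P, hP, h3, h4⟩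
    · exact Or.inr (Or.inl ⟨rfl, exists_triple_of_links_star hH hne hx hy hxy neA hz1 hz2⟩)
    · exact Or.inr (Or.inr ⟨rfl, extremalShape_of_pair hH hne hx hy hxy neB hP h4 h3⟩)
    · exact Or.inr (Or.inr ⟨rfl, extremalShape_of_pair hH hne.symm hy hx
        (fun F hF => (hxy F hF).symm) neA hP h4 h3⟩)

/-- The `4`-sets containing a triple `E`, or containing `x` and meeting `E`. -/
theorem card_triple_family {V E : Finset α} {n : ℕ} (hV : #V = n) (hn : 9 ≤ n) {x : α} (hE : E ⊆ V)
    (hx : x ∈ V) (hEc : #E = 3) (hxE : x ∉ E) :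
    #{F ∈ powersetCard 4 V | E ⊆ F ∨ (x ∈ F ∧ ¬ Disjoint F E)} + 2 * (n - 5).choose 3 =
      (n - 1).choose 3 + (n - 6).choose 3 + 2 := by
  set H := {F ∈ powersetCard 4 V | E ⊆ F ∨ (x ∈ F ∧ ¬ Disjoint F E)} with hH
  have h1 := card_split x H
  have h2 : H.memberSubfamily x = {U ∈ powersetCard 3 (V.erase x) | ¬ Disjoint U E} := by
    ext U
    rw [mem_memberSubfamily, hH, mem_filter, mem_filter, mem_powersetCard, mem_powersetCard,
      subset_erase]
    constructor
    · rintro ⟨⟨⟨h3, h4⟩, h5⟩, h6⟩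
      rw [card_insert_of_notMem h6] at h4
      refine ⟨⟨⟨(subset_insert _ _).trans h3, h6⟩, by omega⟩, ?_⟩
      rcases h5 with h5 | h5
      · obtain ⟨e, he⟩ := card_pos.1 (by omega : 0 < #E)
        have : e ≠ x := by rintro rfl; exact hxE he
        exact not_disjoint_iff.2 ⟨e, (mem_insert.1 (h5 he)).resolve_left this, he⟩
      · intro hd
        exact h5.2 (disjoint_insert_left.2 ⟨hxE, hd⟩)
    · rintro ⟨⟨⟨h3, h4⟩, h5⟩, h6⟩
      refine ⟨⟨⟨insert_subset hx h3, by rw [card_insert_of_notMem h4, h5]⟩,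
        Or.inr ⟨mem_insert_self _ _, fun hd => h6 ?_⟩⟩, h4⟩
      exact disjoint_of_subset_left (subset_insert _ _) hd
  have h3 : {F ∈ H | x ∉ F} = ((V.erase x) \ E).image (fun y => insert y E) := by
    ext F
    simp only [hH, mem_filter, mem_powersetCard, mem_image, mem_sdiff, mem_erase]
    constructor
    · rintro ⟨⟨⟨h4, h5⟩, h6⟩, h7⟩
      have hEF : E ⊆ F := by tauto
      obtain ⟨y, hyF, hyE⟩ := exists_mem_notMem_of_card_lt_card (by omega : #E < #F)
      refine ⟨y, ⟨⟨by rintro rfl; exact h7 hyF, h4 hyF⟩, hyE⟩, ?_⟩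
      refine eq_of_subset_of_card_le (insert_subset hyF hEF) ?_
      rw [card_insert_of_notMem hyE]; omega
    · rintro ⟨y, ⟨⟨h4, h5⟩, h6⟩, rfl⟩
      refine ⟨⟨⟨insert_subset h5 hE, by rw [card_insert_of_notMem h6, hEc]⟩,
        Or.inl (subset_insert _ _)⟩, ?_⟩
      simp [hxE, h4.symm]
  have hEs : E ⊆ V.erase x := subset_erase.2 ⟨hE, hxE⟩
  rw [h2, h3, card_image_of_injOn, card_sdiff_of_subset hEs, card_erase_of_mem hx, hV, hEc] at h1
  · have h4 := card_filter_not_disjoint hEs 3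
    rw [card_erase_of_mem hx, hV, hEc] at h4
    have h5 := choose_three_identity (by omega : 4 ≤ n - 2)
    simp only [Nat.sub_sub, Nat.reduceAdd] at h1 h4 h5
    omega
  · intro y hy y' hy' hyy
    simp only [coe_sdiff, Set.mem_sdiff, mem_coe] at hy hy' hyy
    have : y ∈ insert y' E := by rw [← hyy]; exact mem_insert_self _ _
    exact (mem_insert.1 this).resolve_right hy.2

theorem choose_two_gt {n : ℕ} (hn : 9 ≤ n) : n - 5 < (n - 5).choose 2 := by
  obtain ⟨m, rfl⟩ : ∃ m, n = m + 9 := ⟨n - 9, by omega⟩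
  have h : ∀ a, (a + 1).choose 2 = a + a.choose 2 := fun a => by
    rw [Nat.choose_succ_succ' a 1]; simp
  simp only [show m + 9 - 5 = m + 4 by omega]
  have h1 := h (m + 3)
  have h2 := h (m + 2)
  simp only [Nat.add_assoc, Nat.reduceAdd] at h1 h2
  omega

/-! ### Uncovered families with a covered shift. -/

/-- Undoing a shift that produces all `4`-sets containing a triple, or containing the new element
and meeting the triple. -/
theorem card_lt_of_shift_triple [Countable α] {V E : Finset α} {n : ℕ} (hV : #V = n) (hn : 9 ≤ n)
    {H : Finset (Finset α)} (hH : H ⊆ powersetCard 4 V) (h : CrossInt H H) (hcov : ¬ Covered H)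
    {i j : α} (hij : i ≠ j) (hi : i ∈ V) (hj : j ∈ V) (hE : E ⊆ V) (hEc : #E = 3) (hiE : i ∉ E)
    (hjE : j ∉ E)
    (hs : shift i j H = {F ∈ powersetCard 4 V | E ⊆ F ∨ (i ∈ F ∧ ¬ Disjoint F E)}) :
    #H + 2 * (n - 5).choose 3 < (n - 1).choose 3 + (n - 6).choose 3 + 2 := by
  obtain ⟨e, he⟩ := card_pos.1 (by omega : 0 < #E)
  have hW := card_sdiff_pair hV hij hi hj
  have hEW : E ⊆ V \ {i, j} := by
    rw [subset_sdiff, disjoint_insert_right, disjoint_singleton_right]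
    exact ⟨hE, hiE, hjE⟩
  have hkeep : ∀ F ∈ H, i ∉ F → j ∉ F → E ⊆ F := by
    intro F hF h1 h2
    have : F ∈ shift i j H := (mem_shift hij).2 (Or.inl ⟨hF, fun h3 => absurd h3 h2⟩)
    rw [hs, mem_filter] at this
    tauto
  have hback : ∀ F ∈ powersetCard 4 V, E ⊆ F → i ∉ F →
      F ∈ H ∧ (j ∈ F → insert i (F.erase j) ∈ H) := by
    intro F hF hEF hiF
    have : F ∈ shift i j H := by rw [hs]; exact mem_filter.2 ⟨hF, Or.inl hEF⟩
    rcases (mem_shift hij).1 this with h1 | h1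
    · exact ⟨h1.1, fun h2 => h1.2 h2 hiF⟩
    · exact absurd h1.2.1 hiF
  have hEj := hback (insert j E) (mem_powersetCard.2 ⟨insert_subset hj hE, by
    rw [card_insert_of_notMem hjE, hEc]⟩) (subset_insert _ _) (by simp [hij, hiE])
  have hEB : E ∈ link j i H := (mem_link hij.symm).2 ⟨hEj.1, hjE, hiE⟩
  have hEA : E ∈ link i j H := by
    refine (mem_link hij).2 ⟨?_, hiE, hjE⟩
    have := hEj.2 (mem_insert_self _ _)
    rwa [erase_insert hjE] at this
  -- If E were the only member of the link, then a and any e in E would meet every member.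
  have haux : ∀ a b : α, a ≠ b → E ∈ link b a H → (∀ F ∈ H, a ∉ F → b ∉ F → E ⊆ F) →
      2 ≤ #(link b a H) := by
    intro a b hab hEl hk
    by_contra! hlt
    have hone := card_le_one.1 (by omega : #(link b a H) ≤ 1)
    refine hcov ⟨a, e, fun F hF => or_iff_not_imp_left.2 fun haF => ?_⟩
    by_cases hbF : b ∈ F
    · have := hone _ (erase_mem_link hab.symm hF hbF haF) _ hEl
      exact mem_of_mem_erase (this ▸ he)
    · exact hk F hF haF hbF he
  have hB2 := haux i j hij hEB hkeep
  have hA2 := haux j i hij.symm hEA fun F hF h1 h2 => hkeep F hF h2 h1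
  have hcr := (cross_two_links hV (by omega : 2 ≤ 3) (by omega) hij hi hj hH h hA2 hB2
    (by omega)).1
  have hD : #{F ∈ H | i ∉ F ∧ j ∉ F} ≤ n - 5 := by
    have : {F ∈ H | i ∉ F ∧ j ∉ F} ⊆ ((V \ {i, j}) \ E).image (fun y => insert y E) := by
      intro F hF
      obtain ⟨h1, h2⟩ := missing_both_subset hH hF
      obtain ⟨h3, h4, h5⟩ := mem_filter.1 hF
      obtain ⟨y, hyF, hyE⟩ := exists_mem_notMem_of_card_lt_card (by omega : #E < #F)
      refine mem_image.2 ⟨y, mem_sdiff.2 ⟨h1 hyF, hyE⟩, ?_⟩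
      refine eq_of_subset_of_card_le (insert_subset hyF (hkeep F h3 h4 h5)) ?_
      rw [card_insert_of_notMem hyE]; omega
    refine (card_le_card this).trans (card_image_le.trans ?_)
    rw [card_sdiff_of_subset hEW, hW, hEc]; omega
  -- If Q in `linkBoth` missed E, some y outside E ∪ Q ∪ {i, j} would give a member E ∪ {y} disjoint
  -- from Q ∪ {i, j}; five points of at least seven are occupied.
  have hC := card_le_of_meets (linkBoth_subset hij hH) hEW (by
    intro Q hQ hd
    obtain ⟨hQW, hQc⟩ := mem_powersetCard.1 (linkBoth_subset hij hH hQ)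
    have hpos : 0 < #((V \ {i, j}) \ (E ∪ Q)) := by
      rw [card_sdiff_of_subset (union_subset hEW hQW), hW]
      have := card_union_le E Q
      omega
    obtain ⟨y, hy⟩ := card_pos.1 hpos
    simp only [mem_sdiff, mem_union, mem_insert, mem_singleton, not_or] at hy
    have hyH := (hback (insert y E) (mem_powersetCard.2 ⟨insert_subset hy.1.1 hE, by
      rw [card_insert_of_notMem hy.2.1, hEc]⟩) (subset_insert _ _) (by
        simp [hiE, Ne.symm hy.1.2.1])).1
    refine linkBoth_meets hij h (mem_filter.2 ⟨hyH, ?_, ?_⟩) hQ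
      (disjoint_insert_right.2 ⟨hy.2.2, hd⟩)
    · simp [hiE, Ne.symm hy.1.2.1]
    · simp [hjE, Ne.symm hy.1.2.2])
  rw [hW, hEc] at hC
  have hsp := card_split_four hij H
  have hp := choose_pascal (by omega : 1 ≤ 3) (by omega : 2 ≤ n)
  -- The C(n-5, 2) sets lost from `linkBoth` outnumber the at most n - 5 members avoiding i and j.
  have hg := choose_two_gt hn
  simp only [Nat.sub_sub, Nat.reduceAdd, Nat.reduceSub] at hcr hC hp
  omega

/-- Any two points of T meet every set that meets T twice. Two points other than i keep this
property when the shift is undone. -/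
theorem covered_of_shift_triple {i j : α} (hij : i ≠ j) {H : Finset (Finset α)} {T : Finset α}
    (hT : #T = 3) (h : ∀ F ∈ shift i j H, 2 ≤ #(F ∩ T)) : Covered H := by
  have h2 : 2 ≤ #(T.erase i) := by have := pred_card_le_card_erase (s := T) (a := i); omega
  obtain ⟨S, hS, hS2⟩ := exists_subset_card_eq h2
  obtain ⟨a, b, hab, rfl⟩ := card_eq_two.1 hS2
  have hST : {a, b} ⊆ T := hS.trans (erase_subset _ _)
  have hiS : i ∉ ({a, b} : Finset α) := fun h => by simpa using hS h
  have := forall_meets_of_shift hij hiS (A := H) (by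
    intro F hF hd
    have h3 : F ∩ T ⊆ T \ {a, b} := by
      intro x hx
      obtain ⟨h4, h5⟩ := mem_inter.1 hx
      exact mem_sdiff.2 ⟨h5, disjoint_left.1 hd h4⟩
    have h4 := (h F hF).trans (card_le_card h3)
    rw [card_sdiff_of_subset hST, hT, card_pair hab] at h4
    omega)
  refine ⟨a, b, fun F hF => ?_⟩
  have h5 := this F hF
  rw [disjoint_insert_right, disjoint_singleton_right] at h5
  tauto

theorem covered_of_shift_center {i j x : α} (hij : i ≠ j) (hx : x ≠ i) {H : Finset (Finset α)}
    {E : Finset α} (hE : 2 ≤ #E) (h : ∀ F ∈ shift i j H, x ∈ F ∨ E ⊆ F) : Covered H := by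
  obtain ⟨e, he, hei⟩ := exists_mem_ne (by omega : 1 < #E) i
  have := forall_meets_of_shift hij (P := {x, e}) (A := H) (by simp [hx.symm, hei.symm]) (by
    intro F hF
    rw [disjoint_insert_right, disjoint_singleton_right]
    rcases h F hF with h1 | h1
    · tauto
    · have := h1 he; tauto)
  refine ⟨x, e, fun F hF => ?_⟩
  have h5 := this F hF
  rw [disjoint_insert_right, disjoint_singleton_right] at h5
  tauto

theorem missing_both_shift {i j : α} (hij : i ≠ j) (H : Finset (Finset α)) :
    {F ∈ H | i ∉ F ∧ j ∉ F} ⊆ {F ∈ shift i j H | i ∉ F} := by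
  intro F hF
  obtain ⟨h1, h2, h3⟩ := mem_filter.1 hF
  exact mem_filter.2 ⟨(mem_shift hij).2 (Or.inl ⟨h1, fun h => absurd h h3⟩), h2⟩

/-- Only i can lose missing members: those missing j stay, and for other points the shift acts
inside the subfamily missing them. A triple met twice by the whole shift would have covered the
original. -/
theorem NonTrivial.shift {r : ℕ} {i j : α} (hij : i ≠ j) {H : Finset (Finset α)}
    (hnt : NonTrivial r H) (hi : 2 ≤ #{F ∈ shift i j H | i ∉ F}) (hcov : ¬ Covered H) :
    NonTrivial r (shift i j H) := by
  refine ⟨fun x => ?_, fun _ T hT => ?_⟩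
  · by_cases hxi : x = i
    · subst hxi; exact hi
    by_cases hxj : x = j
    · subst hxj
      refine (hnt.1 x).trans (card_le_card ?_)
      intro F hF
      obtain ⟨h1, h2⟩ := mem_filter.1 hF
      exact mem_filter.2 ⟨(mem_shift hij).2 (Or.inl ⟨h1, fun h => absurd h h2⟩), h2⟩
    · rw [shift_filter_notMem hij hxi hxj, card_shift]
      exact hnt.1 x
  · by_contra! hcon
    exact hcov (covered_of_shift_triple hij hT fun F hF => hcon F hF)

/-- An uncovered family with a covered shift is strictly below the bound. -/
theorem card_lt_of_shift_covered [Countable α] {V : Finset α} {r n : ℕ} (hV : #V = n)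
    (hr : 2 ≤ r) (hn : 2 * (r + 1) < n) {H : Finset (Finset α)} (hH : H ⊆ powersetCard (r + 1) V)
    (h : CrossInt H H) (hcov : ¬ Covered H) {i j : α} (hij : i ≠ j) (hi : i ∈ V) (hj : j ∈ V)
    (hnt' : NonTrivial r (shift i j H)) (hi3 : 3 ≤ #{F ∈ shift i j H | i ∉ F})
    (hcov' : Covered (shift i j H)) :
    #H + 2 * (n - 2 - r).choose r < (n - 1).choose r + (n - 3 - r).choose r + 2 := by
  have hH' := shift_subset_powersetCard hij (j := j) hi hH
  have hb := covered_card_le hV hr hn hH' (h.shift hij) hnt' hcov'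
  rw [card_shift] at hb
  refine lt_of_le_of_ne hb.1 fun heq => ?_
  rcases hb.2 heq with ⟨x, hx, D₁, D₂, hne, hD, hc⟩ | ⟨rfl, T, hTV, hT, hT2⟩ |
    ⟨rfl, E, hE, x, hx, hEc, hxE, hEx⟩
  · have hxi : x ≠ i := by
      rintro rfl
      rw [hD, card_pair hne] at hi3
      omega
    refine hcov (covered_of_shift_center hij hxi (E := D₁ ∩ D₂) (by omega) fun F hF => ?_)
    refine or_iff_not_imp_left.2 fun hxF => ?_
    have : F ∈ {F ∈ shift i j H | x ∉ F} := mem_filter.2 ⟨hF, hxF⟩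
    rw [hD, mem_insert, mem_singleton] at this
    rcases this with rfl | rfl
    · exact inter_subset_left
    · exact inter_subset_right
  · exact hcov (covered_of_shift_triple hij hT hT2)
  · by_cases hxi : x = i
    · subst hxi
      by_cases hjE : j ∈ E
      · refine hcov ⟨x, j, fun F hF => ?_⟩
        rcases mem_shift_or hij hF with h1 | h1
        · rcases hEx F h1 with h2 | h2
          · exact Or.inr (h2 hjE)
          · exact Or.inl h2.1
        · exact Or.inr h1.1
      · have hfull : shift x j H = {F ∈ powersetCard 4 V | E ⊆ F ∨ (x ∈ F ∧ ¬ Disjoint F E)} := by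
          apply eq_of_subset_of_card_le fun F hF => mem_filter.2 ⟨hH' hF, hEx F hF⟩
          have := card_triple_family hV (by omega) hE hx hEc hxE
          simp only [Nat.sub_sub, Nat.reduceAdd] at heq ⊢
          rw [card_shift]
          omega
        have := card_lt_of_shift_triple hV (by omega) hH h hcov hij hx hj hE hEc hxE hjE hfull
        simp only [Nat.sub_sub, Nat.reduceAdd] at heq
        omega
    · exact hcov (covered_of_shift_center hij hxi (by omega) fun F hF =>
        ((hEx F hF).imp_right And.left).symm)

end Uniform

/-! ### The strict bound for uncovered families. -/

theorem card_lt_of_not_covered_nat {r n : ℕ} (hr : 2 ≤ r) (hn : 2 * (r + 1) < n)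
    {H : Finset (Finset ℕ)} (hH : H ⊆ powersetCard (r + 1) (range n))
    (h : CrossInt H H) (hnt : NonTrivial r H) (hcov : ¬ Covered H) :
    #H + 2 * (n - 2 - r).choose r < (n - 1).choose r + (n - 3 - r).choose r + 2 := by
  induction hw : weight H using Nat.strong_induction_on generalizing H with
  | _ w ih =>
  by_cases sH : IsShifted H
  · refine shifted_uncovered_lt hr hn hH sH h ?_
    by_contra! hcon
    exact hcov ⟨0, 1, fun F hF => or_iff_not_imp_left.2 (hcon F hF)⟩
  obtain ⟨F, hF, j, hj, i, hij, -, hne⟩ := exists_shift_ne sH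
  have hjn := (mem_powersetCard.1 (hH hF)).1 hj
  have hin : i ∈ range n := mem_range.2 (hij.trans (mem_range.1 hjn))
  -- Members avoiding i and j are not moved by the shift, so they number at most two when at most
  -- two shifted members miss i.
  by_cases hi3 : #{F ∈ shift i j H | i ∉ F} ≤ 2
  · exact card_lt_of_missing_both_le_two (card_range n) hr hn hH h hnt hcov hij.ne hin hjn
      ((card_le_card (missing_both_shift hij.ne H)).trans hi3)
  have hnt' := hnt.shift hij.ne (by omega) hcov
  by_cases hcov' : Covered (shift i j H)
  · exact card_lt_of_shift_covered (card_range n) hr hn hH h hcov hij.ne hin hjn hnt'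
      (by omega) hcov'
  · have := ih _ (hw ▸ (weight_shift hij H).2 hne) (shift_subset_powersetCard hij.ne hin hH)
      (h.shift hij.ne) hnt' hcov' rfl
    rwa [card_shift] at this

section Transport

variable {α : Type*} [DecidableEq α]

theorem card_lt_of_not_covered [Countable α] {V : Finset α} {r n : ℕ} (hV : #V = n)
    (hr : 2 ≤ r) (hn : 2 * (r + 1) < n) {H : Finset (Finset α)} (hH : H ⊆ powersetCard (r + 1) V)
    (h : CrossInt H H) (hnt : NonTrivial r H) (hcov : ¬ Covered H) :
    #H + 2 * (n - 2 - r).choose r < (n - 1).choose r + (n - 3 - r).choose r + 2 := by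
  obtain ⟨e, he⟩ := exists_embedding_range V
  rw [hV] at he
  rw [← card_mapFamily e H]
  have hfilter : ∀ p : Finset ℕ → Prop, [DecidablePred p] →
      #{F ∈ mapFamily e H | p F} = #{F ∈ H | p (F.map e)} := by
    intro p _
    rw [mapFamily, filter_image, card_image_of_injective _ (map_injective e)]
  have hbig : ∀ y, y ∉ Set.range e → ∀ F : Finset α, y ∉ F.map e := by
    intro y hy F hyF
    obtain ⟨x, -, rfl⟩ := mem_map.1 hyF
    exact hy ⟨x, rfl⟩
  -- Stands in for naturals outside the range of `e`, which belong to no image set.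
  obtain ⟨a₀, ha₀⟩ : ∃ a, a ∈ V := card_pos.1 (by omega)
  refine card_lt_of_not_covered_nat hr hn (he ▸ mapFamily_subset e hH) (h.mapFamily e)
    ⟨fun y => ?_, fun hr2 T hT => ?_⟩ ?_
  · rw [hfilter]
    by_cases hy : y ∈ Set.range e
    · obtain ⟨x, rfl⟩ := hy
      simpa using hnt.1 x
    · refine (hnt.1 a₀).trans (card_le_card ?_)
      intro F hF
      exact mem_filter.2 ⟨(mem_filter.1 hF).1, hbig y hy F⟩
  · have hpre : #(T.preimage e e.injective.injOn) ≤ 3 := by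
      rw [← card_map e, ← hT]
      refine card_le_card fun y hy => ?_
      obtain ⟨x, hx, rfl⟩ := mem_map.1 hy
      exact mem_preimage.1 hx
    obtain ⟨S, hS, hS3⟩ : ∃ S, T.preimage e e.injective.injOn ⊆ S ∧ #S = 3 := by
      obtain ⟨S, h1, -, h2⟩ := exists_subsuperset_card_eq
        (subset_union_left (s₂ := V)) hpre
        ((by omega : 3 ≤ #V).trans (card_le_card subset_union_right))
      exact ⟨S, h1, h2⟩
    obtain ⟨F, hF, hFS⟩ := hnt.2 hr2 S hS3
    refine ⟨F.map e, mem_image_of_mem _ hF, le_trans ?_ hFS⟩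
    rw [← card_map e (s := F ∩ S)]
    refine card_le_card fun y hy => ?_
    obtain ⟨hy1, hy2⟩ := mem_inter.1 hy
    obtain ⟨x, hx, rfl⟩ := mem_map.1 hy1
    exact mem_map_of_mem e (mem_inter.2 ⟨hx, hS (mem_preimage.2 hy2)⟩)
  · rintro ⟨x, y, hxy⟩
    rw [forall_mem_mapFamily] at hxy
    have hback : ∀ y, ∃ x, ∀ F : Finset α, y ∈ F.map e → x ∈ F := by
      intro y
      by_cases hy : y ∈ Set.range e
      · obtain ⟨x, rfl⟩ := hy
        exact ⟨x, fun F hF => (mem_map' e).1 hF⟩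
      · exact ⟨a₀, fun F hF => absurd hF (hbig y hy F)⟩
    obtain ⟨x', hx'⟩ := hback x
    obtain ⟨y', hy'⟩ := hback y
    exact hcov ⟨x', y', fun F hF => (hxy F hF).imp (hx' F) (hy' F)⟩

end Transport

/-! ### Sizes of the model families and embedding into them. -/

theorem SubS.card_le {X Y : Type*} {A : Finset (Finset X)} {B : Finset (Finset Y)}
    (h : SubS A B) : #A ≤ #B := by
  obtain ⟨f, hf⟩ := h
  rw [← card_map (mapEmbedding f).toEmbedding]
  refine card_le_card fun F hF => ?_
  obtain ⟨G, hG, rfl⟩ := mem_map.1 hF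
  exact hf G hG

theorem SubS.of_subset {X : Type*} {A B : Finset (Finset X)} (h : A ⊆ B) : SubS A B :=
  ⟨Function.Embedding.refl X, fun F hF => by rw [map_refl]; exact h hF⟩

theorem Iso.refl {X : Type*} (A : Finset (Finset X)) : Iso A A :=
  ⟨SubS.of_subset subset_rfl, SubS.of_subset subset_rfl⟩

theorem Iso.card_eq {X Y : Type*} {A : Finset (Finset X)} {B : Finset (Finset Y)}
    (h : Iso A B) : #A = #B :=
  le_antisymm h.1.card_le h.2.card_le

theorem card_filter_superset {α : Type*} [DecidableEq α] {W E : Finset α} (hE : E ⊆ W) (r : ℕ) :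
    #{F ∈ powersetCard (r + #E) W | E ⊆ F} = (#W - #E).choose r := by
  rw [← card_sdiff_of_subset hE, ← card_powersetCard]
  refine card_bij' (fun F _ => F \ E) (fun U _ => U ∪ E) ?_ ?_ ?_ ?_
  · intro F hF
    simp only [mem_filter, mem_powersetCard] at hF ⊢
    refine ⟨sdiff_subset_sdiff hF.1.1 subset_rfl, ?_⟩
    rw [card_sdiff_of_subset hF.2, hF.1.2]; omega
  · intro U hU
    simp only [mem_filter, mem_powersetCard, subset_sdiff] at hU ⊢
    refine ⟨⟨union_subset hU.1.1 hE, ?_⟩, subset_union_right⟩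
    rw [card_union_of_disjoint hU.1.2, hU.2]
  · intro F hF
    exact sdiff_union_of_subset (mem_filter.1 hF).2
  · intro U hU
    simp only [mem_powersetCard, subset_sdiff] at hU
    exact union_sdiff_cancel_right hU.1.2

section Families

variable {X : Type*} [Fintype X] [DecidableEq X]

theorem mem_familyG {k : ℕ} {E F : Finset X} {x : X} :
    F ∈ familyG k E x ↔ #F = k ∧ (E ⊆ F ∨ (x ∈ F ∧ ¬ Disjoint F E)) := by
  simp only [familyG, mem_union, mem_filter, mem_powersetCard, subset_univ, true_and,
    not_disjoint_iff_nonempty_inter]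
  tauto

theorem mem_familyJ {k : ℕ} {E J F : Finset X} {x : X} :
    F ∈ familyJ k E J x ↔ #F = k ∧ ((E ⊆ F ∧ ¬ Disjoint F J) ∨ J ⊆ F ∨
      (x ∈ F ∧ ¬ Disjoint F E)) := by
  simp only [familyJ, mem_union, mem_filter, mem_powersetCard, subset_univ, true_and,
    not_disjoint_iff_nonempty_inter]
  tauto

theorem choose_pair_identity {n : ℕ} (hn : 9 ≤ n) :
    (n - 3).choose 2 + 2 * (n - 5).choose 3 = (n - 3).choose 3 + (n - 6).choose 3 + 2 := by
  obtain ⟨m, rfl⟩ : ∃ m, n = m + 9 := ⟨n - 9, by omega⟩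
  simp only [show m + 9 - 3 = m + 6 by omega, show m + 9 - 5 = m + 4 by omega,
    show m + 9 - 6 = m + 3 by omega]
  have h2 : ∀ a, (a + 1).choose 2 = a + a.choose 2 := fun a => by
    rw [Nat.choose_succ_succ' a 1]; simp
  have h3 : ∀ a, (a + 1).choose 3 = a.choose 2 + a.choose 3 := fun a => Nat.choose_succ_succ' a 2
  have a1 := h3 (m + 5)
  have a2 := h3 (m + 4)
  have a3 := h3 (m + 3)
  have b1 := h2 (m + 5)
  have b2 := h2 (m + 4)
  have b3 := h2 (m + 3)
  simp only [Nat.add_assoc, Nat.reduceAdd] at *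
  omega

theorem card_familyG_two {n : ℕ} (hX : Fintype.card X = n) (hn : 9 ≤ n) {E : Finset X} {x : X}
    (hE : #E = 2) (hx : x ∉ E) :
    #(familyG 4 E x) + 2 * (n - 5).choose 3 = (n - 1).choose 3 + (n - 6).choose 3 + 2 := by
  have hV : #(univ : Finset X) = n := by rw [card_univ, hX]
  have h1 := card_split x (familyG 4 E x)
  have hEx : E ⊆ univ.erase x := subset_erase.2 ⟨subset_univ _, hx⟩
  have hVx : #(univ.erase x : Finset X) = n - 1 := by rw [card_erase_of_mem (mem_univ _), hV]
  have h2 : (familyG 4 E x).memberSubfamily x =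
      {U ∈ powersetCard 3 (univ.erase x) | ¬ Disjoint U E} := by
    ext U
    rw [mem_memberSubfamily, mem_familyG, mem_filter, mem_powersetCard, subset_erase]
    constructor
    · rintro ⟨⟨h3, h4⟩, h5⟩
      rw [card_insert_of_notMem h5] at h3
      refine ⟨⟨⟨subset_univ _, h5⟩, by omega⟩, ?_⟩
      rcases h4 with h4 | h4
      · obtain ⟨e, he⟩ := card_pos.1 (by omega : 0 < #E)
        have : e ≠ x := by rintro rfl; exact hx he
        exact not_disjoint_iff.2 ⟨e, (mem_insert.1 (h4 he)).resolve_left this, he⟩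
      · exact fun hd => h4.2 (disjoint_insert_left.2 ⟨hx, hd⟩)
    · rintro ⟨⟨⟨-, h4⟩, h5⟩, h6⟩
      exact ⟨⟨by rw [card_insert_of_notMem h4, h5], Or.inr ⟨mem_insert_self _ _,
        fun hd => h6 (disjoint_of_subset_left (subset_insert _ _) hd)⟩⟩, h4⟩
  have h3 : {F ∈ familyG 4 E x | x ∉ F} = {F ∈ powersetCard (2 + #E) (univ.erase x) | E ⊆ F} := by
    ext F
    rw [mem_filter, mem_familyG, mem_filter, mem_powersetCard, subset_erase, hE]
    have := subset_univ F
    tauto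
  have h4 := card_filter_not_disjoint hEx 3
  rw [h2, h3, card_filter_superset hEx] at h1
  rw [hVx, hE] at h1 h4
  have h5 := choose_pair_identity hn
  simp only [Nat.sub_sub, Nat.reduceAdd] at h1 h4
  omega

theorem card_familyG_three {n : ℕ} (hX : Fintype.card X = n) (hn : 9 ≤ n) {E : Finset X} {x : X}
    (hE : #E = 3) (hx : x ∉ E) :
    #(familyG 4 E x) + 2 * (n - 5).choose 3 = (n - 1).choose 3 + (n - 6).choose 3 + 2 := by
  rw [← card_triple_family (V := univ) (by rw [card_univ, hX]) hn (subset_univ _) (mem_univ x) hE hx]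
  congr 2
  ext F
  rw [mem_familyG, mem_filter, mem_powersetCard]
  simp

/-- With J = {x, y, z}, only E ∪ {y} and E ∪ {z} miss x. A set through x belongs to the family
exactly when the rest meets both of them: it meets E, or contains y and z. -/
theorem card_familyJ {n r : ℕ} (hX : Fintype.card X = n) (hr : 2 ≤ r)
    {E J : Finset X} {x : X} (hE : #E = r) (hJ : #J = 3) (hEJ : Disjoint E J) (hx : x ∈ J) :
    #(familyJ (r + 1) E J x) + 2 * (n - 2 - r).choose r =
      (n - 1).choose r + (n - 3 - r).choose r + 2 := by
  have hV : #(univ : Finset X) = n := by rw [card_univ, hX]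
  obtain ⟨y, z, hyz, hJx⟩ := card_eq_two.1 (by rw [card_erase_of_mem hx, hJ] : #(J.erase x) = 2)
  have hJeq : J = {x, y, z} := by rw [← hJx, insert_erase hx]
  have hxy : x ≠ y := by
    rintro rfl
    have : x ∈ J.erase x := by rw [hJx]; simp
    simp at this
  have hxz : x ≠ z := by
    rintro rfl
    have : x ∈ J.erase x := by rw [hJx]; simp
    simp at this
  subst hJeq
  simp only [disjoint_insert_right, disjoint_singleton_right] at hEJ
  obtain ⟨hxE, hyE, hzE⟩ := hEJ
  have h1 := card_split x (familyJ (r + 1) E {x, y, z} x)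
  have hVx : #(univ.erase x : Finset X) = n - 1 := by rw [card_erase_of_mem (mem_univ _), hV]
  have h2 : (familyJ (r + 1) E {x, y, z} x).memberSubfamily x =
      {U ∈ powersetCard r (univ.erase x) |
        ¬ Disjoint U (insert y E) ∧ ¬ Disjoint U (insert z E)} := by
    ext U
    rw [mem_memberSubfamily, mem_familyJ, mem_filter, mem_powersetCard, subset_erase]
    simp only [disjoint_insert_right]
    constructor
    · rintro ⟨⟨h3, h4⟩, h5⟩
      rw [card_insert_of_notMem h5] at h3
      refine ⟨⟨⟨subset_univ _, h5⟩, by omega⟩, ?_⟩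
      rcases h4 with h4 | h4 | h4
      · obtain ⟨e, he⟩ := card_pos.1 (by omega : 0 < #E)
        have hex : e ≠ x := by rintro rfl; exact hxE he
        have : ¬ Disjoint U E :=
          not_disjoint_iff.2 ⟨e, (mem_insert.1 (h4.1 he)).resolve_left hex, he⟩
        tauto
      · have hy : y ∈ U := (mem_insert.1 (h4 (by simp))).resolve_left hxy.symm
        have hz : z ∈ U := (mem_insert.1 (h4 (by simp))).resolve_left hxz.symm
        tauto
      · have : ¬ Disjoint U E := fun hd => h4.2 (disjoint_insert_left.2 ⟨hxE, hd⟩)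
        tauto
    · rintro ⟨⟨⟨-, h4⟩, h5⟩, h6⟩
      refine ⟨⟨by rw [card_insert_of_notMem h4, h5], Or.inr ?_⟩, h4⟩
      by_cases hd : Disjoint U E
      · left
        intro w; simp only [mem_insert, mem_singleton]
        rintro (rfl | rfl | rfl) <;> tauto
      · exact Or.inr ⟨mem_insert_self _ _,
          fun hd' => hd (disjoint_of_subset_left (subset_insert _ _) hd')⟩
  have h3 : {F ∈ familyJ (r + 1) E {x, y, z} x | x ∉ F} = {insert y E, insert z E} := by
    ext F
    rw [mem_filter, mem_familyJ, mem_insert, mem_singleton]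
    constructor
    · rintro ⟨⟨h4, h5⟩, h6⟩
      have h7 : E ⊆ F ∧ (y ∈ F ∨ z ∈ F) := by
        rcases h5 with h5 | h5 | h5
        · simp only [disjoint_insert_right, disjoint_singleton_right] at h5
          exact ⟨h5.1, by tauto⟩
        · exact absurd (h5 (by simp)) h6
        · exact absurd h5.1 h6
      rcases h7.2 with h8 | h8
      · left
        refine (eq_of_subset_of_card_le (insert_subset h8 h7.1) ?_).symm
        rw [card_insert_of_notMem hyE, hE, h4]
      · right
        refine (eq_of_subset_of_card_le (insert_subset h8 h7.1) ?_).symm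
        rw [card_insert_of_notMem hzE, hE, h4]
    · rintro (rfl | rfl)
      · refine ⟨⟨by rw [card_insert_of_notMem hyE, hE], Or.inl ⟨subset_insert _ _, ?_⟩⟩, ?_⟩
        · exact not_disjoint_iff.2 ⟨y, by simp, by simp⟩
        · simp [hxy, hxE]
      · refine ⟨⟨by rw [card_insert_of_notMem hzE, hE], Or.inl ⟨subset_insert _ _, ?_⟩⟩, ?_⟩
        · exact not_disjoint_iff.2 ⟨z, by simp, by simp⟩
        · simp [hxz, hxE]
  have hne : insert y E ≠ insert z E := by
    intro h
    have : y ∈ insert z E := h ▸ mem_insert_self _ _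
    exact (mem_insert.1 this).elim hyz hyE
  have hs : ∀ w, x ≠ w → insert w E ⊆ univ.erase x := fun w hw =>
    subset_erase.2 ⟨subset_univ _, by simp [hw, hxE]⟩
  have h4 := card_filter_not_disjoint_two (hs y hxy) (hs z hxz) r
  have hu : #(insert y E ∪ insert z E) = r + 2 := by
    rw [show insert y E ∪ insert z E = insert y (insert z E) by ext; simp; tauto,
      card_insert_of_notMem (by simp [hyz, hyE]), card_insert_of_notMem hzE, hE]
  rw [h2, h3, card_pair hne] at h1
  rw [hVx, card_insert_of_notMem hyE, card_insert_of_notMem hzE, hE, hu,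
    show n - 1 - (r + 1) = n - 2 - r by omega, show n - 1 - (r + 2) = n - 3 - r by omega] at h4
  omega

theorem familyG_of_triple {X : Type*} [DecidableEq X] {F T : Finset X} {x : X} (hT : #T = 3) (hx : x ∈ T)
    (h : 2 ≤ #(F ∩ T)) : T.erase x ⊆ F ∨ (x ∈ F ∧ ¬ Disjoint F (T.erase x)) := by
  by_cases hxF : x ∈ F
  · refine Or.inr ⟨hxF, ?_⟩
    obtain ⟨y, hy, hyx⟩ := exists_mem_ne (by omega : 1 < #(F ∩ T)) x
    obtain ⟨h1, h2⟩ := mem_inter.1 hy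
    exact not_disjoint_iff.2 ⟨y, h1, mem_erase.2 ⟨hyx, h2⟩⟩
  · left
    have h1 : F ∩ T ⊆ T.erase x := fun y hy =>
      mem_erase.2 ⟨by rintro rfl; exact hxF (mem_inter.1 hy).1, (mem_inter.1 hy).2⟩
    rw [← eq_of_subset_of_card_le h1 (by rw [card_erase_of_mem hx, hT]; exact h)]
    exact inter_subset_left

/-- J consists of x and the two points in which D₁ and D₂ differ. A member through x that avoids D₁
∩ D₂ can meet D₁ and D₂ only in those points, so it contains J. -/
theorem subset_familyJ {r : ℕ} {H : Finset (Finset X)}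
    (hH : H ⊆ powersetCard (r + 1) univ) (h : CrossInt H H) {x : X} {D₁ D₂ : Finset X}
    (hD : {F ∈ H | x ∉ F} = {D₁, D₂}) (hc : #(D₁ ∩ D₂) = r) :
    ∃ J : Finset X, #J = 3 ∧ Disjoint (D₁ ∩ D₂) J ∧ x ∈ J ∧ H ⊆ familyJ (r + 1) (D₁ ∩ D₂) J x := by
  have hm1 : D₁ ∈ {F ∈ H | x ∉ F} := by rw [hD]; simp
  have hm2 : D₂ ∈ {F ∈ H | x ∉ F} := by rw [hD]; simp
  obtain ⟨-, h1c, h1H, h1x⟩ := missing_subset hH hm1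
  obtain ⟨-, h2c, h2H, h2x⟩ := missing_subset hH hm2
  have e1 := card_inter_add_card_sdiff D₁ D₂
  have e2 := card_inter_add_card_sdiff D₂ D₁
  rw [inter_comm] at e2
  obtain ⟨y, hy⟩ := card_eq_one.1 (by omega : #(D₁ \ D₂) = 1)
  obtain ⟨z, hz⟩ := card_eq_one.1 (by omega : #(D₂ \ D₁) = 1)
  have hy' : ∀ w, w ∈ D₁ → w ∉ D₂ → w = y := fun w h1 h2 => by
    rw [← mem_singleton, ← hy]; exact mem_sdiff.2 ⟨h1, h2⟩
  have hz' : ∀ w, w ∈ D₂ → w ∉ D₁ → w = z := fun w h1 h2 => by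
    rw [← mem_singleton, ← hz]; exact mem_sdiff.2 ⟨h1, h2⟩
  obtain ⟨hy1, hy2⟩ := mem_sdiff.1 (hy ▸ mem_singleton_self y : y ∈ D₁ \ D₂)
  obtain ⟨hz1, hz2⟩ := mem_sdiff.1 (hz ▸ mem_singleton_self z : z ∈ D₂ \ D₁)
  have hyz : y ≠ z := by rintro rfl; exact hy2 hz1
  have hxy : x ≠ y := by rintro rfl; exact h1x hy1
  have hxz : x ≠ z := by rintro rfl; exact h2x hz1
  refine ⟨{x, y, z}, ?_, ?_, by simp, fun F hF => mem_familyJ.2 ⟨sized_of_subset hH F hF, ?_⟩⟩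
  · rw [card_insert_of_notMem (by simp [hxy, hxz]), card_pair hyz]
  · simp only [disjoint_insert_right, disjoint_singleton_right, mem_inter]
    tauto
  · by_cases hxF : x ∈ F
    · by_cases hd : Disjoint F (D₁ ∩ D₂)
      · right; left
        obtain ⟨u, hu1, hu2⟩ := not_disjoint_iff.1 (h F hF _ h1H)
        obtain ⟨v, hv1, hv2⟩ := not_disjoint_iff.1 (h F hF _ h2H)
        obtain rfl := hy' u hu2 fun hu => disjoint_left.1 hd hu1 (mem_inter.2 ⟨hu2, hu⟩)
        obtain rfl := hz' v hv2 fun hv => disjoint_left.1 hd hv1 (mem_inter.2 ⟨hv, hv2⟩)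
        intro w; simp only [mem_insert, mem_singleton]
        rintro (rfl | rfl | rfl) <;> assumption
      · exact Or.inr (Or.inr ⟨hxF, hd⟩)
    · left
      have : F ∈ {F ∈ H | x ∉ F} := mem_filter.2 ⟨hF, hxF⟩
      rw [hD, mem_insert, mem_singleton] at this
      rcases this with rfl | rfl
      · exact ⟨inter_subset_left, not_disjoint_iff.2 ⟨y, hy1, by simp⟩⟩
      · exact ⟨inter_subset_right, not_disjoint_iff.2 ⟨z, hz1, by simp⟩⟩

theorem nonTrivial_of_not_subS {r : ℕ} {H : Finset (Finset X)}
    (hH : H ⊆ powersetCard (r + 1) univ) (h : CrossInt H H)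
    (hF₀ : ∀ 𝓕 : Finset (Finset X), IsF₀ (r + 1) 𝓕 → ¬ SubS H 𝓕)
    (hF₁ : ∀ 𝓕 : Finset (Finset X), IsF₁ (r + 1) 𝓕 → ¬ SubS H 𝓕)
    (hG₂ : r = 2 → ∀ 𝓕 : Finset (Finset X), IsG 3 2 𝓕 → ¬ SubS H 𝓕) : NonTrivial r H := by
  have uH := sized_of_subset hH
  refine ⟨fun x => ?_, ?_⟩
  · by_contra! hlt
    by_cases h0 : #{F ∈ H | x ∉ F} = 0
    · rw [card_eq_zero, filter_eq_empty_iff] at h0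
      refine hF₀ (star (r + 1) x) ⟨x, Iso.refl _⟩ (SubS.of_subset fun F hF => ?_)
      exact mem_filter.2 ⟨hH hF, not_not.1 (h0 hF)⟩
    · obtain ⟨D, hD⟩ := card_eq_one.1 (by omega : #{F ∈ H | x ∉ F} = 1)
      have hm : D ∈ {F ∈ H | x ∉ F} := by rw [hD]; simp
      obtain ⟨hDH, hxD⟩ := mem_filter.1 hm
      refine hF₁ (hiltonMilner (r + 1) D x) ⟨D, x, uH D hDH, hxD, Iso.refl _⟩
        (SubS.of_subset fun F hF => ?_)
      rw [hiltonMilner, mem_insert, mem_filter]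
      by_cases hxF : x ∈ F
      · exact Or.inr ⟨hH hF, hxF, not_disjoint_iff_nonempty_inter.1 (h D hDH F hF)⟩
      · left
        have : F ∈ {F ∈ H | x ∉ F} := mem_filter.2 ⟨hF, hxF⟩
        rwa [hD, mem_singleton] at this
  · rintro rfl T hT
    by_contra! hcon
    obtain ⟨x, hx⟩ := card_pos.1 (by omega : 0 < #T)
    refine hG₂ rfl (familyG 3 (T.erase x) x) ⟨T.erase x, x, by rw [card_erase_of_mem hx, hT],
      notMem_erase _ _, Iso.refl _⟩ (SubS.of_subset fun F hF => ?_)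
    exact mem_familyG.2 ⟨uH F hF, familyG_of_triple hT hx (hcon F hF)⟩

theorem bound_eq {n r : ℕ} (hr : 1 ≤ r) (hn : r + 3 ≤ n) :
    bound n (r + 1) + 2 * ((n - 2 - r).choose r : ℤ) =
      ((n - 1).choose r : ℤ) + ((n - 3 - r).choose r : ℤ) + 2 := by
  obtain ⟨s, rfl⟩ : ∃ s, r = s + 1 := ⟨r - 1, by omega⟩
  have h : (n - 3 - (s + 1) + 1).choose (s + 1) =
      (n - 3 - (s + 1)).choose s + (n - 3 - (s + 1)).choose (s + 1) := Nat.choose_succ_succ _ _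
  rw [show n - 3 - (s + 1) + 1 = n - 2 - (s + 1) by omega] at h
  unfold bound
  rw [show s + 1 + 1 - 1 = s + 1 by omega, show s + 1 + 1 - 2 = s by omega,
    show n - (s + 1 + 1) - 1 = n - 2 - (s + 1) by omega,
    show n - (s + 1 + 1) - 2 = n - 3 - (s + 1) by omega, h]
  push_cast
  ring

end Families

end BeyondHM

theorem mainTheorem1 {X : Type*} [Fintype X] [DecidableEq X] (n k : ℕ)
    (hX : Fintype.card X = n) (hk : 3 ≤ k) (hn : 2 * k < n)
    (𝓗 : Finset (Finset X))
    (hunif : (𝓗 : Set (Finset X)).Sized k)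
    (hint : (𝓗 : Set (Finset X)).Intersecting)
    (hF₀ : ∀ 𝓕 : Finset (Finset X), BeyondHM.IsF₀ k 𝓕 → ¬ BeyondHM.SubS 𝓗 𝓕)
    (hF₁ : ∀ 𝓕 : Finset (Finset X), BeyondHM.IsF₁ k 𝓕 → ¬ BeyondHM.SubS 𝓗 𝓕)
    (hG₂ : k = 3 → ∀ 𝓕 : Finset (Finset X), BeyondHM.IsG k 2 𝓕 → ¬ BeyondHM.SubS 𝓗 𝓕) :
    (𝓗.card : ℤ) ≤ BeyondHM.bound n k ∧
    (k = 4 → ((𝓗.card : ℤ) = BeyondHM.bound n k ↔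
      BeyondHM.IsJ k 2 𝓗 ∨ BeyondHM.IsG k 2 𝓗 ∨ BeyondHM.IsG k 3 𝓗)) ∧
    (k ≠ 4 → ((𝓗.card : ℤ) = BeyondHM.bound n k ↔ BeyondHM.IsJ k 2 𝓗)) := by
  obtain ⟨r, rfl⟩ : ∃ r, k = r + 1 := ⟨k - 1, by omega⟩
  have hr : 2 ≤ r := by omega
  have hV : #(univ : Finset X) = n := by rw [card_univ, hX]
  have hH : 𝓗 ⊆ powersetCard (r + 1) univ := fun F hF =>
    mem_powersetCard.2 ⟨subset_univ _, hunif hF⟩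
  have hcr : BeyondHM.CrossInt 𝓗 𝓗 := fun F hF G hG => hint hF hG
  have hnt := BeyondHM.nonTrivial_of_not_subS hH hcr hF₀ hF₁ (by
    rintro rfl; exact hG₂ rfl)
  have hb := BeyondHM.bound_eq (by omega : 1 ≤ r) (by omega : r + 3 ≤ n)
  have hmain : #𝓗 + 2 * (n - 2 - r).choose r ≤ (n - 1).choose r + (n - 3 - r).choose r + 2 ∧
      (#𝓗 + 2 * (n - 2 - r).choose r = (n - 1).choose r + (n - 3 - r).choose r + 2 →
        BeyondHM.ExtremalShape r univ 𝓗) := by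
    by_cases hcov : BeyondHM.Covered 𝓗
    · exact BeyondHM.covered_card_le hV hr hn hH hcr hnt hcov
    · have := BeyondHM.card_lt_of_not_covered hV hr hn hH hcr hnt hcov
      exact ⟨this.le, fun h => absurd h this.ne⟩
  have heq : (#𝓗 : ℤ) = BeyondHM.bound n (r + 1) ↔
      #𝓗 + 2 * (n - 2 - r).choose r = (n - 1).choose r + (n - 3 - r).choose r + 2 := by omega
  have ofJ : BeyondHM.IsJ (r + 1) 2 𝓗 → (#𝓗 : ℤ) = BeyondHM.bound n (r + 1) := by
    rintro ⟨E, J, x, hE, hJ, hEJ, hx, hiso⟩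
    rw [heq, hiso.card_eq]
    exact BeyondHM.card_familyJ hX hr hE hJ hEJ hx
  -- The family lies in a copy of 𝒥₂ of the same size, so it is that copy.
  have toJ : ∀ x : X, ∀ D₁ D₂ : Finset X, {F ∈ 𝓗 | x ∉ F} = {D₁, D₂} → #(D₁ ∩ D₂) = r →
      #𝓗 + 2 * (n - 2 - r).choose r = (n - 1).choose r + (n - 3 - r).choose r + 2 →
      BeyondHM.IsJ (r + 1) 2 𝓗 := by
    intro x D₁ D₂ hD hc he
    obtain ⟨J, hJ, hEJ, hx, hsub⟩ := BeyondHM.subset_familyJ hH hcr hD hc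
    have hcard := BeyondHM.card_familyJ hX hr hc hJ hEJ hx
    have := eq_of_subset_of_card_le hsub (by omega)
    exact ⟨_, J, x, hc, hJ, hEJ, hx, by rw [← this]; exact BeyondHM.Iso.refl _⟩
  refine ⟨by omega, fun h4 => ?_, fun h4 => ?_⟩
  · obtain rfl : r = 3 := by omega
    have e1 : n - 2 - 3 = n - 5 := by omega
    have e2 : n - 3 - 3 = n - 6 := by omega
    constructor
    · intro h
      have h' := heq.1 h
      rcases hmain.2 h' with ⟨x, -, D₁, D₂, -, hD, hc⟩ | ⟨-, T, -, hT, hT2⟩ |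
        ⟨-, E, -, x, -, hE, hxE, hEx⟩
      · exact Or.inl (toJ x D₁ D₂ hD hc h')
      · right; left
        -- Meeting T twice is symmetric in the three points of T, so any of them can serve as the
        -- centre of 𝒢₂.
        obtain ⟨x, hx⟩ := card_pos.1 (by omega : 0 < #T)
        have hc : #(T.erase x) = 2 := by rw [card_erase_of_mem hx, hT]
        have hcard := BeyondHM.card_familyG_two hX (by omega) hc (notMem_erase x T)
        have hsub : 𝓗 ⊆ BeyondHM.familyG 4 (T.erase x) x := fun F hF =>
          BeyondHM.mem_familyG.2 ⟨hunif hF, BeyondHM.familyG_of_triple hT hx (hT2 F hF)⟩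
        rw [e1, e2] at h'
        have := eq_of_subset_of_card_le hsub (by omega)
        exact ⟨_, x, hc, notMem_erase _ _, by rw [← this]; exact BeyondHM.Iso.refl _⟩
      · right; right
        have hcard := BeyondHM.card_familyG_three hX (by omega) hE hxE
        have hsub : 𝓗 ⊆ BeyondHM.familyG 4 E x := fun F hF =>
          BeyondHM.mem_familyG.2 ⟨hunif hF, hEx F hF⟩
        rw [e1, e2] at h'
        have := eq_of_subset_of_card_le hsub (by omega)
        exact ⟨_, x, hE, hxE, by rw [← this]; exact BeyondHM.Iso.refl _⟩
    · rintro (h | ⟨E, x, hE, hx, hiso⟩ | ⟨E, x, hE, hx, hiso⟩)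
      · exact ofJ h
      · rw [heq, hiso.card_eq, e1, e2]
        exact BeyondHM.card_familyG_two hX (by omega) hE hx
      · rw [heq, hiso.card_eq, e1, e2]
        exact BeyondHM.card_familyG_three hX (by omega) hE hx
  · refine ⟨fun h => ?_, ofJ⟩
    have h' := heq.1 h
    rcases hmain.2 h' with ⟨x, -, D₁, D₂, -, hD, hc⟩ | ⟨h3, -⟩ | ⟨h3, -⟩
    · exact toJ x D₁ D₂ hD hc h'
    · omega
    · omega
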